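/- Let $d\ge 1$, let $V\ge 0$ be a potential in $L^2_{\rm loc}(\mathbb R^d)$ with $V(x)\to+\infty$ as $|x|\to+\infty$, let $H=-\Delta+V$ on $L^2(\mathbb R^d)$, and let $\lambda_0$ be the smallest eigenvalue of $H$. Let $a_0>0$, and let $\beta\in C^0([0,a_0])$ be strictly convex with $\beta(0)=0$. A density operator is a positive trace class operator $\varrho=\sum_p\rho_p|\phi_p\rangle\langle\phi_p|$ on $L^2(\mathbb R^d)$, with $(\phi_p)$ orthonormal; $\mathcal E^+$ is the set of density operators with $\operatorname{Tr}(\sqrt{-\Delta}\,\varrho\sqrt{-\Delta})=\sum_p\rho_p\|\nabla\phi_p\|_{L^2}^2<\infty$. For $\varrho \in\mathcal E^+$ put $$n[\varrho]=\sum_p\rho_p|\phi_p|^2,\quad u[\varrho]=\sum_p\rho_p\,\Im(\phi_p^*\nabla\phi_p),\quad k[\varrho]=\sum_p\rho_p|\nabla\phi_p|^2,\quad e[\varrho]=k[\varrho]+V\,n[\varrho],$$ $$S(\varrho)=\operatorname{Tr}(\beta(\varrho)),\qquad E(\varrho)=\operatorname{Tr}(\sqrt H\varrho\sqrt H)=\sum_p\rho_p\|\sqrt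 H\phi_p\|_{L^2}^2\in[0,\infty],\qquad F_T(\varrho)=E(\varrho)+T\,S(\varrho).$$ Let $\mathcal S(a_0)=\{\varrho\in\mathcal E^+:\operatorname{Tr}\varrho=a_0\}$ and, for $b_0\in\mathbb R^d$ and $c\in\mathbb R$, $$\mathcal S(a_0,b_0,c)=\Big\{\varrho\in\mathcal E^+:\ \int_{\mathbb R^d} n[\varrho]\,dx=a_0,\ \int_{\mathbb R^d} u[\varrho]\,dx=b_0,\ \int_{\mathbb R^d} e[\varrho]\,dx=c\Big\}.$$ Assume (monotonicity with respect to the temperature) that there is $T_c\ge0$ such that for every $T>T_c$ the free energy $F_T$ has a unique minimizer $\varrho_T$ among the states of $\mathcal S(a_0)$ with finite energy $E$, that $u[\varrho_T]=0$, that on $(T_c,\infty)$ the map $T\mapsto E(\varrho_T)$ is continuous and strictly increasing and $T\mapsto S(\varrho_T)$ is continuous and strictly decreasing, and that $\lim_{T\to+\infty}E(\varrho_T)=+\infty$ and $\lim_{T\to T_c^+}E(\varrho_T)=\lambda_0a_0$. Call $\varrho\in\mathcal S(a_0)$ with $E(\varrho)<\infty$ a generalized Gibbs state at temperature $T\in[T_c,\infty)$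 if $T>T_c$ and $\varrho=\varrho_T$, or if $T=T_c$ and $\varrho$ minimizes $E$ on $\mathcal S(a_0)$. Then for every $b_0\in\mathbb R^d$ and every $c\ge a_0\lambda_0+|b_0|^2/a_0$, the entropy $S$ has a unique minimizer on $\mathcal S(a_0,b_0,c)$. Moreover, there is exactly one $T\in[T_c,\infty)$ at which there is a generalized Gibbs state $\varrho$ with $E(\varrho)+|b_0|^2/a_0=c$, and for one such $\varrho$ at this temperature the minimizer is $$e^{ix\cdot b_0/a_0}\,\varrho\,e^{-ix\cdot b_0/a_0}.$$ -/

import Mathlib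

open MeasureTheory Set Filter Topology
open scoped ENNReal SchwartzMap LineDeriv

noncomputable section

namespace QuantumEntropy

/-! ### The one-particle Hilbert space and weak gradients -/

/-- The configuration space `ℝ^d`. -/
abbrev Space (d : ℕ) : Type := EuclideanSpace ℝ (Fin d)

/-- The Hilbert space `L²(ℝ^d)` of complex-valued functions. -/
abbrev L2 (d : ℕ) : Type := Lp ℂ 2 (volume : Measure (Space d))

/-- Bounded operators on `L²(ℝ^d)`. -/
abbrev Op (d : ℕ) : Type := L2 d →L[ℂ] L2 d

/-- `g = (g_1, …, g_d) ∈ L²(ℝ^d)^d` is the weak gradient of `φ ∈ L²(ℝ^d)`: the derivative of `φ`,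
as a tempered distribution, in the direction of the `j`-th basis vector is `g_j`. -/
def HasWeakGrad {d : ℕ} (φ : L2 d) (g : Fin d → L2 d) : Prop :=
  ∀ j, ∂_{(EuclideanSpace.single j (1 : ℝ) : Space d)} (φ : 𝓢'(Space d, ℂ)) = (g j : 𝓢'(Space d, ℂ))

/-- Membership in the Sobolev space `H¹(ℝ^d)`. -/
def InH1 {d : ℕ} (φ : L2 d) : Prop := ∃ g, HasWeakGrad φ g

/-- The weak gradient of `φ ∈ H¹(ℝ^d)` (it is unique; no meaning outside of `H¹`). -/
def grad {d : ℕ} (φ : L2 d) : Fin d → L2 d := Classical.epsilon (HasWeakGrad φ)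

/-! ### The quadratic forms of `H₀ = -Δ` and `H = -Δ + V` -/

open Classical in
/-- `‖√H₀ φ‖² = ‖∇φ‖²` for `φ ∈ H¹(ℝ^d) = D(√H₀)`, and `∞` otherwise. -/
def kineticForm {d : ℕ} (φ : L2 d) : ℝ≥0∞ :=
  if InH1 φ then ∑ j, ‖grad φ j‖ₑ ^ 2 else ⊤

/-- `‖√H φ‖² = ‖∇φ‖² + ∫ V |φ|²` for `φ` in the form domain `D(√H)` of `H = -Δ + V`, `V ≥ 0`,
and `∞` otherwise. -/
def energyForm {d : ℕ} (V : Space d → ℝ) (φ : L2 d) : ℝ≥0∞ :=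
  kineticForm φ + ∫⁻ x, ENNReal.ofReal (V x) * ‖φ x‖ₑ ^ 2

/-- `lam` is an eigenvalue of the self-adjoint operator `H = -Δ + V` associated with the form
`energyForm V`: some `φ ≠ 0` in the form domain satisfies `⟨√H ψ, √H φ⟩ = lam ⟨ψ, φ⟩` for every
`ψ` in the form domain, that is, `φ ∈ D(H)` and `H φ = lam φ`. -/
def IsEigenvalue {d : ℕ} (V : Space d → ℝ) (lam : ℝ) : Prop :=
  ∃ φ : L2 d, φ ≠ 0 ∧ energyForm V φ < ⊤ ∧ ∀ ψ : L2 d, energyForm V ψ < ⊤ →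
    ∑ j, inner ℂ (grad ψ j) (grad φ j) + ∫ x, (V x : ℂ) * (starRingEnd ℂ (ψ x) * φ x)
      = (lam : ℂ) * inner ℂ ψ φ

/-- `λ₀`, the smallest eigenvalue of `H = -Δ + V`. -/
def groundEnergy {d : ℕ} (V : Space d → ℝ) : ℝ := sInf {lam : ℝ | IsEigenvalue V lam}

/-! ### Traces, entropy and density operators -/

/-- The trace `∑ᵢ ⟨eᵢ, A eᵢ⟩ ∈ [0, ∞]` of a positive bounded operator on a Hilbert space, computed
in some Hilbert basis `(eᵢ)`, on which it does not depend. -/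
def posTrace {H : Type*} [NormedAddCommGroup H] [InnerProductSpace ℂ H] [CompleteSpace H]
    (A : H →L[ℂ] H) : ℝ≥0∞ :=
  ∑' e : (Classical.choose (exists_hilbertBasis ℂ H) : Set H),
    ENNReal.ofReal (inner ℂ (e : H) (A (e : H))).re

/-- The trace `Tr A = Tr A⁺ - Tr A⁻` of a self-adjoint bounded operator, in the extended sense
(meaningful as soon as one of the two terms is finite). -/
def saTrace {H : Type*} [NormedAddCommGroup H] [InnerProductSpace ℂ H] [CompleteSpace H]
    (A : H →L[ℂ] H) : EReal :=
  (posTrace A⁺ : EReal) - (posTrace A⁻ : EReal)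

/-- Entropy `S(ϱ) = Tr (β(ϱ))`, with `β(ϱ)` given by the continuous functional calculus. For `β`
convex with `β(0) = 0`, the positive part of `β(ϱ)` is trace class, so `S(ϱ) ∈ [-∞, ∞)`. -/
def entropy {H : Type*} [NormedAddCommGroup H] [InnerProductSpace ℂ H] [CompleteSpace H]
    (β : ℝ → ℝ) (ϱ : H →L[ℂ] H) : EReal :=
  saTrace (cfc β ϱ)

/-- A density operator: a positive (hence self-adjoint), trace class operator on `L²(ℝ^d)`. -/
def IsDensityOperator {d : ℕ} (ϱ : Op d) : Prop := ϱ.IsPositive ∧ posTrace ϱ < ⊤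

/-- The sequences `D.1 = (ρ_p)` of nonnegative eigenvalues and `D.2 = (φ_p)` of orthonormal
eigenvectors diagonalize `ϱ`, i.e. `ϱ = ∑_p ρ_p |φ_p⟩⟨φ_p|`; the `ρ_p` are completed by zeros
if the rank is finite. The quantities below do not depend on the enumeration. -/
def IsSpectralDecomposition {d : ℕ} (ϱ : Op d) (D : (ℕ → ℝ) × (ℕ → L2 d)) : Prop :=
  (∀ p, 0 ≤ D.1 p) ∧ Orthonormal ℂ D.2 ∧
    ∀ f, HasSum (fun p => ((D.1 p : ℂ) * inner ℂ (D.2 p) f) • D.2 p) (ϱ f)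

/-- The eigenvalues `ρ_p` of a density operator, counted with multiplicity. -/
def eigval {d : ℕ} (ϱ : Op d) : ℕ → ℝ := (Classical.epsilon (IsSpectralDecomposition ϱ)).1

/-- The corresponding orthonormal eigenvectors `φ_p`. -/
def eigvec {d : ℕ} (ϱ : Op d) : ℕ → L2 d := (Classical.epsilon (IsSpectralDecomposition ϱ)).2

/-- `Tr (√A ϱ √A) = ∑_p ρ_p ‖√A φ_p‖²` for a density operator `ϱ` and a nonnegative self-adjoint
operator `A` with quadratic form `q φ = ‖√A φ‖²`, `q φ = ∞` for `φ ∉ D(√A)`. -/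
def formTrace {d : ℕ} (q : L2 d → ℝ≥0∞) (ϱ : Op d) : ℝ≥0∞ :=
  ∑' p, ENNReal.ofReal (eigval ϱ p) * q (eigvec ϱ p)

/-- The energy space `𝓔⁺`: density operators with `Tr (√H₀ ϱ √H₀) < ∞`. -/
def energySpace (d : ℕ) : Set (Op d) :=
  {ϱ | IsDensityOperator ϱ ∧ formTrace kineticForm ϱ < ⊤}

/-! ### Local density, current and energies -/

/-- Local density `n[ϱ] = ∑_p ρ_p |φ_p|²`. -/
def density {d : ℕ} (ϱ : Op d) (x : Space d) : ℝ≥0∞ :=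
  ∑' p, ENNReal.ofReal (eigval ϱ p) * ‖eigvec ϱ p x‖ₑ ^ 2

/-- Local current `u[ϱ] = ∑_p ρ_p Im (φ_p^* ∇φ_p)`. -/
def current {d : ℕ} (ϱ : Op d) (x : Space d) : Space d :=
  WithLp.toLp 2 fun j =>
    ∑' p, eigval ϱ p * (starRingEnd ℂ (eigvec ϱ p x) * grad (eigvec ϱ p) j x).im

/-- Local kinetic energy `k[ϱ] = ∑_p ρ_p |∇φ_p|²`. -/
def kineticDensity {d : ℕ} (ϱ : Op d) (x : Space d) : ℝ≥0∞ :=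
  ∑' p, ENNReal.ofReal (eigval ϱ p) * ∑ j, ‖grad (eigvec ϱ p) j x‖ₑ ^ 2

/-- Local total energy `e[ϱ] = k[ϱ] + V n[ϱ]`. -/
def energyDensity {d : ℕ} (V : Space d → ℝ) (ϱ : Op d) (x : Space d) : ℝ≥0∞ :=
  kineticDensity ϱ x + ENNReal.ofReal (V x) * density ϱ x

/-! ### Energy and free energy -/

/-- Total energy `E(ϱ) = Tr (√H ϱ √H)`, with `H = -Δ + V`. -/
def energy {d : ℕ} (V : Space d → ℝ) (ϱ : Op d) : ℝ≥0∞ := formTrace (energyForm V) ϱ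

/-- Free energy `F_T(ϱ) = E(ϱ) + T S(ϱ)` (used for states with finite energy). -/
def freeEnergy {d : ℕ} (V : Space d → ℝ) (β : ℝ → ℝ) (T : ℝ) (ϱ : Op d) : EReal :=
  (energy V ϱ : EReal) + (T : EReal) * entropy β ϱ

/-! ### Sets of states with global constraints -/

/-- `𝓢(a)`: states in `𝓔⁺` with trace `a`. -/
def statesTrace (d : ℕ) (a : ℝ) : Set (Op d) :=
  {ϱ | ϱ ∈ energySpace d ∧ posTrace ϱ = ENNReal.ofReal a}

/-- The states in `𝓢(a)` with finite total energy, where `F_T` is well-defined. -/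
def statesFinite {d : ℕ} (V : Space d → ℝ) (a : ℝ) : Set (Op d) :=
  {ϱ | ϱ ∈ statesTrace d a ∧ energy V ϱ < ⊤}

/-- `𝓢(a, b, c)`: states in `𝓔⁺` with total density `a`, total current `b ∈ ℝ^d` and total
energy `c`. -/
def statesGlobal {d : ℕ} (V : Space d → ℝ) (a : ℝ) (b : Space d) (c : ℝ) : Set (Op d) :=
  {ϱ | ϱ ∈ energySpace d ∧ ∫⁻ x, density ϱ x = ENNReal.ofReal a ∧ ∫ x, current ϱ x = b ∧
    ∫⁻ x, energyDensity V ϱ x = ENNReal.ofReal c}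

/-- `ϱ` is the unique minimizer of `f` on `s`. -/
def IsUniqueMinimizer {α β : Type*} [Preorder β] (f : α → β) (s : Set α) (x : α) : Prop :=
  (x ∈ s ∧ IsMinOn f s x) ∧ ∀ y ∈ s, IsMinOn f s y → y = x

/-- Monotonicity with respect to the temperature, for the critical temperature `Tc` and the
family `T ↦ ρ T`, `T > Tc`, of the minimizers of the free energies `F_T` on `𝓢(a)`. -/
structure MonotoneInTemperature {d : ℕ} (V : Space d → ℝ) (β : ℝ → ℝ) (a Tc : ℝ)
    (ρ : ℝ → Op d) : Prop where
  Tc_nonneg : 0 ≤ Tc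
  minimizer : ∀ T, Tc < T → IsUniqueMinimizer (freeEnergy V β T) (statesFinite V a) (ρ T)
  current_eq_zero : ∀ T, Tc < T → ∀ᵐ x, current (ρ T) x = 0
  energy_continuous : ContinuousOn (fun T => energy V (ρ T)) (Ioi Tc)
  energy_strictMono : StrictMonoOn (fun T => energy V (ρ T)) (Ioi Tc)
  entropy_continuous : ContinuousOn (fun T => entropy β (ρ T)) (Ioi Tc)
  entropy_strictAnti : StrictAntiOn (fun T => entropy β (ρ T)) (Ioi Tc)
  energy_atTop : Tendsto (fun T => energy V (ρ T)) atTop (𝓝 ⊤)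
  energy_Tc : Tendsto (fun T => energy V (ρ T)) (𝓝[>] Tc) (𝓝 (ENNReal.ofReal (groundEnergy V * a)))

/-- `ϱ` is a generalized Gibbs state with trace `a` at temperature `T ∈ [Tc, ∞)`: a minimizer on
`𝓢(a)` of the free energy `F_T` if `T > Tc`, and of the energy `E` alone at the end point
`T = Tc`. -/
def IsGibbsState {d : ℕ} (V : Space d → ℝ) (β : ℝ → ℝ) (a Tc T : ℝ) (ϱ : Op d) : Prop :=
  ϱ ∈ statesFinite V a ∧
    ((Tc < T ∧ IsMinOn (freeEnergy V β T) (statesFinite V a) ϱ) ∨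
      (T = Tc ∧ IsMinOn (energy V) (statesFinite V a) ϱ))

/-! ### The gauge transformation -/

lemma memLp_phase {d : ℕ} (b : Space d) :
    MemLp (fun x : Space d => Complex.exp (Complex.I * ((inner ℝ b x : ℝ) : ℂ))) ∞ volume := by
  refine memLp_top_of_bound (Continuous.aestronglyMeasurable (by fun_prop)) 1 ?_
  refine Eventually.of_forall fun x => ?_
  rw [mul_comm, Complex.norm_exp_ofReal_mul_I]

/-- The function `x ↦ e^{i x·b}`, as an element of `L^∞(ℝ^d)`. -/
def phase {d : ℕ} (b : Space d) : Lp ℂ ∞ (volume : Measure (Space d)) := (memLp_phase b).toLp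

/-- Multiplication by `e^{i x·b}` on `L²(ℝ^d)`. -/
def phaseOp {d : ℕ} (b : Space d) : Op d :=
  (ContinuousLinearMap.mul ℂ ℂ).holderL volume ∞ 2 2 (phase b)

/-- The gauge transformation `G_b(ϱ) = e^{i x·b} ϱ e^{-i x·b}`. -/
def gauge {d : ℕ} (b : Space d) (ϱ : Op d) : Op d := phaseOp b ∘L ϱ ∘L phaseOp (-b)

end QuantumEntropy

end

/-! The current is removed by a change of frame. Conjugation by `e^{ix·k}` is unitary, so it
preserves trace and entropy; it adds `a k` to the total current `J` and changes the energy by `2 k·J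
+ a|k|²`. With `k = -b/a`, a state of `𝓢(a,b,c)` becomes a state of trace `a` and energy `e = c -
|b|²/a`. It therefore suffices to find a state of zero total current that minimizes the entropy,
uniquely, among all states of trace `a` and energy `e`; `isUniqueMinimizer_gauge` carries the result
back.

If `e > λ₀ a`, the intermediate value theorem gives `T > Tc` with `E(ρ_T) = e`. At fixed energy, and
since `T > 0`, comparing `F_T` is comparing `S`, so `ρ_T` is the minimizer. If `e = λ₀ a`, the
admissible states are those supported in the ground eigenspace `G`, and strict convexity (Jensen)
singles out `(a / dim G) P_G`; its current vanishes, as otherwise a boost would lower its energy.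
Strict monotonicity of `E(ρ_T)`, and its limit at `Tc`, make the temperature unique.

The second case needs `λ₀` to be attained, to bound the form from below and to have finite
multiplicity. All this is drawn from a single minimizer `ϱ = ρ_T`. Its entropy is finite and
unitarily invariant, so `ϱ` has least energy in its unitary orbit, and any conjugate of equal energy
is `ϱ` itself. Conjugating by the reflection along `v` turns this into an inequality quadratic in
both the form and the state, with equality only if `v` is an eigenvector of `ϱ`
(`exists_reflectionMinimal`). Its first variation makes the top eigenspace `W` of `ϱ` orthogonal,
for the energy form, to the rest of the form domain. Its second variation shows that no vector
orthogonal to `W` has less energy than a unit vector of `W`. The bottom of the form is thus reached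
in the finite-dimensional `W`, and the equality case puts every ground state in `W`
(`exists_ground_state`). -/

namespace QuantumEntropy

/-! ### Traces of positive operators, and compactness from finite trace -/

section Trace

variable {H : Type*} [NormedAddCommGroup H] [InnerProductSpace ℂ H]

lemma tsum_enorm_inner_sq {ι : Type*} (e : HilbertBasis ι ℂ H) (x : H) :
    ∑' i, ‖inner ℂ (e i) x‖ₑ ^ 2 = ‖x‖ₑ ^ 2 := by
  have h := (e.hasSum_inner_mul_inner x x).mapL Complex.reCLM
  have h2 : HasSum (fun i => ‖inner ℂ (e i) x‖ ^ 2) (‖x‖ ^ 2) := by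
    convert h using 1
    · ext i
      rw [← inner_conj_symm x (e i), mul_comm, Complex.mul_conj, Complex.normSq_eq_norm_sq]
      exact (Complex.ofReal_re _).symm
    · rw [inner_self_eq_norm_sq_to_K]
      simp [← Complex.ofReal_pow]
  have h3 : ∀ y : ℂ, ‖y‖ₑ ^ 2 = ENNReal.ofReal (‖y‖ ^ 2) := fun y => by
    rw [ENNReal.ofReal_pow (norm_nonneg _), ofReal_norm]
  simp_rw [h3]
  rw [← ENNReal.ofReal_tsum_of_nonneg (fun i => by positivity) h2.summable, h2.tsum_eq,
    ENNReal.ofReal_pow (norm_nonneg _), ofReal_norm]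

lemma enorm_inner_symm (x y : H) : ‖inner ℂ x y‖ₑ = ‖inner ℂ y x‖ₑ := by
  rw [← ofReal_norm, ← ofReal_norm, norm_inner_symm]

/-- Both sides are the double sum of `|⟨f_j, B e_i⟩|²`, by Parseval in one basis or the other.
Applied to a square root, this makes the trace independent of the basis. -/
lemma tsum_enorm_sq_symm {ι κ : Type*} (e : HilbertBasis ι ℂ H) (f : HilbertBasis κ ℂ H)
    {B : H →L[ℂ] H} (hB : ∀ x y, inner ℂ (B x) y = inner ℂ x (B y)) :
    ∑' i, ‖B (e i)‖ₑ ^ 2 = ∑' j, ‖B (f j)‖ₑ ^ 2 := by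
  calc ∑' i, ‖B (e i)‖ₑ ^ 2 = ∑' i, ∑' j, ‖inner ℂ (f j) (B (e i))‖ₑ ^ 2 := by
        simp_rw [tsum_enorm_inner_sq f]
    _ = ∑' j, ∑' i, ‖inner ℂ (f j) (B (e i))‖ₑ ^ 2 := ENNReal.tsum_comm
    _ = ∑' j, ∑' i, ‖inner ℂ (e i) (B (f j))‖ₑ ^ 2 := by
        simp_rw [fun i j => enorm_inner_symm (e i) (B (f j)), hB]
    _ = _ := by simp_rw [tsum_enorm_inner_sq e]

variable [CompleteSpace H]

lemma exists_sqrt {A : H →L[ℂ] H} (hA : A.IsPositive) :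
    ∃ B : H →L[ℂ] H, (∀ x y, inner ℂ (B x) y = inner ℂ x (B y)) ∧ ∀ x, A x = B (B x) := by
  have h0 : 0 ≤ A := (ContinuousLinearMap.nonneg_iff_isPositive A).2 hA
  refine ⟨CFC.sqrt A, ?_, fun x => ?_⟩
  · have : (CFC.sqrt A).IsPositive :=
      (ContinuousLinearMap.nonneg_iff_isPositive _).1 (CFC.sqrt_nonneg A)
    exact fun x y => this.isSymmetric x y
  · conv_lhs => rw [← CFC.sqrt_mul_sqrt_self A h0]
    rfl

lemma exists_enorm_sq_eq {A : H →L[ℂ] H} (hA : A.IsPositive) :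
    ∃ B : H →L[ℂ] H, (∀ x y, inner ℂ (B x) y = inner ℂ x (B y)) ∧ (∀ x, A x = B (B x)) ∧
      ∀ x, ENNReal.ofReal (inner ℂ x (A x)).re = ‖B x‖ₑ ^ 2 := by
  obtain ⟨B, hB, hAB⟩ := exists_sqrt hA
  refine ⟨B, hB, hAB, fun x => ?_⟩
  rw [hAB, ← hB, inner_self_eq_norm_sq_to_K]
  simp [← Complex.ofReal_pow, ENNReal.ofReal_pow]

/-- The trace of a positive operator may be computed in any Hilbert basis. -/
lemma posTrace_eq_tsum {A : H →L[ℂ] H} (hA : A.IsPositive) {ι : Type*} (e : HilbertBasis ι ℂ H) :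
    posTrace A = ∑' i, ENNReal.ofReal (inner ℂ (e i) (A (e i))).re := by
  obtain ⟨B, hB, -, hq⟩ := exists_enorm_sq_eq hA
  obtain ⟨f, hf⟩ := Classical.choose_spec (exists_hilbertBasis ℂ H)
  have := tsum_enorm_sq_symm f e hB
  simp only [posTrace, hq]
  rw [← this, hf]

/-- Completing `v` to a Hilbert basis makes the left side one term of the trace. -/
lemma inner_le_posTrace {A : H →L[ℂ] H} (hA : A.IsPositive) {v : H} (hv : ‖v‖ = 1) :
    ENNReal.ofReal (inner ℂ v (A v)).re ≤ posTrace A := by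
  have : Orthonormal ℂ ((↑) : ({v} : Set H) → H) := by
    refine ⟨fun x => by rw [x.2, hv], fun x y h => absurd (Subsingleton.elim x y) h⟩
  obtain ⟨w, e, hw, he⟩ := this.exists_hilbertBasis_extension
  rw [posTrace_eq_tsum hA e]
  simpa [he] using ENNReal.le_tsum (f := fun i => ENNReal.ofReal (inner ℂ (e i) (A (e i))).re)
    ⟨v, hw rfl⟩

/-- A positive operator with finite trace is compact. -/
lemma isCompactOperator_of_posTrace_lt_top {A : H →L[ℂ] H} (hA : A.IsPositive)
    (hfin : posTrace A < ⊤) : IsCompactOperator A := by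
  obtain ⟨B, hB, hAB, hq⟩ := exists_enorm_sq_eq hA
  obtain ⟨w, e, -⟩ := exists_hilbertBasis ℂ H
  have hS : ∑' i, ‖B (e i)‖ₑ ^ 2 ≠ ⊤ := by
    rw [posTrace_eq_tsum hA e] at hfin
    simpa only [hq] using hfin.ne
  -- `F s` is `B` followed by the projection onto the span of the `e i`, `i ∈ s`. It has finite
  -- rank, and its squared distance to `B` is at most the tail of the Hilbert–Schmidt sum.
  let F : Finset w → H →L[ℂ] H := fun s => ∑ i ∈ s, (innerSL ℂ (B (e i))).smulRight (e i)
  have hcomp : IsCompactOperator B := by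
    refine isCompactOperator_of_tendsto (l := atTop) (F := F) ?_ (Eventually.of_forall fun s => ?_)
    · have htail := ENNReal.tendsto_tsum_compl_atTop_zero hS
      rw [tendsto_iff_norm_sub_tendsto_zero, Metric.tendsto_nhds]
      intro ε hε
      have hev := htail.eventually_lt_const (u := ENNReal.ofReal ((ε / 2) ^ 2))
        (ENNReal.ofReal_pos.2 (by positivity))
      filter_upwards [hev] with s hs
      simp only [dist_zero_right, norm_norm]
      refine lt_of_le_of_lt (ContinuousLinearMap.opNorm_le_bound _ (half_pos hε).le fun x => ?_)
        (half_lt_self hε)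
      classical
      have hexp : ∀ i, inner ℂ (e i) ((F s - B) x) =
          if i ∈ s then 0 else - inner ℂ (B (e i)) x := by
        intro i
        have := orthonormal_iff_ite.1 e.orthonormal
        simp only [F, sub_apply, sum_apply,
          ContinuousLinearMap.smulRight_apply, inner_sub_right, inner_sum, inner_smul_right, this,
          innerSL_apply_apply, mul_ite, mul_one, mul_zero, Finset.sum_ite_eq]
        split_ifs with h <;> simp [hB]
      have h1 : ‖(F s - B) x‖ₑ ^ 2 ≤ (ENNReal.ofReal (ε / 2) * ‖x‖ₑ) ^ 2 := by
        rw [← tsum_enorm_inner_sq e, mul_pow, ← ENNReal.ofReal_pow (half_pos hε).le]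
        refine le_trans ?_ (mul_le_mul_left hs.le _)
        rw [← ENNReal.tsum_mul_right]
        change _ ≤ ∑' i : {i | i ∉ s}, ‖B (e i)‖ₑ ^ 2 * ‖x‖ₑ ^ 2
        rw [tsum_subtype {i | i ∉ s} fun i => ‖B (e i)‖ₑ ^ 2 * ‖x‖ₑ ^ 2]
        refine ENNReal.tsum_le_tsum fun i => ?_
        rw [hexp]
        by_cases h : i ∈ s
        · simp [h]
        · simp only [h, if_false, indicator, mem_ofPred_eq, not_false_eq_true, if_true, enorm_neg,
            ← mul_pow]
          gcongr
          rw [← ofReal_norm, ← ofReal_norm, ← ofReal_norm, ← ENNReal.ofReal_mul (norm_nonneg _)]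
          exact ENNReal.ofReal_le_ofReal (norm_inner_le_norm _ _)
      have h2 := (ENNReal.pow_le_pow_left_iff two_ne_zero).1 h1
      rw [← ofReal_norm, ← ofReal_norm, ← ENNReal.ofReal_mul (half_pos hε).le] at h2
      exact (ENNReal.ofReal_le_ofReal_iff (by positivity)).1 h2
    · have : ∀ i ∈ s, (innerSL ℂ (B (e i))).smulRight (e i) ∈
          compactOperator (RingHom.id ℂ) H H := fun i _ => by
        have h1 : IsCompactOperator (ContinuousLinearMap.toSpanSingleton ℂ (e i)) :=
          isCompactOperator_of_locallyCompactSpace_rng _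
        exact h1.comp_clm (innerSL ℂ (B (e i)))
      exact Submodule.sum_mem _ this
  have : (A : H → H) = B ∘ B := funext hAB
  rw [this]
  exact hcomp.comp_clm B

end Trace

/-! ### Diagonalization of positive trace class operators -/

section Diagonal

variable {H : Type*} [NormedAddCommGroup H] [InnerProductSpace ℂ H]

/-- The operator `A` is `∑_p r_p |φ_p⟩⟨φ_p|`, with `r_p ≥ 0` and `(φ_p)` orthonormal. -/
def Diagonalizes (A : H →L[ℂ] H) (r : ℕ → ℝ) (φ : ℕ → H) : Prop :=
  (∀ p, 0 ≤ r p) ∧ Orthonormal ℂ φ ∧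
    ∀ f, HasSum (fun p => ((r p : ℂ) * inner ℂ (φ p) f) • φ p) (A f)

namespace Diagonalizes

variable {A : H →L[ℂ] H} {r : ℕ → ℝ} {φ : ℕ → H}

lemma apply_eigvec (h : Diagonalizes A r φ) (p : ℕ) : A (φ p) = (r p : ℂ) • φ p := by
  have h1 := h.2.2 (φ p)
  have h2 : HasSum (fun q => ((r q : ℂ) * inner ℂ (φ q) (φ p)) • φ q) ((r p : ℂ) • φ p) := by
    convert hasSum_single p ?_ using 1
    · simp [inner_self_eq_norm_sq_to_K, h.2.1.1 p]
    · intro q hq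
      simp [h.2.1.2 hq]
  exact h1.unique h2

lemma hasSum_inner (h : Diagonalizes A r φ) (f g : H) :
    HasSum (fun p => (r p : ℂ) * inner ℂ (φ p) f * inner ℂ g (φ p)) (inner ℂ g (A f)) := by
  simpa [inner_smul_right] using (h.2.2 f).mapL (innerSL ℂ g)

lemma hasSum_re_inner (h : Diagonalizes A r φ) (f : H) :
    HasSum (fun p => r p * ‖inner ℂ (φ p) f‖ ^ 2) (inner ℂ f (A f)).re := by
  have h1 := (h.hasSum_inner f f).mapL Complex.reCLM
  change HasSum _ (Complex.reCLM (inner ℂ f (A f)))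
  convert h1 using 1
  ext p
  rw [← inner_conj_symm f, mul_assoc, Complex.mul_conj, Complex.normSq_eq_norm_sq,
    ← Complex.ofReal_mul]
  exact (Complex.ofReal_re _).symm

variable [CompleteSpace H]

lemma isPositive (h : Diagonalizes A r φ) : A.IsPositive := by
  rw [ContinuousLinearMap.isPositive_iff']
  refine ⟨?_, fun f => ?_⟩
  · rw [ContinuousLinearMap.isSelfAdjoint_iff_isSymmetric]
    intro f g
    have h1 := (h.hasSum_inner g f)
    have h2 := (h.hasSum_inner f g).mapL (Complex.conjCLE : ℂ →L[ℝ] ℂ)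
    simp only [ContinuousLinearEquiv.coe_coe, Complex.conjCLE_apply, inner_conj_symm, map_mul,
      Complex.conj_ofReal] at h2
    refine h2.unique ?_
    change HasSum _ (inner ℂ f (A g))
    convert h1 using 1
    ext p
    ring
  · have h1 := h.hasSum_inner f f
    have h2 : HasSum (fun p => (r p : ℂ) * inner ℂ (φ p) f * inner ℂ f (φ p))
        ((inner ℂ f (A f)).re : ℂ) := by
      have := (h.hasSum_re_inner f).mapL Complex.ofRealCLM
      change HasSum _ (Complex.ofRealCLM (inner ℂ f (A f)).re)
      convert this using 1
      ext p
      rw [← inner_conj_symm f, mul_assoc, Complex.mul_conj, Complex.normSq_eq_norm_sq]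
      simp
    have h3 : inner ℂ (A f) f = ((inner ℂ f (A f)).re : ℂ) := by
      rw [← inner_conj_symm, h1.unique h2, Complex.conj_ofReal, Complex.ofReal_re]
    rw [h3, Complex.zero_le_real]
    exact (h.hasSum_re_inner f).nonneg fun p => mul_nonneg (h.1 p) (by positivity)

/-- The trace is the sum of the eigenvalues. -/
lemma posTrace_eq (h : Diagonalizes A r φ) : posTrace A = ∑' p, ENNReal.ofReal (r p) := by
  obtain ⟨w, e, -⟩ := exists_hilbertBasis ℂ H
  rw [posTrace_eq_tsum h.isPositive e]
  calc _ = ∑' i, ∑' p, ENNReal.ofReal (r p) * ‖inner ℂ (e i) (φ p)‖ₑ ^ 2 := by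
        refine tsum_congr fun i => ?_
        have h1 := h.hasSum_re_inner (e i)
        rw [← h1.tsum_eq, ENNReal.ofReal_tsum_of_nonneg
          (fun p => mul_nonneg (h.1 p) (by positivity)) h1.summable]
        refine tsum_congr fun p => ?_
        rw [ENNReal.ofReal_mul (h.1 p), ENNReal.ofReal_pow (norm_nonneg _), ofReal_norm,
          enorm_inner_symm]
    _ = _ := by
        rw [ENNReal.tsum_comm]
        refine tsum_congr fun p => ?_
        rw [ENNReal.tsum_mul_left, tsum_enorm_inner_sq, ← ofReal_norm, h.2.1.1 p]
        simp

end Diagonalizes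

/-- Orthonormal vectors are `√2` apart, so the balls of radius `1/2` around them are disjoint, and a
separable space holds countably many. -/
lemma countable_of_orthonormal [TopologicalSpace.SeparableSpace H] {ι : Type*} {v : ι → H}
    (hv : Orthonormal ℂ v) : Countable ι := by
  have hd : ∀ i j, i ≠ j → 1 < dist (v i) (v j) := fun i j hij => by
    rw [dist_eq_norm]
    have : ‖v i - v j‖ ^ 2 = 2 := by
      rw [@norm_sub_sq ℂ, hv.1 i, hv.1 j, hv.2 hij]
      norm_num
    nlinarith [norm_nonneg (v i - v j)]
  refine Pairwise.countable_of_isOpen_disjoint (s := fun i => Metric.ball (v i) (1 / 2))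
    (fun i j hij => Metric.ball_disjoint_ball (by linarith [hd i j hij]))
    (fun i => Metric.isOpen_ball) (fun i => ⟨v i, by simp⟩)

variable [CompleteSpace H]

/-- Spectral theorem for positive operators with finite trace. -/
lemma exists_diagonalizes [TopologicalSpace.SeparableSpace H] (hinf : ¬ FiniteDimensional ℂ H)
    {A : H →L[ℂ] H} (hA : A.IsPositive) (hfin : posTrace A < ⊤) :
    ∃ r φ, Diagonalizes A r φ := by
  have hc := isCompactOperator_of_posTrace_lt_top hA hfin
  have hsym : A.IsSymmetric := hA.isSymmetric
  have horth := LinearMap.IsSymmetric.orthogonalFamily_eigenspaces hsym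
  have hcl : ∀ μ : ℂ, CompleteSpace (Module.End.eigenspace (A : Module.End ℂ H) μ) := fun μ => by
    have : IsClosed (Module.End.eigenspace (A : Module.End ℂ H) μ : Set H) := by
      have : (Module.End.eigenspace (A : Module.End ℂ H) μ : Set H) = {x | A x = μ • x} := by
        ext x
        simp
      rw [this]
      exact isClosed_eq A.continuous (by fun_prop)
    exact this.completeSpace_coe
  choose w e he using fun μ : ℂ =>
    exists_hilbertBasis ℂ (Module.End.eigenspace (A : Module.End ℂ H) μ)
  have hon := horth.orthonormal_sigma_orthonormal (fun μ => (e μ).orthonormal)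
  set v : (Σ μ, w μ) → H := fun a => ((e a.1 a.2 : Module.End.eigenspace (A : Module.End ℂ H) a.1) : H) with hv
  have hon' : Orthonormal ℂ v := hon
  -- A vector orthogonal to a Hilbert basis of each eigenspace is orthogonal to all eigenspaces,
  -- hence zero because `A` is compact and symmetric.
  have hbot : (Submodule.span ℂ (Set.range v))ᗮ = ⊥ := by
    rw [eq_bot_iff, ← ContinuousLinearMap.orthogonalComplement_iSup_eigenspaces_eq_bot hc hsym]
    intro x hx
    rw [Submodule.mem_orthogonal] at hx ⊢
    intro u hu
    have hle : (⨆ μ, Module.End.eigenspace (A : Module.End ℂ H) μ) ≤ (ℂ ∙ x)ᗮ := by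
      refine iSup_le fun μ y hy => ?_
      rw [Submodule.mem_orthogonal_singleton_iff_inner_left]
      have h1 := ((e μ).hasSum_repr ⟨y, hy⟩).mapL (Submodule.subtypeL _)
      have h2 := h1.mapL (innerSL ℂ x)
      have h3 : inner ℂ x y = 0 := by
        refine h2.unique ?_
        convert hasSum_zero with i
        have := hx (v ⟨μ, i⟩) (Submodule.subset_span ⟨_, rfl⟩)
        simp only [hv] at this
        simp [inner_eq_zero_symm.1 this]
      exact inner_eq_zero_symm.1 h3
    exact (Submodule.mem_orthogonal_singleton_iff_inner_left.1 (hle hu))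
  let b := HilbertBasis.mkOfOrthogonalEqBot hon' hbot
  have hb : ∀ a, b a = v a := fun a => by simp [b]
  have hcount : Countable (Σ μ, w μ) := countable_of_orthonormal hon'
  -- Infinite dimension lets `ℕ` enumerate the whole eigenbasis, kernel included, so no padding is
  -- needed for finite rank.
  have hinfi : Infinite (Σ μ, w μ) := by
    by_contra hf
    rw [not_infinite_iff_finite] at hf
    have := Fintype.ofFinite (Σ μ, w μ)
    exact hinf (Module.Finite.of_basis b.toOrthonormalBasis.toBasis)
  obtain ⟨σ⟩ : Nonempty (ℕ ≃ Σ μ, w μ) := by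
    obtain ⟨_⟩ := nonempty_denumerable (Σ μ, w μ)
    exact ⟨(Denumerable.eqv _).symm⟩
  have heig : ∀ a, A (v a) = a.1 • v a := fun a =>
    Module.End.mem_eigenspace_iff.1 (e a.1 a.2).2
  have hre : ∀ a : Σ μ, w μ, ((a.1.re : ℝ) : ℂ) = a.1 ∧ 0 ≤ a.1.re := fun a => by
    have h1 := hA.inner_nonneg_right (v a)
    rw [heig, inner_smul_right, inner_self_eq_norm_sq_to_K, hon'.1 a] at h1
    simp only [Complex.coe_algebraMap, Complex.ofReal_one, one_pow, mul_one] at h1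
    rw [Complex.le_def] at h1
    exact ⟨Complex.ext (by simp) (by simpa using h1.2), h1.1⟩
  refine ⟨fun p => (σ p).1.re, fun p => v (σ p), fun p => (hre _).2,
    hon'.comp _ σ.injective, fun f => ?_⟩
  have h1 := (b.hasSum_repr f).mapL A
  rw [← σ.hasSum_iff] at h1
  convert h1 using 1
  ext p
  simp [Function.comp, hb, b.repr_apply_apply, heig, (hre _).1, smul_smul, mul_comm]

end Diagonal

/-! ### Separability and infinite dimension of `L²` -/

section L2

variable {d : ℕ}

instance : TopologicalSpace.SeparableSpace (L2 d) :=
  have : Fact ((2 : ℝ≥0∞) ≠ ⊤) := ⟨ENNReal.ofNat_ne_top⟩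
  inferInstance

/-- Indicators of the balls of radius `1/2` around the integer points of one axis are nonzero and
pairwise orthogonal. Without this, no orthonormal sequence indexed by `ℕ` could exist. -/
lemma not_finiteDimensional_L2 (hd : 1 ≤ d) : ¬ FiniteDimensional ℂ (L2 d) := by
  intro hfin
  let c : ℕ → Space d := fun n => EuclideanSpace.single ⟨0, hd⟩ (n : ℝ)
  let s : ℕ → Set (Space d) := fun n => Metric.ball (c n) (1 / 2)
  have hs : ∀ n, MeasurableSet (s n) := fun n => measurableSet_ball
  have hfs : ∀ n, volume (s n) ≠ ⊤ := fun n => measure_ball_lt_top.ne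
  let v : ℕ → L2 d := fun n => indicatorConstLp 2 (hs n) (hfs n) (1 : ℂ)
  have hdisj : ∀ m n, m ≠ n → Disjoint (s m) (s n) := fun m n hmn => by
    refine Metric.ball_disjoint_ball ?_
    rw [PiLp.dist_single_same, Nat.dist_cast_real]
    norm_num
    exact_mod_cast Nat.pairwise_one_le_dist hmn
  have hli : LinearIndependent ℂ v := by
    refine linearIndependent_of_ne_zero_of_inner_eq_zero (fun n => ?_) (fun m n hmn => ?_)
    · rw [Ne, ← norm_eq_zero, norm_indicatorConstLp two_ne_zero ENNReal.ofNat_ne_top]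
      have : 0 < (volume (s n)).toReal :=
        ENNReal.toReal_pos (Metric.measure_ball_pos _ _ (by norm_num)).ne' (hfs n)
      simp [Measure.real]
      positivity
    · simp only [v]
      rw [L2.inner_indicatorConstLp_one_indicatorConstLp_one, (hdisj m n hmn).inter_eq]
      simp
  exact absurd hli.finite (not_finite_iff_infinite.2 inferInstance)

end L2

/-! ### Uniqueness and linearity of the weak gradient -/

section WeakGradient

variable {d : ℕ}

lemma Lp_toTemperedDistribution_injective :
    Function.Injective (fun φ : L2 d => (φ : 𝓢'(Space d, ℂ))) := by
  have h := Lp.ker_toTemperedDistributionCLM_eq_bot (E := Space d) (F := ℂ) (μ := volume) (p := 2)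
  exact LinearMap.ker_eq_bot.1 h

lemma HasWeakGrad.unique {φ : L2 d} {g g' : Fin d → L2 d} (h : HasWeakGrad φ g)
    (h' : HasWeakGrad φ g') : g = g' :=
  funext fun j => Lp_toTemperedDistribution_injective ((h j).symm.trans (h' j))

lemma HasWeakGrad.grad_eq {φ : L2 d} {g : Fin d → L2 d} (h : HasWeakGrad φ g) : grad φ = g :=
  (Classical.epsilon_spec (p := HasWeakGrad φ) ⟨g, h⟩ : HasWeakGrad φ (grad φ)).unique h

lemma InH1.hasWeakGrad {φ : L2 d} (h : InH1 φ) : HasWeakGrad φ (grad φ) :=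
  Classical.epsilon_spec h

lemma HasWeakGrad.add {φ φ' : L2 d} {g g' : Fin d → L2 d} (h : HasWeakGrad φ g)
    (h' : HasWeakGrad φ' g') : HasWeakGrad (φ + φ') (g + g') := fun j => by
  have hadd : ∀ a b : L2 d, ((a + b : L2 d) : 𝓢'(Space d, ℂ)) = (a : 𝓢'(Space d, ℂ)) + b :=
    (Lp.toTemperedDistributionCLM ℂ (volume : Measure (Space d)) 2).map_add
  rw [hadd, LineDeriv.lineDerivOp_add, h j, h' j, Pi.add_apply, hadd]

lemma HasWeakGrad.smul {φ : L2 d} {g : Fin d → L2 d} (c : ℂ) (h : HasWeakGrad φ g) :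
    HasWeakGrad (c • φ) (c • g) := fun j => by
  have hsmul : ∀ a : L2 d, ((c • a : L2 d) : 𝓢'(Space d, ℂ)) = c • (a : 𝓢'(Space d, ℂ)) :=
    (Lp.toTemperedDistributionCLM ℂ (volume : Measure (Space d)) 2).map_smul c
  rw [hsmul, LineDeriv.lineDerivOp_smul, h j, Pi.smul_apply, hsmul]

lemma HasWeakGrad.zero : HasWeakGrad (0 : L2 d) 0 := fun j => by
  have h0 : ((0 : L2 d) : 𝓢'(Space d, ℂ)) = 0 :=
    (Lp.toTemperedDistributionCLM ℂ (volume : Measure (Space d)) 2).map_zero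
  simp only [Pi.zero_apply, h0, LineDeriv.lineDerivOp_zero]

end WeakGradient

/-! ### Multiplication by `e^{ix·b}` -/

section Phase

variable {d : ℕ}

/-- The function `x ↦ e^{i x·b}`. -/
noncomputable def phaseFun (b x : Space d) : ℂ := Complex.exp (Complex.I * ((inner ℝ b x : ℝ) : ℂ))

lemma norm_phaseFun (b x : Space d) : ‖phaseFun b x‖ = 1 := by
  rw [phaseFun, mul_comm, Complex.norm_exp_ofReal_mul_I]

lemma phaseFun_add (b b' x : Space d) : phaseFun (b + b') x = phaseFun b x * phaseFun b' x := by
  simp only [phaseFun, ← Complex.exp_add, inner_add_left]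
  push_cast
  ring_nf

lemma phaseFun_neg (b x : Space d) : phaseFun (-b) x = (starRingEnd ℂ) (phaseFun b x) := by
  simp only [phaseFun, ← Complex.exp_conj, inner_neg_left]
  simp

lemma coeFn_phaseOp (b : Space d) (φ : L2 d) :
    phaseOp b φ =ᵐ[volume] fun x => phaseFun b x * φ x := by
  have h1 := (ContinuousLinearMap.mul ℂ ℂ).coeFn_holder (r := 2) (phase b) φ
  filter_upwards [h1, (memLp_phase b).coeFn_toLp] with x hx hx'
  change ((ContinuousLinearMap.mul ℂ ℂ).holder 2 (phase b) φ : Space d → ℂ) x = _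
  rw [hx, phase, hx']
  rfl

lemma phaseOp_phaseOp (b b' : Space d) (φ : L2 d) :
    phaseOp b (phaseOp b' φ) = phaseOp (b + b') φ := by
  refine Lp.ext ?_
  filter_upwards [coeFn_phaseOp b (phaseOp b' φ), coeFn_phaseOp b' φ, coeFn_phaseOp (b + b') φ]
    with x h1 h2 h3
  rw [h1, h2, h3, phaseFun_add, mul_assoc]

lemma phaseOp_zero (φ : L2 d) : phaseOp 0 φ = φ := by
  refine Lp.ext ?_
  filter_upwards [coeFn_phaseOp 0 φ] with x h1
  rw [h1]
  simp [phaseFun]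

lemma inner_phaseOp_left (b : Space d) (φ ψ : L2 d) :
    inner ℂ (phaseOp b φ) ψ = inner ℂ φ (phaseOp (-b) ψ) := by
  rw [L2.inner_def, L2.inner_def]
  refine integral_congr_ae ?_
  filter_upwards [coeFn_phaseOp b φ, coeFn_phaseOp (-b) ψ] with x h1 h2
  simp only [h1, h2, phaseFun_neg, RCLike.inner_apply, map_mul]
  ring

lemma inner_phaseOp_phaseOp (b : Space d) (φ ψ : L2 d) :
    inner ℂ (phaseOp b φ) (phaseOp b ψ) = inner ℂ φ ψ := by
  rw [inner_phaseOp_left, phaseOp_phaseOp, neg_add_cancel, phaseOp_zero]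

lemma norm_phaseOp (b : Space d) (φ : L2 d) : ‖phaseOp b φ‖ = ‖φ‖ := by
  rw [@norm_eq_sqrt_re_inner ℂ, inner_phaseOp_phaseOp, ← @norm_eq_sqrt_re_inner ℂ]

lemma iteratedDeriv_cexp_I (n : ℕ) :
    iteratedDeriv n (fun t : ℝ => Complex.exp (Complex.I * t)) =
      fun t : ℝ => Complex.I ^ n * Complex.exp (Complex.I * t) := by
  induction n with
  | zero => simp
  | succ n ih =>
    rw [iteratedDeriv_succ, ih]
    ext t
    have h1 : HasDerivAt (fun t : ℝ => Complex.I * (t : ℂ)) Complex.I t := by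
      simpa using (Complex.ofRealCLM.hasDerivAt (x := t)).const_mul Complex.I
    rw [(h1.cexp.const_mul (Complex.I ^ n)).deriv]
    ring

lemma hasTemperateGrowth_phaseFun (b : Space d) : (phaseFun b).HasTemperateGrowth := by
  have h1 : (fun t : ℝ => Complex.exp (Complex.I * t)).HasTemperateGrowth := by
    refine ⟨?_, fun n => ⟨0, 1, fun t => ?_⟩⟩
    · exact (contDiff_const.mul Complex.ofRealCLM.contDiff).cexp
    · rw [norm_iteratedFDeriv_eq_norm_iteratedDeriv, iteratedDeriv_cexp_I, norm_mul, norm_pow,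
        mul_comm Complex.I, Complex.norm_exp_ofReal_mul_I]
      simp
  exact h1.comp (Function.hasTemperateGrowth_inner_right b)

/-- Multiplication of Schwartz functions by `e^{i x·b}`. -/
noncomputable def phaseSchwartz (b : Space d) : 𝓢(Space d, ℂ) →L[ℂ] 𝓢(Space d, ℂ) :=
  SchwartzMap.smulLeftCLM ℂ (phaseFun b)

lemma phaseSchwartz_apply (b : Space d) (ψ : 𝓢(Space d, ℂ)) (x : Space d) :
    phaseSchwartz b ψ x = phaseFun b x * ψ x :=
  SchwartzMap.smulLeftCLM_apply_apply (hasTemperateGrowth_phaseFun b) ψ x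

lemma hasFDerivAt_phaseFun (b x : Space d) :
    HasFDerivAt (phaseFun b)
      ((phaseFun b x * Complex.I) • (Complex.ofRealCLM ∘L innerSL ℝ b)) x := by
  have h1 : HasFDerivAt (fun x : Space d => ((inner ℝ b x : ℝ) : ℂ))
      (Complex.ofRealCLM ∘L innerSL ℝ b) x :=
    (Complex.ofRealCLM ∘L innerSL ℝ b).hasFDerivAt
  have := (h1.const_mul Complex.I).cexp
  rw [smul_smul] at this
  exact this

lemma lineDeriv_phaseSchwartz (b m : Space d) (ψ : 𝓢(Space d, ℂ)) :
    ∂_{m} (phaseSchwartz b ψ) = phaseSchwartz b (∂_{m} ψ) +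
      (Complex.I * ((inner ℝ b m : ℝ) : ℂ)) • phaseSchwartz b ψ := by
  ext x
  rw [add_apply, smul_apply, phaseSchwartz_apply, phaseSchwartz_apply,
    SchwartzMap.lineDerivOp_apply_eq_fderiv, SchwartzMap.lineDerivOp_apply_eq_fderiv]
  have h1 : (phaseSchwartz b ψ : Space d → ℂ) = phaseFun b * ψ :=
    funext (phaseSchwartz_apply b ψ)
  rw [h1, ((hasFDerivAt_phaseFun b x).mul ψ.differentiableAt.hasFDerivAt).fderiv]
  simp
  ring

lemma phaseOp_toTemperedDistribution (b : Space d) (φ : L2 d) (ψ : 𝓢(Space d, ℂ)) :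
    (phaseOp b φ : 𝓢'(Space d, ℂ)) ψ = (φ : 𝓢'(Space d, ℂ)) (phaseSchwartz b ψ) := by
  rw [Lp.toTemperedDistribution_apply, Lp.toTemperedDistribution_apply]
  refine integral_congr_ae ?_
  filter_upwards [coeFn_phaseOp b φ] with x h1
  rw [h1, phaseSchwartz_apply, smul_eq_mul, smul_eq_mul]
  ring

/-- Tested against a Schwartz function, the phase moves onto the test function, where the product
rule is the classical one. -/
lemma HasWeakGrad.phaseOp {φ : L2 d} {g : Fin d → L2 d} (h : HasWeakGrad φ g) (b : Space d) :
    HasWeakGrad (phaseOp b φ) fun j => QuantumEntropy.phaseOp b (g j + (Complex.I * (b j : ℂ)) • φ) := by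
  intro j
  have hadd : ∀ a b : L2 d, ((a + b : L2 d) : 𝓢'(Space d, ℂ)) = (a : 𝓢'(Space d, ℂ)) + b :=
    (Lp.toTemperedDistributionCLM ℂ (volume : Measure (Space d)) 2).map_add
  have hsmul : ∀ (c : ℂ) (a : L2 d), ((c • a : L2 d) : 𝓢'(Space d, ℂ)) = c • (a : 𝓢'(Space d, ℂ)) :=
    (Lp.toTemperedDistributionCLM ℂ (volume : Measure (Space d)) 2).map_smul
  ext ψ
  have h1 := congrArg (fun T : 𝓢'(Space d, ℂ) => T (phaseSchwartz b ψ)) (h j)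
  simp only [TemperedDistribution.lineDerivOp_apply_apply, lineDeriv_phaseSchwartz] at h1
  rw [TemperedDistribution.lineDerivOp_apply_apply, phaseOp_toTemperedDistribution,
    phaseOp_toTemperedDistribution, hadd, hsmul]
  change _ = (g j : 𝓢'(Space d, ℂ)) (phaseSchwartz b ψ) +
    (Complex.I * (b j : ℂ)) • (φ : 𝓢'(Space d, ℂ)) (phaseSchwartz b ψ)
  rw [← h1, EuclideanSpace.inner_single_right]
  simp only [map_neg, map_add, map_smul]
  simp

end Phase

/-! ### The energy form as a squared norm, and its behaviour under the phase -/

section Form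

/-- The quadratic form `q` is `φ ↦ ‖Γ φ‖²` on its domain `D`, and `∞` elsewhere. -/
structure IsFormOf {H K : Type*} [NormedAddCommGroup H] [InnerProductSpace ℂ H]
    [NormedAddCommGroup K] [InnerProductSpace ℂ K] (q : H → ℝ≥0∞) (D : Submodule ℂ H)
    (Γ : H →ₗ[ℂ] K) : Prop where
  eq_enorm : ∀ φ ∈ D, q φ = ‖Γ φ‖ₑ ^ 2
  eq_top : ∀ φ ∉ D, q φ = ⊤

lemma IsFormOf.lt_top_iff {H K : Type*} [NormedAddCommGroup H] [InnerProductSpace ℂ H]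
    [NormedAddCommGroup K] [InnerProductSpace ℂ K] {q : H → ℝ≥0∞} {D : Submodule ℂ H}
    {Γ : H →ₗ[ℂ] K} (h : IsFormOf q D Γ) (φ : H) : q φ < ⊤ ↔ φ ∈ D := by
  refine ⟨fun hφ => by_contra fun hD => hφ.ne (h.eq_top φ hD), fun hφ => ?_⟩
  rw [h.eq_enorm φ hφ]
  exact ENNReal.pow_lt_top enorm_lt_top

variable {d : ℕ} {V : Space d → ℝ}

/-- The function `√V φ`. -/
noncomputable def sqrtMul (V : Space d → ℝ) (φ : L2 d) (x : Space d) : ℂ := (√(V x) : ℂ) * φ x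

lemma enorm_sqrtMul_sq (hV : ∀ x, 0 ≤ V x) (φ : L2 d) (x : Space d) :
    ‖sqrtMul V φ x‖ₑ ^ 2 = ENNReal.ofReal (V x) * ‖φ x‖ₑ ^ 2 := by
  rw [sqrtMul, enorm_mul, mul_pow, ← ofReal_norm, Complex.norm_real, Real.norm_of_nonneg
    (Real.sqrt_nonneg _), ← ENNReal.ofReal_pow (Real.sqrt_nonneg _), Real.sq_sqrt (hV x)]

lemma aestronglyMeasurable_sqrtMul (hVm : AEStronglyMeasurable V volume) (φ : L2 d) :
    AEStronglyMeasurable (sqrtMul V φ) volume := by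
  have h1 : AEStronglyMeasurable (fun x => √(V x)) volume :=
    (Real.continuous_sqrt.comp_aestronglyMeasurable hVm)
  exact (Complex.continuous_ofReal.comp_aestronglyMeasurable h1).mul
    (Lp.aestronglyMeasurable φ)

lemma eLpNorm_two_sq {α E : Type*} [MeasurableSpace α] {μ : Measure α} [NormedAddCommGroup E]
    (f : α → E) : eLpNorm f 2 μ ^ 2 = ∫⁻ x, ‖f x‖ₑ ^ 2 ∂μ := by
  rw [eLpNorm_eq_lintegral_rpow_enorm_toReal two_ne_zero ENNReal.ofNat_ne_top]
  rw [← ENNReal.rpow_natCast, ← ENNReal.rpow_mul]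
  simp

lemma enorm_sq_eq_lintegral (φ : L2 d) : ‖φ‖ₑ ^ 2 = ∫⁻ x, ‖φ x‖ₑ ^ 2 := by
  rw [Lp.enorm_def, eLpNorm_two_sq]

lemma memLp_sqrtMul_iff (hV : ∀ x, 0 ≤ V x) (hVm : AEStronglyMeasurable V volume) (φ : L2 d) :
    MemLp (sqrtMul V φ) 2 volume ↔ ∫⁻ x, ENNReal.ofReal (V x) * ‖φ x‖ₑ ^ 2 < ⊤ := by
  simp_rw [← enorm_sqrtMul_sq hV, ← eLpNorm_two_sq]
  rw [MemLp, and_iff_right (aestronglyMeasurable_sqrtMul hVm φ)]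
  simp

lemma energyForm_lt_top_iff (hV : ∀ x, 0 ≤ V x) (hVm : AEStronglyMeasurable V volume)
    (φ : L2 d) : energyForm V φ < ⊤ ↔ InH1 φ ∧ MemLp (sqrtMul V φ) 2 volume := by
  rw [memLp_sqrtMul_iff hV hVm, energyForm, ENNReal.add_lt_top]
  refine and_congr_left fun _ => ?_
  rw [kineticForm]
  split_ifs with h
  · simp only [h, iff_true]
    exact ENNReal.sum_lt_top.2 fun j _ => ENNReal.pow_lt_top enorm_lt_top
  · simp [h]

/-- The form domain of `-Δ + V`. -/
noncomputable def formDomain (hV : ∀ x, 0 ≤ V x) (hVm : AEStronglyMeasurable V volume) :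
    Submodule ℂ (L2 d) where
  carrier := {φ | energyForm V φ < ⊤}
  add_mem' := by
    intro φ ψ hφ hψ
    rw [mem_ofPred_eq, energyForm_lt_top_iff hV hVm] at *
    refine ⟨⟨_, hφ.1.hasWeakGrad.add hψ.1.hasWeakGrad⟩, (hφ.2.add hψ.2).ae_eq ?_⟩
    filter_upwards [Lp.coeFn_add φ ψ] with x hx
    simp only [Pi.add_apply, sqrtMul]
    rw [hx, Pi.add_apply, mul_add]
  zero_mem' := by
    rw [mem_ofPred_eq, energyForm_lt_top_iff hV hVm]
    refine ⟨⟨_, HasWeakGrad.zero⟩, (MemLp.zero (ε := ℂ)).ae_eq ?_⟩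
    exact Eventually.of_forall fun x => by simp [sqrtMul]
  smul_mem' := by
    intro c φ hφ
    rw [mem_ofPred_eq, energyForm_lt_top_iff hV hVm] at *
    refine ⟨⟨_, hφ.1.hasWeakGrad.smul c⟩, (hφ.2.const_smul c).ae_eq ?_⟩
    filter_upwards [Lp.coeFn_smul c φ] with x hx
    simp only [Pi.smul_apply, sqrtMul]
    rw [hx, Pi.smul_apply, smul_eq_mul, smul_eq_mul]
    ring

lemma mem_formDomain (hV : ∀ x, 0 ≤ V x) (hVm : AEStronglyMeasurable V volume) (φ : L2 d) :
    φ ∈ formDomain hV hVm ↔ InH1 φ ∧ MemLp (sqrtMul V φ) 2 volume :=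
  energyForm_lt_top_iff hV hVm φ

/-- `(√V φ, ∇φ)` for `φ` in the form domain of `-Δ + V`. -/
noncomputable def formMap (hV : ∀ x, 0 ≤ V x) (hVm : AEStronglyMeasurable V volume) :
    formDomain hV hVm →ₗ[ℂ] PiLp 2 (fun _ : Option (Fin d) => L2 d) where
  toFun φ := WithLp.toLp 2 fun o =>
    o.elim (((mem_formDomain hV hVm φ).1 φ.2).2.toLp) (grad (φ : L2 d))
  map_add' φ ψ := by
    have hφ := (mem_formDomain hV hVm φ).1 φ.2
    have hψ := (mem_formDomain hV hVm ψ).1 ψ.2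
    ext1 o
    cases o with
    | none =>
      simp only [Option.elim, PiLp.add_apply]
      rw [← MemLp.toLp_add]
      refine MemLp.toLp_congr _ _ ?_
      filter_upwards [Lp.coeFn_add (φ : L2 d) ψ] with x hx
      simp only [Pi.add_apply, sqrtMul, Submodule.coe_add]
      rw [hx, Pi.add_apply, mul_add]
    | some j =>
      simp [(hφ.1.hasWeakGrad.add hψ.1.hasWeakGrad).grad_eq]
  map_smul' c φ := by
    have hφ := (mem_formDomain hV hVm φ).1 φ.2
    ext1 o
    cases o with
    | none =>
      simp only [Option.elim, PiLp.smul_apply, RingHom.id_apply]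
      rw [← MemLp.toLp_const_smul]
      refine MemLp.toLp_congr _ _ ?_
      filter_upwards [Lp.coeFn_smul c (φ : L2 d)] with x hx
      simp only [Pi.smul_apply, sqrtMul, Submodule.coe_smul]
      rw [hx, Pi.smul_apply, smul_eq_mul, smul_eq_mul]
      ring
    | some j =>
      simp [(hφ.1.hasWeakGrad.smul c).grad_eq]

lemma enorm_sq_piLp {ι : Type*} [Fintype ι] {E : Type*} [NormedAddCommGroup E]
    (x : PiLp 2 (fun _ : ι => E)) : ‖x‖ₑ ^ 2 = ∑ i, ‖x i‖ₑ ^ 2 := by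
  rw [← ofReal_norm, ← ENNReal.ofReal_pow (norm_nonneg _), PiLp.norm_sq_eq_of_L2,
    ENNReal.ofReal_sum_of_nonneg fun i _ => by positivity]
  refine Finset.sum_congr rfl fun i _ => ?_
  rw [ENNReal.ofReal_pow (norm_nonneg _), ofReal_norm]

/-- The later variational arguments see the Hamiltonian only through `Γ` and its domain; the
polarized identity links them back to `IsEigenvalue`. -/
lemma exists_isFormOf_energyForm (hV : ∀ x, 0 ≤ V x) (hVm : AEStronglyMeasurable V volume) :
    ∃ Γ : L2 d →ₗ[ℂ] PiLp 2 (fun _ : Option (Fin d) => L2 d),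
      IsFormOf (energyForm V) (formDomain hV hVm) Γ ∧
      ∀ φ ∈ formDomain hV hVm, ∀ ψ ∈ formDomain hV hVm, inner ℂ (Γ ψ) (Γ φ) =
        ∑ j, inner ℂ (grad ψ j) (grad φ j) +
          ∫ x, (V x : ℂ) * (starRingEnd ℂ (ψ x) * φ x) := by
  -- The extension off the form domain is arbitrary: no requirement is placed on its values there.
  obtain ⟨Γ, hΓ⟩ := LinearMap.exists_extend (formMap hV hVm)
  have hΓ' : ∀ φ (hφ : φ ∈ formDomain hV hVm), Γ φ = formMap hV hVm ⟨φ, hφ⟩ := fun φ hφ => by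
    rw [← hΓ]; rfl
  refine ⟨Γ, ⟨fun φ hφ => ?_, fun φ hφ => ?_⟩, fun φ hφ ψ hψ => ?_⟩
  · rw [hΓ' φ hφ, enorm_sq_piLp, Fintype.sum_option, add_comm, energyForm, kineticForm,
      if_pos ((mem_formDomain hV hVm φ).1 hφ).1]
    congr 1
    change _ = ‖((mem_formDomain hV hVm φ).1 hφ).2.toLp‖ₑ ^ 2
    rw [Lp.enorm_toLp, eLpNorm_two_sq]
    simp_rw [enorm_sqrtMul_sq hV]
  · exact not_lt_top_iff.1 hφ
  · rw [hΓ' φ hφ, hΓ' ψ hψ, PiLp.inner_apply, Fintype.sum_option, add_comm]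
    congr 1
    change inner ℂ (((mem_formDomain hV hVm ψ).1 hψ).2.toLp)
      (((mem_formDomain hV hVm φ).1 hφ).2.toLp) = _
    rw [L2.inner_def]
    refine integral_congr_ae ?_
    filter_upwards [((mem_formDomain hV hVm ψ).1 hψ).2.coeFn_toLp,
      ((mem_formDomain hV hVm φ).1 hφ).2.coeFn_toLp] with x h1 h2
    rw [h1, h2, RCLike.inner_apply, sqrtMul, sqrtMul, map_mul, Complex.conj_ofReal]
    have : ((√(V x) : ℝ) : ℂ) * (√(V x) : ℝ) = V x := by
      rw [← Complex.ofReal_mul, Real.mul_self_sqrt (hV x)]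
    linear_combination (φ x * (starRingEnd ℂ) (ψ x)) * this

/-- The total current `Im ⟨φ, ∂_j φ⟩` of `φ`. -/
noncomputable def currentVec (φ : L2 d) : Space d :=
  WithLp.toLp 2 fun j => (inner ℂ φ (grad φ j)).im

lemma InH1.phaseOp {φ : L2 d} (h : InH1 φ) (b : Space d) : InH1 (phaseOp b φ) :=
  ⟨_, h.hasWeakGrad.phaseOp b⟩

lemma phaseOp_neg_phaseOp (b : Space d) (φ : L2 d) : phaseOp (-b) (phaseOp b φ) = φ := by
  rw [phaseOp_phaseOp, neg_add_cancel, phaseOp_zero]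

lemma kineticForm_lt_top_iff (φ : L2 d) : kineticForm φ < ⊤ ↔ InH1 φ := by
  rw [kineticForm]
  split_ifs with h
  · simp only [h, iff_true]
    exact ENNReal.sum_lt_top.2 fun j _ => ENNReal.pow_lt_top enorm_lt_top
  · simp [h]

lemma toReal_kineticForm {φ : L2 d} (h : InH1 φ) :
    (kineticForm φ).toReal = ∑ j, ‖grad φ j‖ ^ 2 := by
  rw [kineticForm, if_pos h, ENNReal.toReal_sum fun j _ => by simp]
  simp

/-- This expands `‖∇φ + i b φ‖²`; the cross term is `2 b·Im⟨φ, ∇φ⟩`. -/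
lemma toReal_kineticForm_phaseOp {φ : L2 d} (h : InH1 φ) (b : Space d) :
    (kineticForm (phaseOp b φ)).toReal =
      (kineticForm φ).toReal + 2 * inner ℝ b (currentVec φ) + ‖b‖ ^ 2 * ‖φ‖ ^ 2 := by
  rw [toReal_kineticForm h, toReal_kineticForm (h.phaseOp b),
    (h.hasWeakGrad.phaseOp b).grad_eq]
  have h1 : ∀ j, ‖phaseOp b (grad φ j + (Complex.I * (b j : ℂ)) • φ)‖ ^ 2 =
      ‖grad φ j‖ ^ 2 + 2 * (b j * currentVec φ j) + b j ^ 2 * ‖φ‖ ^ 2 := fun j => by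
    have h2 : (inner ℂ (grad φ j) ((Complex.I * (b j : ℂ)) • φ)).re = b j * currentVec φ j := by
      have h3 : (inner ℂ φ (grad φ j)).im = -(inner ℂ (grad φ j) φ).im := by
        rw [← inner_conj_symm, Complex.conj_im]
      rw [inner_smul_right]
      simp [currentVec, h3]
    rw [norm_phaseOp, @norm_add_sq ℂ, norm_smul]
    simp only [RCLike.re_to_complex, h2]
    simp [mul_pow]
  simp_rw [h1, Finset.sum_add_distrib, ← Finset.mul_sum, ← Finset.sum_mul]
  rw [EuclideanSpace.norm_sq_eq, PiLp.inner_apply]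
  simp [mul_comm]

lemma lintegral_potential_phaseOp (b : Space d) (φ : L2 d) :
    ∫⁻ x, ENNReal.ofReal (V x) * ‖phaseOp b φ x‖ₑ ^ 2 =
      ∫⁻ x, ENNReal.ofReal (V x) * ‖φ x‖ₑ ^ 2 := by
  refine lintegral_congr_ae ?_
  filter_upwards [coeFn_phaseOp b φ] with x hx
  rw [hx, enorm_mul, ← ofReal_norm (phaseFun b x), norm_phaseFun, ENNReal.ofReal_one, one_mul]

lemma energyForm_phaseOp_lt_top {φ : L2 d} (h : energyForm V φ < ⊤) (b : Space d) :
    energyForm V (phaseOp b φ) < ⊤ := by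
  rw [energyForm, ENNReal.add_lt_top, kineticForm_lt_top_iff] at *
  rw [lintegral_potential_phaseOp]
  exact ⟨h.1.phaseOp b, h.2⟩

lemma toReal_energyForm_phaseOp {φ : L2 d} (h : energyForm V φ < ⊤) (b : Space d) :
    (energyForm V (phaseOp b φ)).toReal =
      (energyForm V φ).toReal + 2 * inner ℝ b (currentVec φ) + ‖b‖ ^ 2 * ‖φ‖ ^ 2 := by
  have h' := energyForm_phaseOp_lt_top h b
  rw [energyForm, ENNReal.add_lt_top] at h h'
  rw [energyForm, energyForm, ENNReal.toReal_add h'.1.ne h'.2.ne, ENNReal.toReal_add h.1.ne h.2.ne,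
    lintegral_potential_phaseOp, toReal_kineticForm_phaseOp ((kineticForm_lt_top_iff φ).1 h.1)]
  ring

lemma energyForm_zero (φ : L2 d) : energyForm (fun _ => 0) φ = kineticForm φ := by
  simp [energyForm]

lemma aestronglyMeasurable_of_memLp_compact
    (hV : ∀ K : Set (Space d), IsCompact K → MemLp V 2 (volume.restrict K)) :
    AEStronglyMeasurable V volume := by
  have h := (aestronglyMeasurable_iUnion_iff (μ := volume) (f := V)
    (s := compactCovering (Space d))).2 fun n => (hV _ (isCompact_compactCovering _ n)).1
  rwa [iUnion_compactCovering, Measure.restrict_univ] at h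

end Form

/-! ### Independence of the energy from the diagonalization -/

section FormTrace

lemma enorm_sq_eq_ofReal {E : Type*} [NormedAddCommGroup E] (y : E) :
    ‖y‖ₑ ^ 2 = ENNReal.ofReal (‖y‖ ^ 2) := by
  rw [ENNReal.ofReal_pow (norm_nonneg _), ofReal_norm]

variable {H K : Type*} [NormedAddCommGroup H] [InnerProductSpace ℂ H]
  [NormedAddCommGroup K] [InnerProductSpace ℂ K]

lemma Diagonalizes.inner_eq_zero {A : H →L[ℂ] H} {r s : ℕ → ℝ} {φ ψ : ℕ → H} [CompleteSpace H]
    (hr : Diagonalizes A r φ) (hs : Diagonalizes A s ψ) {p q : ℕ} (h : r p ≠ s q) :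
    inner ℂ (ψ q) (φ p) = 0 := by
  have h1 := hr.isPositive.isSymmetric (ψ q) (φ p)
  simp only [ContinuousLinearMap.coe_coe, hr.apply_eigvec, hs.apply_eigvec, inner_smul_left,
    inner_smul_right, Complex.conj_ofReal] at h1
  have h2 : ((s q : ℂ) - r p) * inner ℂ (ψ q) (φ p) = 0 := by rw [sub_mul, h1, sub_self]
  rcases mul_eq_zero.1 h2 with h3 | h3
  · exact absurd (by exact_mod_cast (sub_eq_zero.1 h3).symm) h
  · exact h3

/-- Eigenvectors `ψ q` for other eigenvalues are orthogonal to `φ p`, so only `J` survives in the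
expansion of `A (φ p) = t φ p`. Dividing by `t` is why the kernel is excluded: its vectors need not
lie in the span of the `ψ q`. -/
lemma Diagonalizes.eq_sum {A : H →L[ℂ] H} {r s : ℕ → ℝ} {φ ψ : ℕ → H} [CompleteSpace H]
    (hr : Diagonalizes A r φ) (hs : Diagonalizes A s ψ) {t : ℝ} (ht : 0 < t)
    (J : Finset ℕ) (hJ : ∀ q, q ∈ J ↔ s q = t) {p : ℕ} (hp : r p = t) :
    φ p = ∑ q ∈ J, inner ℂ (ψ q) (φ p) • ψ q := by
  have h1 := hs.2.2 (φ p)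
  have h2 := hasSum_sum_of_ne_finset_zero
    (f := fun q => ((s q : ℂ) * inner ℂ (ψ q) (φ p)) • ψ q) (s := J) (L := SummationFilter.unconditional ℕ) fun q hq => by
      rw [hr.inner_eq_zero hs (p := p) (q := q) fun h => hq ((hJ q).2 (h ▸ hp)), mul_zero, zero_smul]
  have h3 := h1.unique h2
  rw [hr.apply_eigvec, hp] at h3
  have h4 : (t : ℂ) • φ p = (t : ℂ) • ∑ q ∈ J, inner ℂ (ψ q) (φ p) • ψ q := by
    rw [h3, Finset.smul_sum]
    refine Finset.sum_congr rfl fun q hq => ?_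
    rw [(hJ q).1 hq, mul_smul]
  exact smul_right_injective H (Complex.ofReal_ne_zero.2 ht.ne') h4

lemma Orthonormal.tsum_enorm_inner_sq_le {ι : Type*} {v : ι → H} (hv : Orthonormal ℂ v) (x : H) :
    ∑' i, ‖inner ℂ (v i) x‖ₑ ^ 2 ≤ ‖x‖ₑ ^ 2 := by
  rw [ENNReal.tsum_eq_iSup_sum]
  refine iSup_le fun s => ?_
  have h := hv.sum_inner_products_le x (s := s)
  rw [enorm_sq_eq_ofReal, Finset.sum_congr rfl fun i _ => enorm_sq_eq_ofReal (inner ℂ (v i) x),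
    ← ENNReal.ofReal_sum_of_nonneg fun i _ => by positivity]
  exact ENNReal.ofReal_le_ofReal h

lemma Orthonormal.enorm_sum_sq {ι : Type*} {v : ι → H} (hv : Orthonormal ℂ v) (c : ι → ℂ)
    (s : Finset ι) : ‖∑ i ∈ s, c i • v i‖ₑ ^ 2 = ∑ i ∈ s, ‖c i‖ₑ ^ 2 := by
  have h3 : ‖∑ i ∈ s, c i • v i‖ ^ 2 = ∑ i ∈ s, ‖c i‖ ^ 2 := by
    have h4 := hv.inner_sum c c s
    rw [inner_self_eq_norm_sq_to_K] at h4
    have h5 : ∀ z : ℂ, (starRingEnd ℂ) z * z = ((‖z‖ ^ 2 : ℝ) : ℂ) := fun z => by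
      rw [mul_comm, Complex.mul_conj, Complex.normSq_eq_norm_sq]
    simp_rw [h5] at h4
    rw [← Complex.ofReal_sum] at h4
    apply Complex.ofReal_injective
    rw [← h4]
    simp
  rw [enorm_sq_eq_ofReal, h3, ENNReal.ofReal_sum_of_nonneg fun i _ => by positivity]
  exact Finset.sum_congr rfl fun i _ => (enorm_sq_eq_ofReal _).symm

variable [CompleteSpace H] [CompleteSpace K]

/-- Both sides are Hilbert–Schmidt sums of `Γ` on one eigenspace. Taking coordinates `⟨f_k, Γ ·⟩` in
a Hilbert basis of `K` reduces the claim to Bessel's inequality for the `φ p`. -/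
lemma Diagonalizes.tsum_fiber_le {A : H →L[ℂ] H} {r s : ℕ → ℝ} {φ ψ : ℕ → H}
    (hr : Diagonalizes A r φ) (hs : Diagonalizes A s ψ) {q : H → ℝ≥0∞} {D : Submodule ℂ H}
    {Γ : H →ₗ[ℂ] K} (hq : IsFormOf q D Γ) {t : ℝ} (ht : 0 < t) (hfin : {k | s k = t}.Finite) :
    ∑' p : {p // r p = t}, q (φ p) ≤ ∑' p : {p // s p = t}, q (ψ p) := by
  by_cases htop : ∑' p : {p // s p = t}, q (ψ p) = ⊤
  · rw [htop]; exact le_top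
  have hψ : ∀ p, s p = t → ψ p ∈ D := fun p hp =>
    (hq.lt_top_iff _).1 (lt_of_le_of_lt
      (ENNReal.le_tsum (f := fun p : {p // s p = t} => q (ψ p)) ⟨p, hp⟩) (lt_top_iff_ne_top.2 htop))
  have hJ : ∀ k, k ∈ hfin.toFinset ↔ s k = t := by simp
  have hsum := fun p hp => hr.eq_sum hs ht hfin.toFinset hJ (p := p) hp
  have hφ : ∀ p, r p = t → φ p ∈ D := fun p hp => by
    rw [hsum p hp]
    exact Submodule.sum_mem _ fun k hk => D.smul_mem _ (hψ k ((hJ k).1 hk))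
  obtain ⟨w, f, -⟩ := exists_hilbertBasis ℂ K
  have h1 : ∀ p : {p // r p = t}, q (φ p) = ∑' k, ‖inner ℂ (f k) (Γ (φ p))‖ₑ ^ 2 := fun p => by
    rw [hq.eq_enorm _ (hφ p p.2), tsum_enorm_inner_sq]
  have h2 : ∀ p : {p // s p = t}, q (ψ p) = ∑' k, ‖inner ℂ (f k) (Γ (ψ p))‖ₑ ^ 2 := fun p => by
    rw [hq.eq_enorm _ (hψ p p.2), tsum_enorm_inner_sq]
  simp_rw [h1, h2]
  rw [ENNReal.tsum_comm, ENNReal.tsum_comm (α := {p // s p = t})]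
  refine ENNReal.tsum_le_tsum fun k => ?_
  -- The Riesz vector of `⟨f k, Γ ·⟩` on the span of these `ψ j`, a span that contains the `φ p`.
  set x : H := ∑ j ∈ hfin.toFinset, (starRingEnd ℂ) (inner ℂ (f k) (Γ (ψ j))) • ψ j with hx
  have h3 : ∀ p : {p // r p = t}, ‖inner ℂ (f k) (Γ (φ p))‖ₑ = ‖inner ℂ (φ p) x‖ₑ := fun p => by
    rw [enorm_inner_symm (φ p)]
    congr 1
    conv_lhs => rw [hsum p p.2]
    rw [map_sum, inner_sum, hx, sum_inner]
    refine Finset.sum_congr rfl fun j _ => ?_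
    rw [map_smul, inner_smul_right, inner_smul_left, Complex.conj_conj, mul_comm]
  simp_rw [h3]
  refine (Orthonormal.tsum_enorm_inner_sq_le (hr.2.1.comp _ Subtype.val_injective) x).trans ?_
  rw [hx, Orthonormal.enorm_sum_sq hs.2.1, ← Finset.tsum_subtype]
  refine le_of_eq ?_
  have : ∀ z : ℂ, ‖(starRingEnd ℂ) z‖ₑ = ‖z‖ₑ := fun z => by
    rw [← ofReal_norm, ← ofReal_norm, RCLike.norm_conj]
  simp_rw [this]
  exact (Equiv.subtypeEquivRight hJ).tsum_eq
    (fun p : {p // s p = t} => ‖inner ℂ (f k) (Γ (ψ p))‖ₑ ^ 2)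

/-- The sum is grouped by eigenvalue. The value `0` contributes nothing, even where `q = ∞`, and a
positive value has finite multiplicity because the trace is finite. -/
lemma Diagonalizes.tsum_form_le {A : H →L[ℂ] H} {r s : ℕ → ℝ} {φ ψ : ℕ → H}
    (hr : Diagonalizes A r φ) (hs : Diagonalizes A s ψ) {q : H → ℝ≥0∞} {D : Submodule ℂ H}
    {Γ : H →ₗ[ℂ] K} (hq : IsFormOf q D Γ) (hfin : posTrace A < ⊤) :
    ∑' p, ENNReal.ofReal (r p) * q (φ p) ≤ ∑' p, ENNReal.ofReal (s p) * q (ψ p) := by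
  rw [← (Equiv.sigmaFiberEquiv r).tsum_eq, ← (Equiv.sigmaFiberEquiv s).tsum_eq,
    ENNReal.tsum_sigma', ENNReal.tsum_sigma']
  refine ENNReal.tsum_le_tsum fun t => ?_
  rcases le_or_gt t 0 with ht | ht
  · refine le_trans (le_of_eq ?_) zero_le
    rw [ENNReal.tsum_eq_zero]
    intro p
    have : r p = t := p.2
    simp [Equiv.sigmaFiberEquiv, this, ENNReal.ofReal_of_nonpos ht]
  have h1 : ∀ (s : ℕ → ℝ) (ψ : ℕ → H), ∑' p : {p // s p = t}, ENNReal.ofReal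
      (s ((Equiv.sigmaFiberEquiv s) ⟨t, p⟩)) * q (ψ ((Equiv.sigmaFiberEquiv s) ⟨t, p⟩)) =
      ENNReal.ofReal t * ∑' p : {p // s p = t}, q (ψ p) := fun s ψ => by
    rw [← ENNReal.tsum_mul_left]
    refine tsum_congr fun p => ?_
    have : s p = t := p.2
    simp [Equiv.sigmaFiberEquiv, this]
  rw [h1, h1]
  refine mul_le_mul_right (hr.tsum_fiber_le hs hq ht ?_) _
  have h2 := ENNReal.finite_const_le_of_tsum_ne_top (hs.posTrace_eq ▸ hfin.ne)
    (ENNReal.ofReal_pos.2 ht).ne'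
  exact h2.subset fun k (hk : s k = t) => by simp [hk]

/-- `∑_p r_p q(φ_p)` does not depend on the chosen diagonalization. -/
lemma Diagonalizes.tsum_form_eq {A : H →L[ℂ] H} {r s : ℕ → ℝ} {φ ψ : ℕ → H}
    (hr : Diagonalizes A r φ) (hs : Diagonalizes A s ψ) {q : H → ℝ≥0∞} {D : Submodule ℂ H}
    {Γ : H →ₗ[ℂ] K} (hq : IsFormOf q D Γ) (hfin : posTrace A < ⊤) :
    ∑' p, ENNReal.ofReal (r p) * q (φ p) = ∑' p, ENNReal.ofReal (s p) * q (ψ p) :=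
  le_antisymm (hr.tsum_form_le hs hq hfin) (hs.tsum_form_le hr hq hfin)

lemma inner_unitary_apply {u : H →L[ℂ] H} (hu : u ∈ unitary (H →L[ℂ] H)) (x y : H) :
    inner ℂ (u x) (u y) = inner ℂ x y := by
  rw [← ContinuousLinearMap.adjoint_inner_right]
  have : (star u * u) y = y := by rw [(Unitary.mem_iff.1 hu).1]; rfl
  exact congrArg _ this

/-- Conjugation of a diagonalization by a unitary operator. -/
lemma Diagonalizes.conj {A : H →L[ℂ] H} {r : ℕ → ℝ} {φ : ℕ → H} (h : Diagonalizes A r φ)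
    {u : H →L[ℂ] H} (hu : u ∈ unitary (H →L[ℂ] H)) :
    Diagonalizes (u * A * star u) r (fun p => u (φ p)) := by
  refine ⟨h.1, ?_, fun f => ?_⟩
  · rw [orthonormal_iff_ite]
    intro i j
    rw [inner_unitary_apply hu]
    exact orthonormal_iff_ite.1 h.2.1 i j
  · have h1 := (h.2.2 (star u f)).mapL u
    change HasSum _ (u (A (star u f)))
    convert h1 using 1
    ext p
    have : inner ℂ (u (φ p)) f = inner ℂ (φ p) (star u f) :=
      (ContinuousLinearMap.adjoint_inner_right u _ _).symm
    rw [map_smul, this]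

end FormTrace

/-! ### Density operators and gauge conjugation -/

section Density

variable {d : ℕ}

lemma diagonalizes_eig (hd : 1 ≤ d) {ϱ : Op d} (h : IsDensityOperator ϱ) :
    Diagonalizes ϱ (eigval ϱ) (eigvec ϱ) := by
  obtain ⟨r, φ, hrφ⟩ := exists_diagonalizes (not_finiteDimensional_L2 hd) h.1 h.2
  exact Classical.epsilon_spec (p := IsSpectralDecomposition ϱ) ⟨(r, φ), hrφ⟩

lemma formTrace_eq (hd : 1 ≤ d) {ϱ : Op d} (h : IsDensityOperator ϱ) {r : ℕ → ℝ} {φ : ℕ → L2 d}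
    (hrφ : Diagonalizes ϱ r φ) {V : Space d → ℝ} (hV : ∀ x, 0 ≤ V x)
    (hVm : AEStronglyMeasurable V volume) :
    formTrace (energyForm V) ϱ = ∑' p, ENNReal.ofReal (r p) * energyForm V (φ p) := by
  obtain ⟨Γ, hΓ, -⟩ := exists_isFormOf_energyForm hV hVm
  exact (diagonalizes_eig hd h).tsum_form_eq hrφ hΓ h.2

lemma formTrace_kineticForm (ϱ : Op d) :
    formTrace kineticForm ϱ = formTrace (energyForm fun _ => 0) ϱ := by
  simp only [formTrace, energyForm_zero]

lemma formTrace_kineticForm_le (V : Space d → ℝ) (ϱ : Op d) :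
    formTrace kineticForm ϱ ≤ energy V ϱ :=
  ENNReal.tsum_le_tsum fun _ => mul_le_mul_right le_self_add _

lemma star_phaseOp (b : Space d) : star (phaseOp b) = phaseOp (-b) := by
  symm
  rw [ContinuousLinearMap.star_eq_adjoint, ContinuousLinearMap.eq_adjoint_iff]
  intro x y
  rw [inner_phaseOp_left, neg_neg]

lemma phaseOp_mem_unitary (b : Space d) : phaseOp b ∈ unitary (Op d) := by
  rw [Unitary.mem_iff, star_phaseOp]
  constructor <;> ext1 x
  · exact phaseOp_neg_phaseOp b x
  · have := phaseOp_neg_phaseOp (-b) x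
    rwa [neg_neg] at this

lemma gauge_eq_conj (b : Space d) (ϱ : Op d) :
    gauge b ϱ = phaseOp b * ϱ * star (phaseOp b) := by
  rw [star_phaseOp]; rfl

lemma gauge_gauge (b b' : Space d) (ϱ : Op d) : gauge b (gauge b' ϱ) = gauge (b + b') ϱ := by
  ext1 f
  simp only [gauge, ContinuousLinearMap.comp_apply, phaseOp_phaseOp, neg_add]
  rw [add_comm (-b')]

lemma gauge_zero (ϱ : Op d) : gauge 0 ϱ = ϱ := by
  ext1 f
  simp only [gauge, ContinuousLinearMap.comp_apply, neg_zero, phaseOp_zero]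

end Density

lemma integrable_tsum_of_lintegral {α : Type*} [MeasurableSpace α] {μ : Measure α}
    {F : ℕ → α → ℝ} (hF : ∀ i, Integrable (F i) μ) (hs : ∑' i, ∫⁻ a, ‖F i a‖ₑ ∂μ ≠ ⊤) :
    Integrable (fun a => ∑' i, F i a) μ := by
  have hm : ∀ i, AEMeasurable (fun a => ‖F i a‖ₑ) μ := fun i => (hF i).1.enorm
  rw [← lintegral_tsum hm] at hs
  have hae : ∀ᵐ a ∂μ, Summable fun i => F i a := by
    filter_upwards [ae_lt_top' (AEMeasurable.tsum hm) hs] with a ha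
    have := ENNReal.summable_toReal ha.ne
    simp only [toReal_enorm] at this
    exact this.of_norm
  refine ⟨aestronglyMeasurable_of_tendsto_ae atTop
    (f := fun n a => ∑ i ∈ Finset.range n, F i a)
    (fun n => Finset.aestronglyMeasurable_fun_sum _ fun i _ => (hF i).1) ?_, ?_⟩
  · filter_upwards [hae] with a ha using ha.hasSum.tendsto_sum_nat
  · refine lt_of_le_of_lt (lintegral_mono fun a => ?_) (lt_top_iff_ne_top.2 hs)
    exact enorm_tsum_le_tsum_enorm

/-! ### Total density, current and energy, and their change of frame -/

section States

variable {d : ℕ} {V : Space d → ℝ} {ϱ : Op d}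

lemma enorm_grad_sq_le_kineticForm (φ : L2 d) (j : Fin d) :
    ‖grad φ j‖ₑ ^ 2 ≤ kineticForm φ := by
  rw [kineticForm]
  split_ifs
  · exact Finset.single_le_sum (f := fun j => ‖grad φ j‖ₑ ^ 2) (fun _ _ => zero_le)
      (Finset.mem_univ j)
  · exact le_top

lemma lintegral_density (hd : 1 ≤ d) (h : IsDensityOperator ϱ) :
    ∫⁻ x, density ϱ x = posTrace ϱ := by
  have hD := diagonalizes_eig hd h
  rw [hD.posTrace_eq]
  simp only [density]
  rw [lintegral_tsum fun p => ((Lp.aestronglyMeasurable _).enorm.pow_const 2).const_mul _]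
  refine tsum_congr fun p => ?_
  rw [lintegral_const_mul' _ _ ENNReal.ofReal_ne_top, ← enorm_sq_eq_lintegral, ← ofReal_norm,
    hD.2.1.1 p]
  simp

lemma mul_lt_top_of_tsum {r : ℕ → ℝ} {q : ℕ → ℝ≥0∞}
    (h : ∑' p, ENNReal.ofReal (r p) * q p < ⊤) {p : ℕ} (hp : 0 < r p) : q p < ⊤ := by
  have h1 := lt_of_le_of_lt (ENNReal.le_tsum (f := fun p => ENNReal.ofReal (r p) * q p) p) h
  by_contra h2
  rw [not_lt_top_iff] at h2
  simp [h2, ENNReal.mul_top, hp] at h1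

lemma lintegral_energyDensity (hd : 1 ≤ d) (h : ϱ ∈ energySpace d)
    (hVm : AEStronglyMeasurable V volume) :
    ∫⁻ x, energyDensity V ϱ x = energy V ϱ := by
  have hD := diagonalizes_eig hd h.1
  have hm : ∀ p, AEMeasurable (fun x => ‖eigvec ϱ p x‖ₑ ^ 2) volume := fun p =>
    (Lp.aestronglyMeasurable _).enorm.pow_const 2
  have hVm' : AEMeasurable (fun x => ENNReal.ofReal (V x)) volume :=
    ENNReal.measurable_ofReal.comp_aemeasurable hVm.aemeasurable
  have hg : ∀ p j, AEMeasurable (fun x => ‖grad (eigvec ϱ p) j x‖ₑ ^ 2) volume := fun p j =>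
    (Lp.aestronglyMeasurable _).enorm.pow_const 2
  have hgs : ∀ p, AEMeasurable (fun x => ∑ j, ‖grad (eigvec ϱ p) j x‖ₑ ^ 2) volume := fun p =>
    Finset.aemeasurable_fun_sum _ fun j _ => hg p j
  simp only [energyDensity]
  have hdm : AEMeasurable (fun x => ENNReal.ofReal (V x) * density ϱ x) volume :=
    hVm'.mul (AEMeasurable.tsum fun p => (hm p).const_mul _)
  rw [lintegral_add_right' _ hdm]
  simp only [kineticDensity, density, ← ENNReal.tsum_mul_left]
  have hVd : ∀ p, AEMeasurable (fun x => ENNReal.ofReal (V x) *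
      (ENNReal.ofReal (eigval ϱ p) * ‖eigvec ϱ p x‖ₑ ^ 2)) volume := fun p =>
    hVm'.mul ((hm p).const_mul _)
  rw [lintegral_tsum fun p => (hgs p).const_mul _, lintegral_tsum hVd, ← ENNReal.tsum_add]
  refine tsum_congr fun p => ?_
  -- An eigenvector of weight zero may lie outside `H¹`, where `kineticForm` is infinite but the
  -- density uses an arbitrary value of `grad`; the zero weight kills both.
  rcases (hD.1 p).eq_or_lt with hp | hp
  · simp [← hp]
  have hH1 : InH1 (eigvec ϱ p) :=
    (kineticForm_lt_top_iff _).1 (mul_lt_top_of_tsum h.2 hp)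
  rw [energyForm, kineticForm, if_pos hH1, mul_add, lintegral_const_mul' _ _ ENNReal.ofReal_ne_top,
    lintegral_finsetSum' _ fun j _ => hg p j]
  simp_rw [enorm_sq_eq_lintegral, mul_left_comm (ENNReal.ofReal (V _))]
  rw [lintegral_const_mul' _ _ ENNReal.ofReal_ne_top]

lemma hasSum_eigval (hd : 1 ≤ d) (h : IsDensityOperator ϱ) :
    HasSum (eigval ϱ) (posTrace ϱ).toReal := by
  have hD := diagonalizes_eig hd h
  have h1 := hD.posTrace_eq
  have h2 := ENNReal.hasSum_toReal (h1 ▸ h.2.ne)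
  rw [h1, ENNReal.tsum_toReal_eq fun p => ENNReal.ofReal_ne_top]
  simpa only [ENNReal.toReal_ofReal (hD.1 _)] using h2

/-- The total current is the sum of the currents of the eigenvectors. -/
lemma hasSum_current (hd : 1 ≤ d) (h : ϱ ∈ energySpace d) (j : Fin d) :
    HasSum (fun p => eigval ϱ p * currentVec (eigvec ϱ p) j) ((∫ x, current ϱ x) j) := by
  have hD := diagonalizes_eig hd h.1
  let F : Fin d → ℕ → Space d → ℝ := fun j p x =>
    eigval ϱ p * (starRingEnd ℂ (eigvec ϱ p x) * grad (eigvec ϱ p) j x).im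
  have hFint : ∀ j p, Integrable (F j p) volume := fun j p => by
    have := (L2.integrable_inner (𝕜 := ℂ) (eigvec ϱ p) (grad (eigvec ϱ p) j)).im.const_mul
      (eigval ϱ p)
    refine this.congr (Eventually.of_forall fun x => ?_)
    simp only [F, RCLike.inner_apply, mul_comm]
    rfl
  have hFeq : ∀ j p, ∫ x, F j p x = eigval ϱ p * currentVec (eigvec ϱ p) j := fun j p => by
    simp only [F]
    rw [integral_const_mul]
    congr 1
    change _ = (inner ℂ (eigvec ϱ p) (grad (eigvec ϱ p) j)).im
    rw [L2.inner_def]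
    have := integral_im (L2.integrable_inner (𝕜 := ℂ) (eigvec ϱ p) (grad (eigvec ϱ p) j))
    simp only [RCLike.im_to_complex] at this
    rw [← this]
    simp only [RCLike.inner_apply, mul_comm]
  -- The bound `|φ||∂_jφ| ≤ |φ|² + |∂_jφ|²` controls the sum by the trace plus the kinetic energy,
  -- which justifies exchanging sum and integral.
  have hFfin : ∀ j, ∑' p, ∫⁻ x, ‖F j p x‖ₑ ≠ ⊤ := fun j => by
    have hle : ∀ p, ∫⁻ x, ‖F j p x‖ₑ ≤ ENNReal.ofReal (eigval ϱ p) +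
        ENNReal.ofReal (eigval ϱ p) * kineticForm (eigvec ϱ p) := fun p => by
      have h1 : ∀ x, ‖F j p x‖ₑ ≤ ENNReal.ofReal (eigval ϱ p) *
          (‖eigvec ϱ p x‖ₑ ^ 2 + ‖grad (eigvec ϱ p) j x‖ₑ ^ 2) := fun x => by
        simp only [F]
        rw [enorm_mul, Real.enorm_of_nonneg (hD.1 p)]
        gcongr
        have h2 : ‖(starRingEnd ℂ (eigvec ϱ p x) * grad (eigvec ϱ p) j x).im‖ₑ ≤
            ‖eigvec ϱ p x‖ₑ * ‖grad (eigvec ϱ p) j x‖ₑ := by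
          rw [← ofReal_norm, ← ofReal_norm, ← ofReal_norm, ← ENNReal.ofReal_mul (norm_nonneg _)]
          refine ENNReal.ofReal_le_ofReal ((Complex.abs_im_le_norm _).trans ?_)
          rw [norm_mul, RCLike.norm_conj]
        refine h2.trans ?_
        rcases le_total ‖eigvec ϱ p x‖ₑ ‖grad (eigvec ϱ p) j x‖ₑ with h3 | h3
        · refine le_trans ?_ le_add_self
          rw [sq]
          gcongr
        · refine le_trans ?_ le_self_add
          rw [sq]
          gcongr
      refine (lintegral_mono h1).trans ?_
      rw [lintegral_const_mul' _ _ ENNReal.ofReal_ne_top,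
        lintegral_add_left' ((Lp.aestronglyMeasurable _).enorm.pow_const 2),
        ← enorm_sq_eq_lintegral, ← enorm_sq_eq_lintegral, mul_add]
      gcongr
      · rw [← ofReal_norm, hD.2.1.1 p]
        simp
      · exact enorm_grad_sq_le_kineticForm _ j
    refine ne_top_of_le_ne_top ?_ (ENNReal.tsum_le_tsum hle)
    rw [ENNReal.tsum_add, ← hD.posTrace_eq]
    exact ENNReal.add_ne_top.2 ⟨h.1.2.ne, h.2.ne⟩
  have hcomp : (∫ x, current ϱ x) j = ∫ x, ∑' p, F j p x :=
    eval_integral_piLp (fun j => integrable_tsum_of_lintegral (hFint j) (hFfin j)) j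
  rw [hcomp]
  simp_rw [← hFeq]
  refine hasSum_integral_of_summable_integral_norm (hFint j) ?_
  have := ENNReal.summable_toReal (hFfin j)
  simpa only [integral_norm_eq_lintegral_enorm (hFint j _).1] using this

lemma hasSum_inner_current (hd : 1 ≤ d) (h : ϱ ∈ energySpace d) (b : Space d) :
    HasSum (fun p => eigval ϱ p * inner ℝ b (currentVec (eigvec ϱ p)))
      (inner ℝ b (∫ x, current ϱ x)) := by
  have h1 := hasSum_sum (s := Finset.univ) fun j _ => (hasSum_current hd h j).mul_left (b j)
  have h2 : ∀ x : Space d, inner ℝ b x = ∑ j, b j * x j := fun x => by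
    rw [PiLp.inner_apply]
    exact Finset.sum_congr rfl fun j _ => mul_comm _ _
  rw [h2]
  refine h1.congr_fun fun p => ?_
  rw [h2, Finset.mul_sum]
  exact Finset.sum_congr rfl fun j _ => mul_left_comm _ _ _

lemma gauge_diagonalizes (hd : 1 ≤ d) (h : IsDensityOperator ϱ) (b : Space d) :
    Diagonalizes (gauge b ϱ) (eigval ϱ) (fun p => phaseOp b (eigvec ϱ p)) := by
  rw [gauge_eq_conj]
  exact (diagonalizes_eig hd h).conj (phaseOp_mem_unitary b)

lemma posTrace_gauge (hd : 1 ≤ d) (h : IsDensityOperator ϱ) (b : Space d) :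
    posTrace (gauge b ϱ) = posTrace ϱ := by
  rw [(gauge_diagonalizes hd h b).posTrace_eq, (diagonalizes_eig hd h).posTrace_eq]

lemma isDensityOperator_gauge (hd : 1 ≤ d) (h : IsDensityOperator ϱ) (b : Space d) :
    IsDensityOperator (gauge b ϱ) :=
  ⟨(gauge_diagonalizes hd h b).isPositive, (posTrace_gauge hd h b).trans_lt h.2⟩

/-- The vectors `e^{ix·b} φ_p` diagonalize the conjugated state with the same weights, so the
identity for one vector can be summed over `p`. -/
lemma energy_gauge_aux (hd : 1 ≤ d) (hV : ∀ x, 0 ≤ V x) (hVm : AEStronglyMeasurable V volume)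
    (h : ϱ ∈ energySpace d) (hE : energy V ϱ < ⊤) (b : Space d) :
    energy V (gauge b ϱ) < ⊤ ∧ (energy V (gauge b ϱ)).toReal = (energy V ϱ).toReal +
      2 * inner ℝ b (∫ x, current ϱ x) + ‖b‖ ^ 2 * (posTrace ϱ).toReal := by
  have hD := diagonalizes_eig hd h.1
  set r := eigval ϱ
  set φ := eigvec ϱ
  have hfin : ∀ p, 0 < r p → energyForm V (φ p) < ⊤ := fun p hp => mul_lt_top_of_tsum hE hp
  have hterm : ∀ p, ENNReal.ofReal (r p) * energyForm V (phaseOp b (φ p)) =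
      ENNReal.ofReal (r p * (energyForm V (phaseOp b (φ p))).toReal) := fun p => by
    rcases (hD.1 p).eq_or_lt with hp | hp
    · simp [← hp]
    · rw [ENNReal.ofReal_mul (hD.1 p),
        ENNReal.ofReal_toReal (energyForm_phaseOp_lt_top (hfin p hp) b).ne]
  have hval : ∀ p, r p * (energyForm V (phaseOp b (φ p))).toReal =
      r p * (energyForm V (φ p)).toReal + 2 * (r p * inner ℝ b (currentVec (φ p))) +
        ‖b‖ ^ 2 * r p := fun p => by
    rcases (hD.1 p).eq_or_lt with hp | hp
    · simp [← hp]
    · rw [toReal_energyForm_phaseOp (hfin p hp), hD.2.1.1 p]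
      ring
  have hsumE : HasSum (fun p => r p * (energyForm V (φ p)).toReal) (energy V ϱ).toReal := by
    have h1 := ENNReal.hasSum_toReal hE.ne
    rw [energy, formTrace, ENNReal.tsum_toReal_eq fun p =>
      (lt_of_le_of_lt (ENNReal.le_tsum p) hE).ne]
    simpa only [ENNReal.toReal_mul, r, ENNReal.toReal_ofReal (hD.1 _)] using h1
  have hsum := (hsumE.add ((hasSum_inner_current hd h b).mul_left 2)).add
    ((hasSum_eigval hd h.1).mul_left (‖b‖ ^ 2))
  rw [← funext hval] at hsum
  have hG : energy V (gauge b ϱ) = ENNReal.ofReal ((energy V ϱ).toReal +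
      2 * inner ℝ b (∫ x, current ϱ x) + ‖b‖ ^ 2 * (posTrace ϱ).toReal) := by
    rw [energy, formTrace_eq hd (isDensityOperator_gauge hd h.1 b) (gauge_diagonalizes hd h.1 b)
      hV hVm, tsum_congr hterm, ← ENNReal.ofReal_tsum_of_nonneg
      (fun p => mul_nonneg (hD.1 p) ENNReal.toReal_nonneg) hsum.summable, hsum.tsum_eq]
  refine ⟨hG ▸ ENNReal.ofReal_lt_top, ?_⟩
  rw [hG, ENNReal.toReal_ofReal]
  exact hsum.nonneg fun p => mul_nonneg (hD.1 p) ENNReal.toReal_nonneg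

lemma energySpace_gauge (hd : 1 ≤ d) (h : ϱ ∈ energySpace d) (b : Space d) :
    gauge b ϱ ∈ energySpace d := by
  refine ⟨isDensityOperator_gauge hd h.1 b, ?_⟩
  rw [formTrace_kineticForm]
  exact (energy_gauge_aux hd (V := fun _ => 0) (fun _ => le_rfl) aestronglyMeasurable_const h
    (by rw [energy, ← formTrace_kineticForm]; exact h.2) b).1

/-- The current is the coefficient of the linear term in the kinetic energy of a boosted state.
Boosting by `b` then `b'`, or at once by `b' + b`, gives the same energy, and comparing the terms
linear in `b'` gives the shift. -/
lemma integral_current_gauge (hd : 1 ≤ d) (h : ϱ ∈ energySpace d) (b : Space d) :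
    ∫ x, current (gauge b ϱ) x = (∫ x, current ϱ x) + (posTrace ϱ).toReal • b := by
  have hk : ∀ {σ : Op d}, σ ∈ energySpace d → energy (fun _ => 0) σ < ⊤ := fun {σ} hσ => by
    rw [energy, ← formTrace_kineticForm]; exact hσ.2
  have key : ∀ {σ : Op d} (_ : σ ∈ energySpace d) (b : Space d),
      (energy (fun _ => 0) (gauge b σ)).toReal = (energy (fun _ => 0) σ).toReal +
      2 * inner ℝ b (∫ x, current σ x) + ‖b‖ ^ 2 * (posTrace σ).toReal := fun hσ b =>
    (energy_gauge_aux hd (fun _ => le_rfl) aestronglyMeasurable_const hσ (hk hσ) b).2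
  refine ext_inner_left ℝ fun b' => ?_
  have h1 := key (energySpace_gauge hd h b) b'
  have h2 := key h b
  have h3 := key h (b' + b)
  rw [gauge_gauge, posTrace_gauge hd h.1] at h1
  rw [h1, h2, inner_add_left, norm_add_sq_real] at h3
  rw [inner_add_right, inner_smul_right]
  linarith

lemma mem_statesGlobal_iff (hd : 1 ≤ d) (hVm : AEStronglyMeasurable V volume) {a c : ℝ}
    {b : Space d} : ϱ ∈ statesGlobal V a b c ↔ ϱ ∈ energySpace d ∧ posTrace ϱ = ENNReal.ofReal a ∧
      ∫ x, current ϱ x = b ∧ energy V ϱ = ENNReal.ofReal c := by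
  refine and_congr_right fun h => ?_
  rw [lintegral_density hd h.1, lintegral_energyDensity hd h hVm]

lemma gauge_mem_statesGlobal (hd : 1 ≤ d) (hV : ∀ x, 0 ≤ V x)
    (hVm : AEStronglyMeasurable V volume) {a c : ℝ} (ha : 0 < a) {b : Space d}
    (h : ϱ ∈ statesFinite V a) (hu : ∫ x, current ϱ x = 0)
    (hE : energy V ϱ + ENNReal.ofReal (‖b‖ ^ 2 / a) = ENNReal.ofReal c) :
    gauge (a⁻¹ • b) ϱ ∈ statesGlobal V a b c := by
  have ht : (posTrace ϱ).toReal = a := by rw [h.1.2, ENNReal.toReal_ofReal ha.le]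
  have hG := energy_gauge_aux hd hV hVm h.1.1 h.2 (a⁻¹ • b)
  rw [mem_statesGlobal_iff hd hVm]
  refine ⟨energySpace_gauge hd h.1.1 _, (posTrace_gauge hd h.1.1.1 _).trans h.1.2, ?_, ?_⟩
  · rw [integral_current_gauge hd h.1.1, hu, ht, smul_smul, mul_inv_cancel₀ ha.ne', one_smul,
      zero_add]
  · rw [← hE, ← ENNReal.ofReal_toReal hG.1.ne, hG.2, hu, ht, inner_zero_right, mul_zero, add_zero,
      ENNReal.ofReal_add ENNReal.toReal_nonneg (by positivity), ENNReal.ofReal_toReal h.2.ne,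
      norm_smul, Real.norm_of_nonneg (inv_nonneg.2 ha.le)]
    congr 2
    field_simp

lemma gauge_mem_statesFinite (hd : 1 ≤ d) (hV : ∀ x, 0 ≤ V x)
    (hVm : AEStronglyMeasurable V volume) {a c : ℝ} (ha : 0 < a) {b : Space d}
    (h : ϱ ∈ statesGlobal V a b c) :
    gauge (-(a⁻¹ • b)) ϱ ∈ statesFinite V a ∧
      energy V (gauge (-(a⁻¹ • b)) ϱ) + ENNReal.ofReal (‖b‖ ^ 2 / a) = ENNReal.ofReal c := by
  rw [mem_statesGlobal_iff hd hVm] at h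
  obtain ⟨h1, h2, h3, h4⟩ := h
  have hE : energy V ϱ < ⊤ := h4 ▸ ENNReal.ofReal_lt_top
  have ht : (posTrace ϱ).toReal = a := by rw [h2, ENNReal.toReal_ofReal ha.le]
  have hG := energy_gauge_aux hd hV hVm h1 hE (-(a⁻¹ • b))
  refine ⟨⟨⟨energySpace_gauge hd h1 _, (posTrace_gauge hd h1.1 _).trans h2⟩, hG.1⟩, ?_⟩
  rw [← h4, ← ENNReal.ofReal_toReal hG.1.ne,
    ← ENNReal.ofReal_add ENNReal.toReal_nonneg (by positivity), hG.2, h3, ht,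
    ← ENNReal.ofReal_toReal hE.ne]
  congr 1
  rw [inner_neg_left, inner_smul_left, real_inner_self_eq_norm_sq, norm_neg, norm_smul,
    Real.norm_of_nonneg (inv_nonneg.2 ha.le), ENNReal.toReal_ofReal ENNReal.toReal_nonneg]
  simp
  field_simp
  ring

end States

/-! ### Unitary invariance of the entropy, and functional calculus on eigenvectors -/

section Entropy

variable {H : Type*} [NormedAddCommGroup H] [InnerProductSpace ℂ H] [CompleteSpace H]

lemma posTrace_conj {B : H →L[ℂ] H} (hB : B.IsPositive) {u : H →L[ℂ] H}
    (hu : u ∈ unitary (H →L[ℂ] H)) : posTrace (u * B * star u) = posTrace B := by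
  classical
  obtain ⟨w, e, -⟩ := exists_hilbertBasis ℂ H
  have hpos : (u * B * star u).IsPositive := hB.conj_adjoint u
  let U : H ≃ₗᵢ[ℂ] H := Unitary.linearIsometryEquiv ⟨u, hu⟩
  let e' : HilbertBasis w ℂ H := HilbertBasis.ofRepr (U.symm.trans e.repr)
  have he' : ∀ i, e' i = u (e i) := fun i => by
    rw [← e'.repr_symm_single, ← e.repr_symm_single]
    rfl
  rw [posTrace_eq_tsum hpos e', posTrace_eq_tsum hB e]
  refine tsum_congr fun i => ?_
  have h1 : (star u * u) (e i) = e i := by rw [(Unitary.mem_iff.1 hu).1]; rfl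
  have h2 : (u * B * star u) (u (e i)) = u (B (e i)) := by
    change u (B ((star u * u) (e i))) = _
    rw [h1]
  rw [he', h2, inner_unitary_apply hu]

lemma inner_le_mul_norm_sq {A : H →L[ℂ] H} (hA : A.IsPositive) {a : ℝ} (ha : 0 ≤ a)
    (htr : posTrace A = ENNReal.ofReal a) (v : H) : (inner ℂ v (A v)).re ≤ a * ‖v‖ ^ 2 := by
  rcases eq_or_ne v 0 with rfl | hv
  · simp
  have hv' : 0 < ‖v‖ := norm_pos_iff.2 hv
  have h1 := inner_le_posTrace hA (v := ((‖v‖⁻¹ : ℝ) : ℂ) • v) (by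
    rw [norm_smul]; simp [hv'.ne'])
  rw [htr, ENNReal.ofReal_le_ofReal_iff ha, map_smul, inner_smul_left, inner_smul_right,
    Complex.conj_ofReal, ← mul_assoc, ← Complex.ofReal_mul, Complex.re_ofReal_mul] at h1
  have h2 : ‖v‖⁻¹ * ‖v‖⁻¹ * (inner ℂ v (A v)).re * ‖v‖ ^ 2 ≤ a * ‖v‖ ^ 2 := by gcongr
  convert h2 using 1
  field_simp

/-- A positive operator is bounded by its trace, so the entropy only sees `β` on `[0, a]`, where it
is continuous. -/
lemma spectrum_subset_Icc {A : H →L[ℂ] H} (hA : A.IsPositive) {a : ℝ} (ha : 0 ≤ a)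
    (htr : posTrace A = ENNReal.ofReal a) : spectrum ℝ A ⊆ Icc 0 a := by
  have h0 : 0 ≤ A := (ContinuousLinearMap.nonneg_iff_isPositive A).2 hA
  have h1 : A ≤ algebraMap ℝ (H →L[ℂ] H) a := by
    rw [ContinuousLinearMap.le_def, ContinuousLinearMap.isPositive_def']
    refine ⟨(IsSelfAdjoint.algebraMap _ (IsSelfAdjoint.all a)).sub hA.isSelfAdjoint, fun v => ?_⟩
    rw [ContinuousLinearMap.reApplyInnerSelf_apply]
    have := inner_le_mul_norm_sq hA ha htr v
    have h2 : inner ℂ (A v) v = inner ℂ v (A v) := hA.isSymmetric v v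
    have h3 : (algebraMap ℝ (H →L[ℂ] H) a) v = (a : ℂ) • v := by
      rw [Algebra.algebraMap_eq_smul_one]
      simp
    rw [sub_apply, h3, inner_sub_left, inner_smul_left, h2, inner_self_eq_norm_sq_to_K,
      Complex.conj_ofReal, map_sub]
    simp only [RCLike.re_to_complex, Complex.re_ofReal_mul]
    simp only [Complex.coe_algebraMap, ← Complex.ofReal_pow, Complex.ofReal_re]
    linarith
  exact fun x hx => ⟨spectrum_nonneg_of_nonneg h0 hx,
    (le_algebraMap_iff_spectrum_le hA.isSelfAdjoint).1 h1 x hx⟩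

lemma posPart_eq_cfc (B : H →L[ℂ] H) : B⁺ = cfc (fun x : ℝ => x⁺) B := by
  rw [CFC.posPart_def, cfcₙ_eq_cfc (hf0 := by simp)]

lemma negPart_eq_cfc (B : H →L[ℂ] H) : B⁻ = cfc (fun x : ℝ => x⁻) B := by
  rw [CFC.negPart_def, cfcₙ_eq_cfc (hf0 := by simp)]

/-- Unitary conjugation is a continuous star automorphism, so it commutes with `β(·)` and with
positive and negative parts, whose traces it preserves. -/
lemma entropy_conj {A : H →L[ℂ] H} (hA : IsSelfAdjoint A) {β : ℝ → ℝ}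
    (hβ : ContinuousOn β (spectrum ℝ A)) {u : H →L[ℂ] H} (hu : u ∈ unitary (H →L[ℂ] H)) :
    entropy β (u * A * star u) = entropy β A := by
  let F : (H →L[ℂ] H) ≃⋆ₐ[ℂ] (H →L[ℂ] H) := Unitary.conjStarAlgAut ℂ (H →L[ℂ] H) ⟨u, hu⟩
  have hF : ∀ B, F B = u * B * star u := fun B => rfl
  have hFc : Continuous F := by
    have : (F : (H →L[ℂ] H) → (H →L[ℂ] H)) = fun B => u * B * star u := funext hF
    rw [this]
    fun_prop
  have hmap : ∀ (f : ℝ → ℝ) (B : H →L[ℂ] H), IsSelfAdjoint B → ContinuousOn f (spectrum ℝ B) →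
      F (cfc f B) = cfc f (F B) := fun f B hB hf =>
    StarAlgHomClass.map_cfc F f B hf hFc hB (hB.map F)
  have h1 : cfc β (u * A * star u) = F (cfc β A) := (hmap β A hA hβ).symm
  have hB : IsSelfAdjoint (cfc β A) := cfc_predicate β A
  generalize hBd : cfc β A = B at h1 hB
  have h2 : (F B)⁺ = F B⁺ := by
    rw [posPart_eq_cfc, posPart_eq_cfc, hmap _ B hB continuous_posPart.continuousOn]
  have h3 : (F B)⁻ = F B⁻ := by
    rw [negPart_eq_cfc, negPart_eq_cfc, hmap _ B hB continuous_negPart.continuousOn]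
  rw [entropy, entropy, h1, hBd, saTrace, saTrace, h2, h3, hF, hF,
    posTrace_conj ((ContinuousLinearMap.nonneg_iff_isPositive _).1 (CFC.posPart_nonneg B)) hu,
    posTrace_conj ((ContinuousLinearMap.nonneg_iff_isPositive _).1 (CFC.negPart_nonneg B)) hu]

/-- An eigenvector of `A` is an eigenvector of `f(A)`. -/
lemma cfc_apply_eigenvector {A : H →L[ℂ] H} (hA : IsSelfAdjoint A) {f : ℝ → ℝ}
    (hf : ContinuousOn f (spectrum ℝ A)) {t : ℝ} {v : H} (hv : A v = (t : ℂ) • v) :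
    cfc f A v = (f t : ℂ) • v := by
  rcases eq_or_ne v 0 with rfl | hv0
  · simp
  have ht : t ∈ spectrum ℝ A := by
    rw [spectrum.mem_iff]
    intro hunit
    apply hv0
    have h1 : (algebraMap ℝ (H →L[ℂ] H) t - A) v = 0 := by
      rw [Algebra.algebraMap_eq_smul_one]
      simp [hv]
    obtain ⟨w, hw⟩ := hunit.exists_left_inv
    have := congrArg (fun B : H →L[ℂ] H => B v) hw
    simpa [h1] using this.symm
  -- Stone–Weierstrass: `S` contains the constants and the identity, and is stable under sums,
  -- products and limits.
  let S : Set C(spectrum ℝ A, ℝ) := {g | cfcHom hA g v = ((g ⟨t, ht⟩ : ℝ) : ℂ) • v}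
  have hS : ∀ g : C(spectrum ℝ A, ℝ), g ∈ S := fun g => by
    refine ContinuousMap.induction_on_of_compact (𝕜 := ℝ) (p := fun g => g ∈ S) ?_ ?_ ?_ ?_ ?_ ?_ g
    · intro r
      have : (ContinuousMap.const (spectrum ℝ A) r) = algebraMap ℝ C(spectrum ℝ A, ℝ) r := rfl
      simp only [S, mem_ofPred_eq]
      rw [this, AlgHomClass.commutes, Algebra.algebraMap_eq_smul_one]
      simp
    · simp only [S, mem_ofPred_eq]
      rw [cfcHom_id hA, hv]
      simp
    · have : star (ContinuousMap.restrict (spectrum ℝ A) (ContinuousMap.id ℝ)) =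
          ContinuousMap.restrict (spectrum ℝ A) (ContinuousMap.id ℝ) := by
        ext x
        simp
      rw [this]
      simp only [S, mem_ofPred_eq]
      rw [cfcHom_id hA, hv]
      simp
    · intro g₁ g₂ h₁ h₂
      simp only [S, mem_ofPred_eq] at *
      rw [map_add, add_apply, h₁, h₂, ContinuousMap.add_apply, Complex.ofReal_add, add_smul]
    · intro g₁ g₂ h₁ h₂
      simp only [S, mem_ofPred_eq] at *
      rw [map_mul, mul_apply_eq_comp, h₂, map_smul, h₁, smul_smul,
        ContinuousMap.mul_apply, Complex.ofReal_mul, mul_comm]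
    · intro g hg
      have hcl : IsClosed S := by
        refine isClosed_eq ?_ ?_
        · exact (ContinuousLinearMap.apply ℂ H v).continuous.comp (cfcHom_continuous hA)
        · exact (Complex.continuous_ofReal.comp (continuous_eval_const _)).smul
            continuous_const
      exact hcl.mem_of_frequently_of_tendsto hg tendsto_id
  rw [cfc_apply f A]
  exact hS _

end Entropy

/-- Dividing by `x` and letting `x → 0` from either side forces `a = 0`; dividing by `x²` then gives
`0 ≤ b`. The higher terms never matter: this extracts first and second variations. -/
lemma quartic_nonneg {a b c d : ℝ} (h : ∀ x : ℝ, 0 ≤ a * x + b * x ^ 2 + c * x ^ 3 + d * x ^ 4) :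
    a = 0 ∧ 0 ≤ b := by
  have hlim : ∀ a b c d : ℝ, (∀ x : ℝ, 0 < x → 0 ≤ a + b * x + c * x ^ 2 + d * x ^ 3) → 0 ≤ a := by
    intro a b c d h
    have hc : Continuous fun x : ℝ => a + b * x + c * x ^ 2 + d * x ^ 3 := by fun_prop
    have ht : Tendsto (fun x : ℝ => a + b * x + c * x ^ 2 + d * x ^ 3) (𝓝[>] 0) (𝓝 a) := by
      have := (hc.tendsto 0).mono_left (nhdsWithin_le_nhds (s := Ioi 0))
      simpa using this
    exact ge_of_tendsto ht (eventually_nhdsWithin_of_forall fun x hx => h x hx)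
  have h1 : 0 ≤ a := hlim a b c d fun x hx => by
    have := h x
    have h2 : 0 ≤ x * (a + b * x + c * x ^ 2 + d * x ^ 3) := by linarith
    exact nonneg_of_mul_nonneg_right h2 hx
  have h2 : 0 ≤ -a := hlim (-a) b (-c) d fun x hx => by
    have := h (-x)
    have h2 : 0 ≤ x * (-a + b * x + -c * x ^ 2 + d * x ^ 3) := by
      ring_nf at this ⊢
      linarith
    exact nonneg_of_mul_nonneg_right h2 hx
  have h3 : a = 0 := by linarith
  subst h3
  refine ⟨rfl, hlim b c d 0 fun x hx => ?_⟩
  have := h x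
  have h2 : 0 ≤ x ^ 2 * (b + c * x + d * x ^ 2 + 0 * x ^ 3) := by linarith
  exact nonneg_of_mul_nonneg_right h2 (by positivity)

/-! ### From minimality under reflections to a ground state -/

section GroundState

variable {H K : Type*} [NormedAddCommGroup H] [InnerProductSpace ℂ H]
  [NormedAddCommGroup K] [InnerProductSpace ℂ K]

lemma hasSum_inner_left {r : ℕ → ℝ} {φ : ℕ → H} {γ : ℕ → K} {f : H} {y : K}
    (h : HasSum (fun p => ((r p : ℂ) * inner ℂ (φ p) f) • γ p) y) (k : K) :
    HasSum (fun p => (r p : ℂ) * inner ℂ f (φ p) * inner ℂ (γ p) k) (inner ℂ y k) := by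
  have h1 := (h.mapL (innerSL ℂ k)).mapL (Complex.conjCLE : ℂ →L[ℝ] ℂ)
  simp only [innerSL_apply_apply, ContinuousLinearEquiv.coe_coe, Complex.conjCLE_apply,
    inner_conj_symm] at h1
  refine h1.congr_fun fun p => ?_
  rw [inner_smul_left, map_mul, Complex.conj_ofReal, inner_conj_symm]

/-- The state `A = ∑_p r_p |φ_p⟩⟨φ_p|` has minimal energy, for the form `‖Γ ·‖²` with domain `D`,
among its conjugates by the reflections along the vectors of `D`. The operator `Y` is `Γ A`. -/
structure ReflectionMinimal (A : H →L[ℂ] H) (r : ℕ → ℝ) (φ : ℕ → H) (D : Submodule ℂ H)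
    (Γ Y : H →ₗ[ℂ] K) : Prop where
  diag : Diagonalizes A r φ
  summable : Summable r
  mem : ∀ p, 0 < r p → φ p ∈ D
  summable_form : Summable fun p => r p * ‖Γ (φ p)‖ ^ 2
  hasSum : ∀ f, HasSum (fun p => ((r p : ℂ) * inner ℂ (φ p) f) • Γ (φ p)) (Y f)
  le : ∀ v ∈ D, (inner ℂ (Y v) (Γ v)).re * ‖v‖ ^ 2 ≤ ‖Γ v‖ ^ 2 * (inner ℂ v (A v)).re
  eigen : ∀ v ∈ D, (inner ℂ (Y v) (Γ v)).re * ‖v‖ ^ 2 = ‖Γ v‖ ^ 2 * (inner ℂ v (A v)).re →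
    ∃ t : ℂ, A v = t • v

namespace ReflectionMinimal

variable {A : H →L[ℂ] H} {r : ℕ → ℝ} {φ : ℕ → H} {D : Submodule ℂ H} {Γ Y : H →ₗ[ℂ] K}

lemma apply_eigvec (h : ReflectionMinimal A r φ D Γ Y) (p : ℕ) :
    Y (φ p) = (r p : ℂ) • Γ (φ p) := by
  have h2 := hasSum_single (f := fun q => ((r q : ℂ) * inner ℂ (φ q) (φ p)) • Γ (φ q)) p
    fun q hq => by simp [h.diag.2.1.2 hq]
  rw [(h.hasSum (φ p)).unique h2]
  simp [inner_self_eq_norm_sq_to_K, h.diag.2.1.1 p]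

lemma hasSum_inner (h : ReflectionMinimal A r φ D Γ Y) (f : H) (k : K) :
    HasSum (fun p => (r p : ℂ) * inner ℂ f (φ p) * inner ℂ (Γ (φ p)) k) (inner ℂ (Y f) k) :=
  hasSum_inner_left (h.hasSum f) k

/-- First and second variations along `ψ ⟂ x`, for an eigenvector `x` of the state. -/
lemma variations (h : ReflectionMinimal A r φ D Γ Y) (hA : A.IsSymmetric) {x ψ : H} (hx : x ∈ D)
    (hx1 : ‖x‖ = 1) {t : ℝ} (hAx : A x = (t : ℂ) • x) (hYx : Y x = (t : ℂ) • Γ x) (hψ : ψ ∈ D)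
    (hort : inner ℂ x ψ = 0) :
    t * (inner ℂ (Γ x) (Γ ψ)).re = (inner ℂ (Y ψ) (Γ x)).re ∧
      (inner ℂ (Y ψ) (Γ ψ)).re ≤ t * ‖Γ ψ‖ ^ 2 + ‖Γ x‖ ^ 2 * (inner ℂ ψ (A ψ)).re
        - t * ‖Γ x‖ ^ 2 * ‖ψ‖ ^ 2 := by
  have hort' : inner ℂ ψ x = 0 := inner_eq_zero_symm.1 hort
  have hAψ : inner ℂ x (A ψ) = 0 := by
    have := hA x ψ
    simp only [ContinuousLinearMap.coe_coe] at this
    rw [← this, hAx, inner_smul_left, hort, mul_zero]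
  -- The inequality `h.le` at `x + yψ`, expanded in `y`; the constant term cancels because `x` is an
  -- eigenvector.
  have key : ∀ y : ℝ, 0 ≤ (t * (inner ℂ (Γ x) (Γ ψ)).re - (inner ℂ (Y ψ) (Γ x)).re) * y +
      (t * ‖Γ ψ‖ ^ 2 + ‖Γ x‖ ^ 2 * (inner ℂ ψ (A ψ)).re - t * ‖Γ x‖ ^ 2 * ‖ψ‖ ^ 2
        - (inner ℂ (Y ψ) (Γ ψ)).re) * y ^ 2 +
      (2 * (inner ℂ (Γ x) (Γ ψ)).re * (inner ℂ ψ (A ψ)).re -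
        (t * (inner ℂ (Γ x) (Γ ψ)).re + (inner ℂ (Y ψ) (Γ x)).re) * ‖ψ‖ ^ 2) * y ^ 3 +
      (‖Γ ψ‖ ^ 2 * (inner ℂ ψ (A ψ)).re - (inner ℂ (Y ψ) (Γ ψ)).re * ‖ψ‖ ^ 2) * y ^ 4 := by
    intro y
    have h0 := h.le (x + (y : ℂ) • ψ) (D.add_mem hx (D.smul_mem _ hψ))
    have h1 : ‖x + (y : ℂ) • ψ‖ ^ 2 = 1 + y ^ 2 * ‖ψ‖ ^ 2 := by
      rw [@norm_add_sq ℂ, inner_smul_right, hort, hx1, norm_smul, mul_pow]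
      simp
    have h2 : (inner ℂ (x + (y : ℂ) • ψ) (A (x + (y : ℂ) • ψ))).re =
        t + y ^ 2 * (inner ℂ ψ (A ψ)).re := by
      rw [map_add, map_smul, hAx]
      simp only [inner_add_left, inner_add_right, inner_smul_left, inner_smul_right, hort',
        hAψ, inner_self_eq_norm_sq_to_K, hx1, Complex.conj_ofReal]
      simp
      ring
    have h3 : ‖Γ (x + (y : ℂ) • ψ)‖ ^ 2 =
        ‖Γ x‖ ^ 2 + 2 * y * (inner ℂ (Γ x) (Γ ψ)).re + y ^ 2 * ‖Γ ψ‖ ^ 2 := by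
      rw [map_add, map_smul, @norm_add_sq ℂ, inner_smul_right, norm_smul, mul_pow]
      simp
      ring
    have h4 : (inner ℂ (Y (x + (y : ℂ) • ψ)) (Γ (x + (y : ℂ) • ψ))).re =
        t * ‖Γ x‖ ^ 2 + y * (t * (inner ℂ (Γ x) (Γ ψ)).re + (inner ℂ (Y ψ) (Γ x)).re) +
          y ^ 2 * (inner ℂ (Y ψ) (Γ ψ)).re := by
      rw [map_add, map_smul, map_add, map_smul, hYx]
      simp only [inner_add_left, inner_add_right, inner_smul_left, inner_smul_right,
        inner_self_eq_norm_sq_to_K, Complex.conj_ofReal]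
      simp [← Complex.ofReal_pow]
      ring
    rw [h1, h2, h3, h4] at h0
    linarith
  have := quartic_nonneg key
  constructor <;> linarith [this.1, this.2]

/-- The first variation along `ψ` gives the real part, along `iψ` the imaginary part. -/
lemma inner_eq (h : ReflectionMinimal A r φ D Γ Y) (hA : A.IsSymmetric) {x ψ : H} (hx : x ∈ D)
    (hx1 : ‖x‖ = 1) {t : ℝ} (hAx : A x = (t : ℂ) • x) (hYx : Y x = (t : ℂ) • Γ x) (hψ : ψ ∈ D)
    (hort : inner ℂ x ψ = 0) : inner ℂ (Y ψ) (Γ x) = t * inner ℂ (Γ ψ) (Γ x) := by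
  have h1 := (h.variations hA hx hx1 hAx hYx hψ hort).1
  have h2 := (h.variations hA hx hx1 hAx hYx (D.smul_mem Complex.I hψ)
    (by rw [inner_smul_right, hort, mul_zero])).1
  rw [map_smul, map_smul, inner_smul_right, inner_smul_left] at h2
  have h3 : (inner ℂ (Γ ψ) (Γ x)).re = (inner ℂ (Γ x) (Γ ψ)).re := by
    rw [← inner_conj_symm, Complex.conj_re]
  have h4 : (inner ℂ (Γ ψ) (Γ x)).im = -(inner ℂ (Γ x) (Γ ψ)).im := by
    rw [← inner_conj_symm, Complex.conj_im]
  apply Complex.ext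
  · rw [Complex.re_ofReal_mul, h3, h1]
  · rw [Complex.im_ofReal_mul, h4]
    simp only [Complex.mul_re, Complex.I_re, Complex.I_im, Complex.conj_I, Complex.neg_re,
      Complex.neg_im] at h2
    linarith

lemma inner_eigvec_eq_zero (h : ReflectionMinimal A r φ D Γ Y) (hA : A.IsSymmetric) {p q : ℕ}
    (hp : 0 < r p) (hq : 0 < r q) (hpq : r p ≠ r q) : inner ℂ (Γ (φ q)) (Γ (φ p)) = 0 := by
  have hne : p ≠ q := fun h => hpq (h ▸ rfl)
  have h1 := h.inner_eq hA (h.mem p hp) (h.diag.2.1.1 p) (h.diag.apply_eigvec p) (h.apply_eigvec p)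
    (h.mem q hq) (h.diag.2.1.2 hne)
  rw [h.apply_eigvec, inner_smul_left, Complex.conj_ofReal] at h1
  have h2 : ((r q : ℂ) - r p) * inner ℂ (Γ (φ q)) (Γ (φ p)) = 0 := by rw [sub_mul, h1, sub_self]
  rcases mul_eq_zero.1 h2 with h3 | h3
  · exact absurd (by exact_mod_cast (sub_eq_zero.1 h3).symm) hpq
  · exact h3

/-- The span of the eigenvectors with eigenvalue `R`. -/
def eigenspan (r : ℕ → ℝ) (φ : ℕ → H) (R : ℝ) : Submodule ℂ H :=
  Submodule.span ℂ (φ '' {p | r p = R})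

lemma mem_orthogonal_eigenspan {R : ℝ} {ψ : H} :
    ψ ∈ (eigenspan r φ R)ᗮ ↔ ∀ p, r p = R → inner ℂ (φ p) ψ = 0 := by
  refine ⟨fun h p hp => Submodule.mem_orthogonal _ _ |>.1 h _ (Submodule.subset_span ⟨p, hp, rfl⟩),
    fun h => ?_⟩
  rw [Submodule.mem_orthogonal]
  intro u hu
  have hle : eigenspan r φ R ≤ (ℂ ∙ ψ)ᗮ := by
    refine Submodule.span_le.2 ?_
    rintro _ ⟨p, hp, rfl⟩
    exact Submodule.mem_orthogonal_singleton_iff_inner_left.2 (h p hp)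
  exact Submodule.mem_orthogonal_singleton_iff_inner_left.1 (hle hu)

lemma eigenspan_spec (h : ReflectionMinimal A r φ D Γ Y) {R : ℝ} (hR : 0 < R) {x : H}
    (hx : x ∈ eigenspan r φ R) : x ∈ D ∧ A x = (R : ℂ) • x ∧ Y x = (R : ℂ) • Γ x := by
  induction hx using Submodule.span_induction with
  | mem x hx =>
    obtain ⟨p, rfl, rfl⟩ := hx
    exact ⟨h.mem p hR, h.diag.apply_eigvec p, h.apply_eigvec p⟩
  | zero => simp
  | add x y _ _ hx hy =>
    exact ⟨D.add_mem hx.1 hy.1, by rw [map_add, hx.2.1, hy.2.1, smul_add],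
      by rw [map_add, map_add, hx.2.2, hy.2.2, smul_add]⟩
  | smul c x _ hx =>
    exact ⟨D.smul_mem c hx.1, by rw [map_smul, hx.2.1, smul_comm],
      by rw [map_smul, map_smul, hx.2.2, smul_comm]⟩

/-- In `⟨Yψ, Γφ_m⟩ = ∑ r_p ⟨ψ,φ_p⟩⟨Γφ_p,Γφ_m⟩`, the terms with `r_p = R` vanish since `ψ ⟂ φ_p`, the
others by `inner_eigvec_eq_zero`. The first variation identifies this sum with `R ⟨Γψ, Γφ_m⟩`. -/
lemma inner_orthogonal_eq_zero (h : ReflectionMinimal A r φ D Γ Y) (hA : A.IsSymmetric) {R : ℝ}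
    (hR : 0 < R) {x ψ : H} (hx : x ∈ eigenspan r φ R) (hψ : ψ ∈ D)
    (hort : ψ ∈ (eigenspan r φ R)ᗮ) : inner ℂ (Γ ψ) (Γ x) = 0 := by
  rw [mem_orthogonal_eigenspan] at hort
  induction hx using Submodule.span_induction with
  | mem x hx =>
    obtain ⟨m, hm, rfl⟩ := hx
    have hm' : r m = R := hm
    have h1 := h.inner_eq hA (h.mem m (hm' ▸ hR)) (h.diag.2.1.1 m) (h.diag.apply_eigvec m)
      (h.apply_eigvec m) hψ (hort m hm')
    have h2 : inner ℂ (Y ψ) (Γ (φ m)) = 0 := by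
      refine (h.hasSum_inner ψ (Γ (φ m))).unique ?_
      convert hasSum_zero with p
      rcases (h.diag.1 p).eq_or_lt with hp | hp
      · simp [← hp]
      by_cases hpR : r p = R
      · rw [inner_eq_zero_symm.1 (hort p hpR), mul_zero, zero_mul]
      · rw [h.inner_eigvec_eq_zero hA (hm' ▸ hR : 0 < r m) hp (hm' ▸ Ne.symm hpR), mul_zero]
    rw [h2] at h1
    rcases mul_eq_zero.1 h1.symm with h3 | h3
    · exact absurd (Complex.ofReal_eq_zero.1 h3) (hm' ▸ hR.ne')
    · exact h3
  | zero => simp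
  | add x y _ _ hx hy => rw [map_add, inner_add_right, hx, hy, add_zero]
  | smul c x _ hx => rw [map_smul, inner_smul_right, hx, mul_zero]

lemma mem_eigenspan (h : ReflectionMinimal A r φ D Γ Y) (hA : A.IsSymmetric) {R : ℝ}
    (hR : 0 < R) (hfin : {p | r p = R}.Finite) {x : H} (hx : A x = (R : ℂ) • x) :
    x ∈ eigenspan r φ R := by
  have h1 : HasSum (fun p => ((r p : ℂ) * inner ℂ (φ p) x) • φ p)
      (∑ p ∈ hfin.toFinset, ((r p : ℂ) * inner ℂ (φ p) x) • φ p) := by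
    refine hasSum_sum_of_ne_finset_zero fun p hp => ?_
    have hp' : r p ≠ R := fun h => hp (by simpa using h)
    have h2 := hA (φ p) x
    simp only [ContinuousLinearMap.coe_coe] at h2
    rw [h.diag.apply_eigvec, hx, inner_smul_left, inner_smul_right, Complex.conj_ofReal] at h2
    have h3 : ((r p : ℂ) - R) * inner ℂ (φ p) x = 0 := by rw [sub_mul, h2, sub_self]
    rcases mul_eq_zero.1 h3 with h4 | h4
    · exact absurd (by exact_mod_cast sub_eq_zero.1 h4) hp'
    · rw [h4, mul_zero, zero_smul]
  have h2 := (h.diag.2.2 x).unique h1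
  rw [hx] at h2
  have h3 : x = (R : ℂ)⁻¹ • ∑ p ∈ hfin.toFinset, ((r p : ℂ) * inner ℂ (φ p) x) • φ p := by
    rw [← h2, smul_smul, inv_mul_cancel₀ (Complex.ofReal_ne_zero.2 hR.ne'), one_smul]
  rw [h3]
  exact Submodule.smul_mem _ _ (Submodule.sum_mem _ fun p hp => Submodule.smul_mem _ _
    (Submodule.subset_span ⟨p, by simpa using hp, rfl⟩))

end ReflectionMinimal

end GroundState

/-- Summability leaves finitely many indices above any positive level, so the largest value is
attained and isolated. `R₂` need not be a value of `r`: it is `R/2` when `r` takes no value in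
`[R/2, R)`. -/
lemma exists_max_gap {r : ℕ → ℝ} (hr : Summable r) {p₀ : ℕ} (hp₀ : 0 < r p₀) :
    ∃ R R₂ : ℝ, 0 < R ∧ R₂ < R ∧ 0 ≤ R₂ ∧ (∃ p, r p = R) ∧ {p | r p = R}.Finite ∧
      ∀ p, r p = R ∨ r p ≤ R₂ := by
  have hfin : ∀ t, 0 < t → {p | t ≤ r p}.Finite := fun t ht => by
    have h1 := hr.tendsto_cofinite_zero.eventually_lt_const ht
    simpa [Filter.eventually_cofinite] using h1
  obtain ⟨p₁, hp₁, hmax⟩ := Set.exists_max_image _ r (hfin _ hp₀) ⟨p₀, le_refl (r p₀)⟩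
  have hR : 0 < r p₁ := hp₀.trans_le hp₁
  have hle : ∀ p, r p ≤ r p₁ := fun p => by
    by_cases h : r p₀ ≤ r p
    · exact hmax p h
    · exact (not_le.1 h).le.trans hp₁
  have hS : {p | r p₁ / 2 ≤ r p ∧ r p ≠ r p₁}.Finite :=
    (hfin _ (half_pos hR)).subset fun p hp => hp.1
  refine ⟨r p₁, ?_⟩
  have hfR : {p | r p = r p₁}.Finite := (hfin _ hR).subset fun p hp => le_of_eq (Eq.symm hp)
  rcases Set.eq_empty_or_nonempty {p | r p₁ / 2 ≤ r p ∧ r p ≠ r p₁} with hE | hE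
  · refine ⟨r p₁ / 2, hR, half_lt_self hR, (half_pos hR).le, ⟨p₁, rfl⟩, hfR, fun p => ?_⟩
    by_contra! h
    exact (Set.eq_empty_iff_forall_notMem.1 hE p) ⟨h.2.le, h.1⟩
  · obtain ⟨p₂, hp₂, hmax₂⟩ := Set.exists_max_image _ r hS hE
    refine ⟨r p₂, hR, lt_of_le_of_ne (hle p₂) hp₂.2, (half_pos hR).le.trans hp₂.1, ⟨p₁, rfl⟩, hfR,
      fun p => ?_⟩
    by_contra! h
    exact absurd (hmax₂ p ⟨hp₂.1.trans h.2.le, h.1⟩) (not_le.2 h.2)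

section GroundState

variable {H K : Type*} [NormedAddCommGroup H] [InnerProductSpace ℂ H]
  [NormedAddCommGroup K] [InnerProductSpace ℂ K]

/-- The eigenspace, for the eigenvalue `E`, of the operator with form `‖Γ ·‖²` and form domain
`D`. -/
def formEigenspace (D : Submodule ℂ H) (Γ : H →ₗ[ℂ] K) (E : ℝ) : Submodule ℂ H where
  carrier := {v | v ∈ D ∧ ∀ f ∈ D, inner ℂ (Γ f) (Γ v) = E * inner ℂ f v}
  zero_mem' := ⟨D.zero_mem, by simp⟩
  add_mem' := fun {x y} hx hy => ⟨D.add_mem hx.1 hy.1, fun f hf => by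
    rw [map_add, inner_add_right, inner_add_right, hx.2 f hf, hy.2 f hf, mul_add]⟩
  smul_mem' := fun c {x} hx => ⟨D.smul_mem c hx.1, fun f hf => by
    rw [map_smul, inner_smul_right, inner_smul_right, hx.2 f hf]; ring⟩

lemma norm_sq_of_mem_formEigenspace {D : Submodule ℂ H} {Γ : H →ₗ[ℂ] K} {E : ℝ} {v : H}
    (hv : v ∈ formEigenspace D Γ E) : ‖Γ v‖ ^ 2 = E * ‖v‖ ^ 2 := by
  have := hv.2 v hv.1
  rw [inner_self_eq_norm_sq_to_K, inner_self_eq_norm_sq_to_K] at this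
  simpa [← Complex.ofReal_pow] using congrArg Complex.re this

lemma form_add_smul {Γ : H →ₗ[ℂ] K} (E : ℝ) (v f : H) (y : ℝ) :
    ‖Γ (v + (y : ℂ) • f)‖ ^ 2 - E * ‖v + (y : ℂ) • f‖ ^ 2 = (‖Γ v‖ ^ 2 - E * ‖v‖ ^ 2) +
      2 * y * ((inner ℂ (Γ f) (Γ v)).re - E * (inner ℂ f v).re) +
      y ^ 2 * (‖Γ f‖ ^ 2 - E * ‖f‖ ^ 2) := by
  have h : ∀ {F : Type _} [NormedAddCommGroup F] [InnerProductSpace ℂ F] (v f : F),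
      ‖v + (y : ℂ) • f‖ ^ 2 = ‖v‖ ^ 2 + 2 * y * (inner ℂ f v).re + y ^ 2 * ‖f‖ ^ 2 := by
    intro F _ _ v f
    rw [add_comm, @norm_add_sq ℂ, inner_smul_left, norm_smul, mul_pow]
    simp
    ring
  rw [map_add, map_smul, h, add_comm v, @norm_add_sq ℂ, inner_smul_left, norm_smul, mul_pow]
  simp
  ring

/-- A zero of the nonnegative form `‖Γ·‖² - E‖·‖²` is a minimum, so the first variation vanishes
along `f` and along `i f`. -/
lemma mem_formEigenspace_of_norm_sq_eq {D : Submodule ℂ H} {Γ : H →ₗ[ℂ] K} {E : ℝ}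
    (hE : ∀ f ∈ D, E * ‖f‖ ^ 2 ≤ ‖Γ f‖ ^ 2) {v : H} (hv : v ∈ D)
    (h : ‖Γ v‖ ^ 2 = E * ‖v‖ ^ 2) : v ∈ formEigenspace D Γ E := by
  have key : ∀ f ∈ D, (inner ℂ (Γ f) (Γ v)).re = E * (inner ℂ f v).re := fun f hf => by
    have := (quartic_nonneg (a := 2 * ((inner ℂ (Γ f) (Γ v)).re - E * (inner ℂ f v).re))
      (b := ‖Γ f‖ ^ 2 - E * ‖f‖ ^ 2) (c := 0) (d := 0) fun y => by
        have h1 := form_add_smul (Γ := Γ) E v f y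
        have h2 := hE _ (D.add_mem hv (D.smul_mem (y : ℂ) hf))
        rw [h] at h1
        linarith).1
    linarith
  refine ⟨hv, fun f hf => Complex.ext ?_ ?_⟩
  · rw [key f hf, Complex.re_ofReal_mul]
  · have := key _ (D.smul_mem Complex.I hf)
    rw [map_smul, inner_smul_left, inner_smul_left] at this
    simp only [Complex.mul_re, Complex.I_re, Complex.I_im, Complex.conj_I, Complex.neg_re,
      Complex.neg_im] at this
    rw [Complex.im_ofReal_mul]
    linarith

namespace ReflectionMinimal

variable {A : H →L[ℂ] H} {r : ℕ → ℝ} {φ : ℕ → H} {D : Submodule ℂ H} {Γ Y : H →ₗ[ℂ] K}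

/-- The infimum over the orthogonal complement need not be attained, so a near-minimizer `ψ`
replaces an eigenvector: it satisfies the eigenvalue equation up to `ε` against each `φ_p`, and
these errors are summed with weights `r_p`. -/
lemma le_inner_of_lower_bound (h : ReflectionMinimal A r φ D Γ Y) {R μ ε : ℝ} (hμ : 0 ≤ μ)
    (hε : 0 < ε)
    (hbd : ∀ f ∈ D, f ∈ (eigenspan r φ R)ᗮ → μ * ‖f‖ ^ 2 ≤ ‖Γ f‖ ^ 2) {ψ : H} (hψ : ψ ∈ D)
    (hort : ψ ∈ (eigenspan r φ R)ᗮ) (hψ1 : ‖ψ‖ = 1) (hlt : ‖Γ ψ‖ ^ 2 ≤ μ + ε ^ 2) :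
    μ * (inner ℂ ψ (A ψ)).re - ε * ∑' p, r p * (1 + ‖Γ (φ p)‖ ^ 2) ≤
      (inner ℂ (Y ψ) (Γ ψ)).re := by
  have hS : Summable fun p => r p * (1 + ‖Γ (φ p)‖ ^ 2) := by
    simpa only [mul_add, mul_one] using h.summable.add h.summable_form
  have h1 := (h.diag.hasSum_re_inner ψ).mul_left μ
  have h2 : HasSum (fun p => ((r p : ℂ) * inner ℂ ψ (φ p) * inner ℂ (Γ (φ p)) (Γ ψ)).re)
      (inner ℂ (Y ψ) (Γ ψ)).re := (h.hasSum_inner ψ (Γ ψ)).mapL Complex.reCLM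
  refine hasSum_le (fun p => ?_) (h1.sub (hS.hasSum.mul_left ε)) h2
  rcases (h.diag.1 p).eq_or_lt with hp | hp
  · simp [← hp]
  by_cases hpR : r p = R
  · rw [mem_orthogonal_eigenspan] at hort
    rw [hort p hpR, inner_eq_zero_symm.1 (hort p hpR)]
    have : 0 ≤ ε * (r p * (1 + ‖Γ (φ p)‖ ^ 2)) := by positivity
    simpa using this
  -- The test vector `ψ + ε z φ_p` has as cross term, up to `2ε`, the `p`-th term of `⟨Yψ, Γψ⟩`
  -- without its weight.
  · set z : ℂ := inner ℂ (φ p) ψ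
    have hz : ‖z‖ ≤ 1 := by
      have := norm_inner_le_norm (𝕜 := ℂ) (φ p) ψ
      rwa [h.diag.2.1.1 p, hψ1, one_mul] at this
    have hz2 : ‖z‖ ^ 2 ≤ 1 := pow_le_one₀ (norm_nonneg _) hz
    have hf : z • φ p ∈ D := D.smul_mem _ (h.mem p hp)
    have hfo : z • φ p ∈ (eigenspan r φ R)ᗮ := by
      refine Submodule.smul_mem _ _ (mem_orthogonal_eigenspan.2 fun q hq => h.diag.2.1.2 ?_)
      rintro rfl
      exact hpR hq
    have h3 := form_add_smul (Γ := Γ) μ ψ (z • φ p) ε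
    have h4 := hbd _ (D.add_mem hψ (D.smul_mem (ε : ℂ) hf))
      (Submodule.add_mem _ hort (Submodule.smul_mem _ (ε : ℂ) hfo))
    have h5 : (inner ℂ (z • φ p) ψ).re = ‖z‖ ^ 2 := by
      rw [inner_smul_left, mul_comm]
      change (z * (starRingEnd ℂ) z).re = _
      rw [Complex.mul_conj, Complex.normSq_eq_norm_sq, Complex.ofReal_re]
    have h6 : inner ℂ (Γ (z • φ p)) (Γ ψ) = inner ℂ ψ (φ p) * inner ℂ (Γ (φ p)) (Γ ψ) := by
      rw [map_smul, inner_smul_left, inner_conj_symm]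
    have h7 : ‖Γ (z • φ p)‖ ^ 2 ≤ ‖Γ (φ p)‖ ^ 2 := by
      rw [map_smul, norm_smul, mul_pow]
      exact mul_le_of_le_one_left (by positivity) hz2
    have h8 : 0 ≤ μ * ‖z • φ p‖ ^ 2 := by positivity
    rw [h5, h6, hψ1] at h3
    rw [mul_assoc, Complex.re_ofReal_mul]
    set B := (inner ℂ ψ (φ p) * inner ℂ (Γ (φ p)) (Γ ψ)).re
    have h9 : 0 ≤ ε * (ε + 2 * (B - μ * ‖z‖ ^ 2) + ε * ‖Γ (φ p)‖ ^ 2) := by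
      have : ε ^ 2 * (‖Γ (z • φ p)‖ ^ 2 - μ * ‖z • φ p‖ ^ 2) ≤ ε ^ 2 * ‖Γ (φ p)‖ ^ 2 :=
        mul_le_mul_of_nonneg_left (by linarith) (by positivity)
      nlinarith
    have h10 := nonneg_of_mul_nonneg_right h9 hε
    have h11 : 0 ≤ ε * ‖Γ (φ p)‖ ^ 2 := by positivity
    have h12 : μ * ‖z‖ ^ 2 - ε * (1 + ‖Γ (φ p)‖ ^ 2) ≤ B := by linarith
    calc _ = r p * (μ * ‖z‖ ^ 2 - ε * (1 + ‖Γ (φ p)‖ ^ 2)) := by ring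
      _ ≤ _ := mul_le_mul_of_nonneg_left h12 hp.le

/-- Let `μ` be the infimum of the form on unit vectors orthogonal to the top eigenspace. If `μ <
‖Γx‖²`, moving the larger weight `R` from `x` towards a near-minimizer, whose expected weight is at
most `R₂`, would lower the energy: the second variation gives `(‖Γx‖² - μ)(R - R₂) ≤ ε(R + C)`,
absurd as `ε → 0`. -/
lemma form_le_of_orthogonal (h : ReflectionMinimal A r φ D Γ Y) (hA : A.IsSymmetric) {R R₂ : ℝ}
    (hR : 0 < R) (hR₂ : R₂ < R) (hR₂0 : 0 ≤ R₂) (hgap : ∀ p, r p = R ∨ r p ≤ R₂) {x : H}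
    (hx : x ∈ eigenspan r φ R) (hx1 : ‖x‖ = 1) {ψ : H} (hψ : ψ ∈ D)
    (hort : ψ ∈ (eigenspan r φ R)ᗮ) : ‖Γ x‖ ^ 2 * ‖ψ‖ ^ 2 ≤ ‖Γ ψ‖ ^ 2 := by
  let S : Set ℝ := {e | ∃ f ∈ D, f ∈ (eigenspan r φ R)ᗮ ∧ ‖f‖ = 1 ∧ ‖Γ f‖ ^ 2 = e}
  have hS : BddBelow S := ⟨0, by rintro _ ⟨f, -, -, -, rfl⟩; positivity⟩
  have hmem : ∀ f ∈ D, f ∈ (eigenspan r φ R)ᗮ → f ≠ 0 → ‖Γ f‖ ^ 2 / ‖f‖ ^ 2 ∈ S := by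
    intro f hf hfo hf0
    refine ⟨((‖f‖⁻¹ : ℝ) : ℂ) • f, D.smul_mem _ hf, Submodule.smul_mem _ _ hfo, ?_, ?_⟩
    · rw [norm_smul]; simp [hf0]
    · rw [map_smul, norm_smul]; simp [mul_pow]; ring
  rcases eq_or_ne ψ 0 with rfl | hψ0
  · simp
  have hne : S.Nonempty := ⟨_, hmem ψ hψ hort hψ0⟩
  have hbd : ∀ f ∈ D, f ∈ (eigenspan r φ R)ᗮ → sInf S * ‖f‖ ^ 2 ≤ ‖Γ f‖ ^ 2 := by
    intro f hf hfo
    rcases eq_or_ne f 0 with rfl | hf0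
    · simp
    · have := csInf_le hS (hmem f hf hfo hf0)
      rwa [le_div_iff₀ (by positivity)] at this
  have hμ : 0 ≤ sInf S := le_csInf hne (by rintro _ ⟨f, -, -, -, rfl⟩; positivity)
  refine le_trans (mul_le_mul_of_nonneg_right ?_ (by positivity)) (hbd ψ hψ hort)
  set μ := sInf S
  set C := ∑' p, r p * (1 + ‖Γ (φ p)‖ ^ 2)
  have hC : 0 ≤ C := tsum_nonneg fun p => mul_nonneg (h.diag.1 p) (by positivity)
  have key : ∀ ε : ℝ, 0 < ε → ε ≤ 1 → (‖Γ x‖ ^ 2 - μ) * (R - R₂) ≤ ε * (R + C) ∨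
      ‖Γ x‖ ^ 2 ≤ μ := by
    intro ε hε hε1
    by_contra! hcon
    obtain ⟨hcon, hμx⟩ := hcon
    obtain ⟨_, ⟨f, hf, hfo, hf1, rfl⟩, hlt⟩ :=
      exists_lt_of_csInf_lt hne (lt_add_of_pos_right μ (by positivity : 0 < ε ^ 2))
    have h1 := h.le_inner_of_lower_bound hμ hε hbd hf hfo hf1 hlt.le
    have hs := h.eigenspan_spec hR hx
    have h2 := (h.variations hA hs.1 hx1 hs.2.1 hs.2.2 hf
      ((Submodule.mem_orthogonal _ _).1 hfo x hx)).2
    have h3 : (inner ℂ f (A f)).re ≤ R₂ := by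
      have hB := h.diag.2.1.inner_products_summable f
      have hB2 := h.diag.2.1.tsum_inner_products_le f
      rw [hf1] at hB2
      have h4 := hasSum_le (fun p => ?_) (h.diag.hasSum_re_inner f) (hB.hasSum.mul_left R₂)
      · exact h4.trans (by simpa using mul_le_mul_of_nonneg_left hB2 hR₂0)
      · rcases hgap p with hp | hp
        · rw [mem_orthogonal_eigenspan.1 hfo p hp]; simp
        · exact mul_le_mul_of_nonneg_right hp (by positivity)
    rw [hf1] at h2
    have h5 : (‖Γ x‖ ^ 2 - μ) * (R - R₂) ≤ (‖Γ x‖ ^ 2 - μ) * (R - (inner ℂ f (A f)).re) :=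
      mul_le_mul_of_nonneg_left (by linarith) (by linarith)
    have h6 : R * ‖Γ f‖ ^ 2 ≤ R * (μ + ε ^ 2) := mul_le_mul_of_nonneg_left hlt.le hR.le
    have h7 : ε ^ 2 ≤ ε := by nlinarith
    have h8 : R * ε ^ 2 ≤ R * ε := mul_le_mul_of_nonneg_left h7 hR.le
    nlinarith
  by_contra! hcon
  have hpos : 0 < (‖Γ x‖ ^ 2 - μ) * (R - R₂) := mul_pos (by linarith) (by linarith)
  have hRC : 0 < R + C := by linarith
  -- This `ε` makes `ε (R + C)` at most half of `(‖Γ x‖² - μ)(R - R₂)`.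
  rcases key (min 1 ((‖Γ x‖ ^ 2 - μ) * (R - R₂) / (2 * (R + C)))) (by positivity)
    (min_le_left _ _) with h1 | h1
  · have h2 := mul_le_mul_of_nonneg_right
      (min_le_right 1 ((‖Γ x‖ ^ 2 - μ) * (R - R₂) / (2 * (R + C)))) hRC.le
    have h3 : (‖Γ x‖ ^ 2 - μ) * (R - R₂) / (2 * (R + C)) * (R + C) =
      (‖Γ x‖ ^ 2 - μ) * (R - R₂) / 2 := by field_simp
    linarith
  · linarith

/-- A state that is the unique minimizer of the energy among its conjugates by reflections forces
the bottom of the spectrum to be an eigenvalue of finite multiplicity. -/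
theorem exists_ground_state (h : ReflectionMinimal A r φ D Γ Y) (hA : A.IsSymmetric)
    (hr : ∃ p, 0 < r p) : ∃ E : ℝ, (∃ v ∈ formEigenspace D Γ E, v ≠ 0) ∧
      (∀ f ∈ D, E * ‖f‖ ^ 2 ≤ ‖Γ f‖ ^ 2) ∧ FiniteDimensional ℂ (formEigenspace D Γ E) := by
  obtain ⟨p₀, hp₀⟩ := hr
  obtain ⟨R, R₂, hR, hR₂, hR₂0, ⟨p₁, hp₁⟩, hfin, hgap⟩ := exists_max_gap h.summable hp₀
  set W := eigenspan r φ R with hW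
  have : FiniteDimensional ℂ W := FiniteDimensional.span_of_finite ℂ (hfin.image φ)
  have hcont : Continuous fun w : W => ‖Γ w‖ ^ 2 := by
    have : Continuous (Γ ∘ₗ W.subtype) := LinearMap.continuous_of_finiteDimensional _
    exact (this.norm).pow 2
  have : ProperSpace W := FiniteDimensional.proper ℂ W
  obtain ⟨x, hx1, hmin⟩ := (isCompact_sphere (0 : W) 1).exists_isMinOn
    ⟨⟨φ p₁, Submodule.subset_span ⟨p₁, hp₁, rfl⟩⟩, by simpa using h.diag.2.1.1 p₁⟩
    hcont.continuousOn
  have hx1' : ‖(x : H)‖ = 1 := by simpa using hx1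
  set E := ‖Γ x‖ ^ 2
  have hmin' : ∀ w ∈ W, E * ‖w‖ ^ 2 ≤ ‖Γ w‖ ^ 2 := by
    intro w hw
    rcases eq_or_ne w 0 with rfl | hw0
    · simp
    have h1 : E ≤ ‖Γ (((‖w‖⁻¹ : ℝ) : ℂ) • w)‖ ^ 2 :=
      hmin (show (⟨((‖w‖⁻¹ : ℝ) : ℂ) • w, W.smul_mem _ hw⟩ : W) ∈ Metric.sphere 0 1 by
        rw [mem_sphere_zero_iff_norm, Submodule.coe_norm, norm_smul]; simp [hw0])
    rw [map_smul, norm_smul, mul_pow] at h1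
    simp only [Complex.norm_real, norm_inv, norm_norm] at h1
    rw [inv_pow, ← div_eq_inv_mul, le_div_iff₀ (by positivity)] at h1
    exact h1
  -- Splitting `f` along `W` and its complement creates no cross term, either in `H` or in the form,
  -- so the bounds on the two pieces add up.
  have hlow : ∀ f ∈ D, E * ‖f‖ ^ 2 ≤ ‖Γ f‖ ^ 2 := by
    intro f hf
    set w := W.starProjection f
    have hw : w ∈ W := W.starProjection_apply_mem f
    have hg : f - w ∈ Wᗮ := W.sub_starProjection_mem_orthogonal f
    have hgD : f - w ∈ D := D.sub_mem hf (h.eigenspan_spec hR hw).1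
    have h1 := h.form_le_of_orthogonal hA hR hR₂ hR₂0 hgap x.2 hx1' hgD hg
    have h2 := hmin' w hw
    have h3 : ‖f‖ ^ 2 = ‖w‖ ^ 2 + ‖f - w‖ ^ 2 := by
      have h4 := @norm_add_sq ℂ _ _ _ _ w (f - w)
      rw [(Submodule.mem_orthogonal _ _).1 hg w hw] at h4
      simpa using h4
    have h4 : ‖Γ f‖ ^ 2 = ‖Γ w‖ ^ 2 + ‖Γ (f - w)‖ ^ 2 := by
      have h5 := @norm_add_sq ℂ _ _ _ _ (Γ w) (Γ (f - w))
      rw [inner_eq_zero_symm.1 (h.inner_orthogonal_eq_zero hA hR hw hgD hg)] at h5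
      simpa using h5
    rw [h3, h4]
    linarith
  have hxG : (x : H) ∈ formEigenspace D Γ E :=
    mem_formEigenspace_of_norm_sq_eq hlow (h.eigenspan_spec hR x.2).1 (by rw [hx1']; simp [E])
  have hx0 : (x : H) ≠ 0 := fun h0 => by simp [h0] at hx1'
  have heig : ∀ v ∈ formEigenspace D Γ E, ∃ t : ℂ, A v = t • v := by
    intro v hv
    refine h.eigen v hv.1 ?_
    have h1 := h.hasSum_inner v (Γ v)
    have h2 := (h.diag.hasSum_inner v v).mul_left (E : ℂ)
    have h3 : inner ℂ (Y v) (Γ v) = E * inner ℂ v (A v) := by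
      refine h1.unique (h2.congr_fun fun p => ?_)
      rcases (h.diag.1 p).eq_or_lt with hp | hp
      · simp [← hp]
      · rw [hv.2 _ (h.mem p hp)]; ring
    rw [h3, Complex.re_ofReal_mul, norm_sq_of_mem_formEigenspace hv]
    ring
  refine ⟨E, ⟨x, hxG, hx0⟩, hlow, ?_⟩
  refine Submodule.finiteDimensional_of_le (S₂ := W) fun v hv => ?_
  obtain ⟨t, ht⟩ := heig v hv
  -- Both `v` and `v + x` are eigenvectors of `A`, while `A x = R x`. Hence `v` has eigenvalue `R`
  -- or is a multiple of `x`; in both cases it lies in `W`.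
  obtain ⟨s, hs⟩ := heig _ (Submodule.add_mem _ hv hxG)
  rw [map_add, ht, (h.eigenspan_spec hR x.2).2.1, smul_add] at hs
  have h1 : (t - s) • v = (s - R) • (x : H) := by
    rw [sub_smul, sub_smul, sub_eq_sub_iff_add_eq_add, hs, add_comm]
  by_cases hts : t = s
  · rw [hts, sub_self, zero_smul] at h1
    have h2 : s = R := sub_eq_zero.1 ((smul_eq_zero.1 h1.symm).resolve_right hx0)
    exact h.mem_eigenspan hA hR hfin (by rw [ht, hts, h2])
  · have h2 : v = (t - s)⁻¹ • (s - R) • (x : H) := by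
      rw [← h1, smul_smul, inv_mul_cancel₀ (sub_ne_zero.2 hts), one_smul]
    rw [h2]
    exact W.smul_mem _ (W.smul_mem _ x.2)

end ReflectionMinimal

end GroundState

/-! ### Reflections and the energy of a reflected state -/

section Reflection

variable {H K : Type*} [NormedAddCommGroup H] [InnerProductSpace ℂ H]
  [NormedAddCommGroup K] [InnerProductSpace ℂ K]

/-- The operator `Γ A`, for a state `A = ∑_p r_p |φ_p⟩⟨φ_p|` with finite energy. -/
lemma exists_hasSum_form [CompleteSpace K] {r : ℕ → ℝ} {φ : ℕ → H} (hr : ∀ p, 0 ≤ r p)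
    (hφ : ∀ p, ‖φ p‖ = 1) (hs : Summable r) {Γ : H →ₗ[ℂ] K}
    (hΓ : Summable fun p => r p * ‖Γ (φ p)‖ ^ 2) :
    ∃ Y : H →ₗ[ℂ] K, ∀ f, HasSum (fun p => ((r p : ℂ) * inner ℂ (φ p) f) • Γ (φ p)) (Y f) := by
  have hsum : ∀ f, Summable fun p => ((r p : ℂ) * inner ℂ (φ p) f) • Γ (φ p) := fun f => by
    refine Summable.of_norm_bounded ((hs.add hΓ).mul_left ‖f‖) fun p => ?_
    rw [norm_smul, norm_mul, Complex.norm_real, Real.norm_of_nonneg (hr p)]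
    have h1 : ‖inner ℂ (φ p) f‖ ≤ ‖f‖ := by simpa [hφ p] using norm_inner_le_norm (𝕜 := ℂ) (φ p) f
    have h2 : ‖Γ (φ p)‖ ≤ 1 + ‖Γ (φ p)‖ ^ 2 := by nlinarith [sq_nonneg (‖Γ (φ p)‖ - 1)]
    calc _ ≤ r p * ‖f‖ * (1 + ‖Γ (φ p)‖ ^ 2) := by gcongr; exacts [mul_nonneg (hr p) (norm_nonneg f), hr p]
      _ = _ := by ring
  refine ⟨⟨⟨fun f => ∑' p, ((r p : ℂ) * inner ℂ (φ p) f) • Γ (φ p), fun f g => ?_⟩,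
    fun c f => ?_⟩, fun f => (hsum f).hasSum⟩
  · rw [← (hsum f).tsum_add (hsum g)]
    exact tsum_congr fun p => by rw [inner_add_right, mul_add, add_smul]
  · change _ = c • _
    rw [← (hsum f).tsum_const_smul]
    exact tsum_congr fun p => by rw [inner_smul_right, smul_smul]; ring_nf

/-- The reflection `1 - 2 |v⟩⟨v| / ‖v‖²`. -/
noncomputable def reflectionOp (v : H) : H →L[ℂ] H :=
  ContinuousLinearMap.id ℂ H - ((2 / ‖v‖ ^ 2 : ℝ) : ℂ) • (innerSL ℂ v).smulRight v

lemma reflectionOp_apply (v f : H) :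
    reflectionOp v f = f - (((2 / ‖v‖ ^ 2 : ℝ) : ℂ) * inner ℂ v f) • v := by
  simp [reflectionOp, smul_smul]

lemma reflectionOp_reflectionOp {v : H} (hv : v ≠ 0) (f : H) :
    reflectionOp v (reflectionOp v f) = f := by
  have h : (‖v‖ : ℂ) ≠ 0 := by simpa using hv
  simp only [reflectionOp_apply, inner_sub_right, inner_smul_right, inner_self_eq_norm_sq_to_K]
  rw [sub_sub, ← add_smul]
  convert sub_zero f
  convert zero_smul ℂ v
  push_cast
  simp only [Complex.coe_algebraMap]
  field_simp
  ring

lemma star_reflectionOp [CompleteSpace H] (v : H) : star (reflectionOp v) = reflectionOp v := by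
  symm
  rw [ContinuousLinearMap.star_eq_adjoint, ContinuousLinearMap.eq_adjoint_iff]
  intro x y
  rw [reflectionOp_apply, reflectionOp_apply, inner_sub_left, inner_sub_right, inner_smul_left,
    inner_smul_right, map_mul, Complex.conj_ofReal, inner_conj_symm]
  ring

lemma reflectionOp_mem_unitary [CompleteSpace H] {v : H} (hv : v ≠ 0) :
    reflectionOp v ∈ unitary (H →L[ℂ] H) := by
  rw [Unitary.mem_iff, star_reflectionOp, and_self]
  ext1 f
  exact reflectionOp_reflectionOp hv f

/-- Energy of a state conjugated by a reflection. -/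
lemma hasSum_form_reflectionOp {A : H →L[ℂ] H} {r : ℕ → ℝ} {φ : ℕ → H} (hA : Diagonalizes A r φ)
    {Γ Y : H →ₗ[ℂ] K} {e : ℝ} (he : HasSum (fun p => r p * ‖Γ (φ p)‖ ^ 2) e)
    (hY : ∀ f, HasSum (fun p => ((r p : ℂ) * inner ℂ (φ p) f) • Γ (φ p)) (Y f)) (v : H) :
    HasSum (fun p => r p * ‖Γ (reflectionOp v (φ p))‖ ^ 2)
      (e - 2 * (2 / ‖v‖ ^ 2) * (inner ℂ (Y v) (Γ v)).re +
        (2 / ‖v‖ ^ 2) ^ 2 * ‖Γ v‖ ^ 2 * (inner ℂ v (A v)).re) := by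
  have h2 : HasSum (fun p => ((r p : ℂ) * inner ℂ v (φ p) * inner ℂ (Γ (φ p)) (Γ v)).re)
      (inner ℂ (Y v) (Γ v)).re := (hasSum_inner_left (hY v) (Γ v)).mapL Complex.reCLM
  refine ((he.sub (h2.mul_left (2 * (2 / ‖v‖ ^ 2)))).add
    ((hA.hasSum_re_inner v).mul_left ((2 / ‖v‖ ^ 2) ^ 2 * ‖Γ v‖ ^ 2))).congr_fun fun p => ?_
  rw [reflectionOp_apply, map_sub, map_smul, @norm_sub_sq ℂ, inner_smul_right, norm_smul, norm_mul,
    Complex.norm_real, Real.norm_of_nonneg (by positivity : (0 : ℝ) ≤ 2 / ‖v‖ ^ 2), mul_assoc,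
    mul_assoc (r p : ℂ), Complex.re_ofReal_mul, norm_inner_symm v]
  simp only [RCLike.re_to_complex, Complex.re_ofReal_mul]
  ring

end Reflection

/-! ### The ground state obtained from a free energy minimizer -/

section Ground

variable {d : ℕ} {V : Space d → ℝ} {β : ℝ → ℝ} {a T : ℝ} {ϱ : Op d}

lemma coe_ennreal_eq_coe_toReal {x : ℝ≥0∞} (hx : x < ⊤) : (x : EReal) = ((x.toReal : ℝ) : EReal) := by
  lift x to NNReal using hx.ne
  rfl

/-- Finiteness of the common entropy is what permits its cancellation in `EReal`. -/
lemma freeEnergy_le_iff_energy_le {σ : Op d} (hϱ : energy V ϱ < ⊤) (hσ : energy V σ < ⊤)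
    (hS : entropy β σ = entropy β ϱ) (hbot : entropy β ϱ ≠ ⊥) (htop : entropy β ϱ ≠ ⊤) :
    freeEnergy V β T ϱ ≤ freeEnergy V β T σ ↔ (energy V ϱ).toReal ≤ (energy V σ).toReal := by
  rw [freeEnergy, freeEnergy, hS, coe_ennreal_eq_coe_toReal hϱ, coe_ennreal_eq_coe_toReal hσ]
  lift entropy β ϱ to ℝ using ⟨htop, hbot⟩ with s
  rw [← EReal.coe_mul, ← EReal.coe_add, ← EReal.coe_add, EReal.coe_le_coe_iff, add_le_add_iff_right]

lemma conj_mem_statesFinite (h : ϱ ∈ statesFinite V a) {r : ℕ → ℝ} {φ : ℕ → L2 d}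
    (hrφ : Diagonalizes ϱ r φ) {u : Op d} (hu : u ∈ unitary (Op d))
    (hE : energy V (u * ϱ * star u) < ⊤) : u * ϱ * star u ∈ statesFinite V a := by
  have htr : posTrace (u * ϱ * star u) = ENNReal.ofReal a :=
    (posTrace_conj h.1.1.1.1 hu).trans h.1.2
  exact ⟨⟨⟨⟨(hrφ.conj hu).isPositive, htr.trans_lt ENNReal.ofReal_lt_top⟩,
    (formTrace_kineticForm_le V _).trans_lt hE⟩, htr⟩, hE⟩

/-- A minimizer of the free energy has minimal energy in its unitary orbit. -/
lemma energy_le_conj (ha : 0 ≤ a) (hd : 1 ≤ d) (hβ : ContinuousOn β (Icc 0 a))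
    (hϱ : IsUniqueMinimizer (freeEnergy V β T) (statesFinite V a) ϱ) (hbot : entropy β ϱ ≠ ⊥)
    (htop : entropy β ϱ ≠ ⊤) {u : Op d} (hu : u ∈ unitary (Op d))
    (hE : energy V (u * ϱ * star u) < ⊤) :
    (energy V ϱ).toReal ≤ (energy V (u * ϱ * star u)).toReal ∧
      ((energy V (u * ϱ * star u)).toReal = (energy V ϱ).toReal → u * ϱ * star u = ϱ) := by
  have hmem := conj_mem_statesFinite hϱ.1.1 (diagonalizes_eig hd hϱ.1.1.1.1.1) hu hE
  have hS : entropy β (u * ϱ * star u) = entropy β ϱ :=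
    entropy_conj hϱ.1.1.1.1.1.1.isSelfAdjoint
      (hβ.mono (spectrum_subset_Icc hϱ.1.1.1.1.1.1 ha hϱ.1.1.1.2)) hu
  refine ⟨(freeEnergy_le_iff_energy_le hϱ.1.1.2 hE hS hbot htop).1 (hϱ.1.2 hmem), fun h => ?_⟩
  -- With equal energy the conjugate state also minimizes `F_T`, so uniqueness identifies it with
  -- `ϱ`.
  refine hϱ.2 _ hmem fun τ hτ => ?_
  have hτ' : freeEnergy V β T ϱ ≤ freeEnergy V β T τ := hϱ.1.2 hτ
  refine le_trans ?_ hτ'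
  rw [← hS] at hbot htop
  exact (freeEnergy_le_iff_energy_le hE hϱ.1.1.2 hS.symm hbot htop).2 h.le

lemma hasSum_energy (hd : 1 ≤ d) (hV : ∀ x, 0 ≤ V x)
    (hVm : AEStronglyMeasurable V volume) (h : IsDensityOperator ϱ) (hE : energy V ϱ < ⊤)
    {r : ℕ → ℝ} {φ : ℕ → L2 d} (hrφ : Diagonalizes ϱ r φ)
    {K : Type*} [NormedAddCommGroup K] [InnerProductSpace ℂ K] {D : Submodule ℂ (L2 d)}
    {Γ : L2 d →ₗ[ℂ] K} (hΓ : IsFormOf (energyForm V) D Γ) :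
    (∀ p, 0 < r p → φ p ∈ D) ∧
      HasSum (fun p => r p * ‖Γ (φ p)‖ ^ 2) (energy V ϱ).toReal := by
  rw [energy, formTrace_eq hd h hrφ hV hVm] at hE ⊢
  have hmem : ∀ p, 0 < r p → φ p ∈ D := fun p hp =>
    (hΓ.lt_top_iff _).1 (mul_lt_top_of_tsum hE hp)
  refine ⟨hmem, ?_⟩
  have h1 := ENNReal.hasSum_toReal hE.ne
  rw [ENNReal.tsum_toReal_eq fun p => (lt_of_le_of_lt (ENNReal.le_tsum p) hE).ne]
  refine h1.congr_fun fun p => ?_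
  rcases (hrφ.1 p).eq_or_lt with hp | hp
  · simp [← hp]
  · rw [hΓ.eq_enorm _ (hmem p hp), ENNReal.toReal_mul, ENNReal.toReal_ofReal hp.le,
      ENNReal.toReal_pow, toReal_enorm]

lemma energy_eq_ofReal_of_hasSum (hd : 1 ≤ d) (hV : ∀ x, 0 ≤ V x)
    (hVm : AEStronglyMeasurable V volume) (h : IsDensityOperator ϱ)
    {r : ℕ → ℝ} {φ : ℕ → L2 d} (hrφ : Diagonalizes ϱ r φ)
    {K : Type*} [NormedAddCommGroup K] [InnerProductSpace ℂ K] {D : Submodule ℂ (L2 d)}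
    {Γ : L2 d →ₗ[ℂ] K} (hΓ : IsFormOf (energyForm V) D Γ) (hD : ∀ p, 0 < r p → φ p ∈ D) {e : ℝ}
    (he : HasSum (fun p => r p * ‖Γ (φ p)‖ ^ 2) e) : energy V ϱ = ENNReal.ofReal e := by
  rw [energy, formTrace_eq hd h hrφ hV hVm, ← he.tsum_eq, ENNReal.ofReal_tsum_of_nonneg
    (fun p => mul_nonneg (hrφ.1 p) (by positivity)) he.summable]
  refine tsum_congr fun p => ?_
  rcases (hrφ.1 p).eq_or_lt with hp | hp
  · simp [← hp]
  · rw [hΓ.eq_enorm _ (hD p hp), ENNReal.ofReal_mul hp.le, enorm_sq_eq_ofReal]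

lemma exists_eigval_pos (hd : 1 ≤ d) (ha : 0 < a) (h : IsDensityOperator ϱ)
    (htr : posTrace ϱ = ENNReal.ofReal a) : ∃ p, 0 < eigval ϱ p := by
  by_contra! hcon
  have h1 : eigval ϱ = 0 := funext fun p => le_antisymm (hcon p) ((diagonalizes_eig hd h).1 p)
  have h2 := hasSum_eigval hd h
  rw [h1, htr, ENNReal.toReal_ofReal ha.le] at h2
  exact ha.ne (hasSum_zero.unique h2)

/-- A unique minimizer of the free energy at some temperature satisfies the variational
inequalities that force the existence of a ground state. -/
lemma exists_reflectionMinimal (hd : 1 ≤ d) (hV : ∀ x, 0 ≤ V x)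
    (hVm : AEStronglyMeasurable V volume) (ha : 0 < a) (hβ : ContinuousOn β (Icc 0 a))
    (hϱ : IsUniqueMinimizer (freeEnergy V β T) (statesFinite V a) ϱ) (hbot : entropy β ϱ ≠ ⊥)
    (htop : entropy β ϱ ≠ ⊤) {K : Type*} [NormedAddCommGroup K] [InnerProductSpace ℂ K]
    [CompleteSpace K] {D : Submodule ℂ (L2 d)} {Γ : L2 d →ₗ[ℂ] K}
    (hΓ : IsFormOf (energyForm V) D Γ) :
    ∃ Y, ReflectionMinimal ϱ (eigval ϱ) (eigvec ϱ) D Γ Y := by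
  have hdens := hϱ.1.1.1.1.1
  have hD := diagonalizes_eig hd hdens
  obtain ⟨hmem, hsum⟩ := hasSum_energy hd hV hVm hdens hϱ.1.1.2 hD hΓ
  have hs := (hasSum_eigval hd hdens).summable
  obtain ⟨Y, hY⟩ := exists_hasSum_form hD.1 hD.2.1.1 hs hsum.summable
  have key : ∀ v ∈ D, v ≠ 0 →
      (inner ℂ (Y v) (Γ v)).re * ‖v‖ ^ 2 ≤ ‖Γ v‖ ^ 2 * (inner ℂ v (ϱ v)).re ∧
      ((inner ℂ (Y v) (Γ v)).re * ‖v‖ ^ 2 = ‖Γ v‖ ^ 2 * (inner ℂ v (ϱ v)).re →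
        ∃ t : ℂ, ϱ v = t • v) := by
    intro v hv hv0
    have hu := reflectionOp_mem_unitary hv0
    have hc := hD.conj hu
    have hdens' : IsDensityOperator (reflectionOp v * ϱ * star (reflectionOp v)) :=
      ⟨hc.isPositive, (posTrace_conj hdens.1 hu).trans_lt hdens.2⟩
    have hr := hasSum_form_reflectionOp hD hsum hY v
    have hE := energy_eq_ofReal_of_hasSum hd hV hVm hdens' hc hΓ (fun p hp => by
      rw [reflectionOp_apply]
      exact D.sub_mem (hmem p hp) (D.smul_mem _ hv)) hr
    have hE0 := hr.nonneg fun p => mul_nonneg (hD.1 p) (by positivity)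
    have hmin := energy_le_conj ha.le hd hβ hϱ hbot htop hu (hE ▸ ENNReal.ofReal_lt_top)
    rw [hE, ENNReal.toReal_ofReal hE0] at hmin
    have hn : 0 < ‖v‖ ^ 2 := by positivity
    -- The energy change under the reflection is a positive multiple of the defect in the desired
    -- inequality.
    have hid : (2 / ‖v‖ ^ 2) ^ 2 * ‖Γ v‖ ^ 2 * (inner ℂ v (ϱ v)).re -
        2 * (2 / ‖v‖ ^ 2) * (inner ℂ (Y v) (Γ v)).re = (2 / ‖v‖ ^ 2) ^ 2 *
        (‖Γ v‖ ^ 2 * (inner ℂ v (ϱ v)).re - (inner ℂ (Y v) (Γ v)).re * ‖v‖ ^ 2) := by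
      field_simp
    refine ⟨?_, fun heq => ?_⟩
    · have h1 : 0 ≤ (2 / ‖v‖ ^ 2) ^ 2 *
          (‖Γ v‖ ^ 2 * (inner ℂ v (ϱ v)).re - (inner ℂ (Y v) (Γ v)).re * ‖v‖ ^ 2) := by
        rw [← hid]; linarith [hmin.1]
      have h2 := nonneg_of_mul_nonneg_right h1 (by positivity)
      linarith
    · rw [heq, sub_self, mul_zero] at hid
      -- In the equality case the reflection commutes with `ϱ`. As it maps `v` to `-v`, it maps `ϱ
      -- v` to `-ϱ v`, so `ϱ v` is a multiple of `v`.
      have h1 := hmin.2 (by linarith)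
      rw [star_reflectionOp] at h1
      have h2 := congrArg (reflectionOp v) (DFunLike.congr_fun h1 v)
      simp only [mul_apply_eq_comp, reflectionOp_reflectionOp hv0] at h2
      have h3 : reflectionOp v v = -v := by
        have : (‖v‖ : ℂ) ≠ 0 := by simpa using hv0
        rw [reflectionOp_apply, inner_self_eq_norm_sq_to_K]
        have h4 : ((2 / ‖v‖ ^ 2 : ℝ) : ℂ) * ((‖v‖ : ℝ) : ℂ) ^ 2 = 2 := by
          push_cast; field_simp
        change v - (((2 / ‖v‖ ^ 2 : ℝ) : ℂ) * ((‖v‖ : ℝ) : ℂ) ^ 2) • v = _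
        rw [h4, two_smul]; abel
      rw [h3, reflectionOp_apply, map_neg] at h2
      refine ⟨((2 / ‖v‖ ^ 2 : ℝ) : ℂ) * inner ℂ v (ϱ v) / 2, ?_⟩
      have h5 : (2 : ℂ) • ϱ v = (((2 / ‖v‖ ^ 2 : ℝ) : ℂ) * inner ℂ v (ϱ v)) • v := by
        rw [two_smul]
        nth_rewrite 1 [← neg_neg (ϱ v)]
        rw [h2]
        abel
      rw [div_eq_inv_mul, mul_smul, ← h5, smul_smul, inv_mul_cancel₀ two_ne_zero, one_smul]
  refine ⟨Y, hD, hs, hmem, hsum.summable, hY, fun v hv => ?_, fun v hv h => ?_⟩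
  · rcases eq_or_ne v 0 with rfl | hv0
    · simp
    · exact (key v hv hv0).1
  · rcases eq_or_ne v 0 with rfl | hv0
    · exact ⟨0, by simp⟩
    · exact (key v hv hv0).2 h

variable {Tc : ℝ} {ρ : ℝ → Op d}

/-- Strict monotonicity places the entropy at `T` strictly between those at a higher and a lower
temperature. -/
lemma MonotoneInTemperature.entropy_ne (hA : MonotoneInTemperature V β a Tc ρ) (hT : Tc < T) :
    entropy β (ρ T) ≠ ⊥ ∧ entropy β (ρ T) ≠ ⊤ := by
  have h1 := hA.entropy_strictAnti hT (hT.trans (lt_add_one T)) (lt_add_one T)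
  obtain ⟨t, ht, htT⟩ := exists_between hT
  have h2 := hA.entropy_strictAnti ht hT htT
  exact ⟨(bot_le.trans_lt h1).ne', (h2.trans_le le_top).ne⟩

/-- The bottom of the spectrum of `H` is an eigenvalue of finite multiplicity, equal to
`groundEnergy V`. -/
theorem MonotoneInTemperature.ground_state (hA : MonotoneInTemperature V β a Tc ρ) (hd : 1 ≤ d)
    (hV : ∀ x, 0 ≤ V x) (hVm : AEStronglyMeasurable V volume) (ha : 0 < a)
    (hβ : ContinuousOn β (Icc 0 a)) {K : Type*} [NormedAddCommGroup K] [InnerProductSpace ℂ K]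
    [CompleteSpace K] {Γ : L2 d →ₗ[ℂ] K} (hΓ : IsFormOf (energyForm V) (formDomain hV hVm) Γ)
    (hin : ∀ φ ∈ formDomain hV hVm, ∀ ψ ∈ formDomain hV hVm, inner ℂ (Γ ψ) (Γ φ) =
      ∑ j, inner ℂ (grad ψ j) (grad φ j) + ∫ x, (V x : ℂ) * (starRingEnd ℂ (ψ x) * φ x)) :
    (∃ v ∈ formEigenspace (formDomain hV hVm) Γ (groundEnergy V), v ≠ 0) ∧
      (∀ f ∈ formDomain hV hVm, groundEnergy V * ‖f‖ ^ 2 ≤ ‖Γ f‖ ^ 2) ∧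
      FiniteDimensional ℂ (formEigenspace (formDomain hV hVm) Γ (groundEnergy V)) := by
  have hT := lt_add_one Tc
  have hmin := hA.minimizer _ hT
  obtain ⟨Y, hY⟩ := exists_reflectionMinimal hd hV hVm ha hβ hmin (hA.entropy_ne hT).1
    (hA.entropy_ne hT).2 hΓ
  obtain ⟨E, ⟨v, hv, hv0⟩, hlow, hfin⟩ := hY.exists_ground_state
    hmin.1.1.1.1.1.1.isSymmetric (exists_eigval_pos hd ha hmin.1.1.1.1.1 hmin.1.1.1.2)
  -- The lower bound applied to an eigenvector gives `E ≤ lam`, so the infimum defining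
  -- `groundEnergy` is a genuine minimum.
  have hE : IsLeast {lam : ℝ | IsEigenvalue V lam} E := by
    refine ⟨⟨v, hv0, (hΓ.lt_top_iff v).2 hv.1, fun ψ hψ => ?_⟩, ?_⟩
    · rw [← hin v hv.1 ψ ((hΓ.lt_top_iff ψ).1 hψ), hv.2 ψ ((hΓ.lt_top_iff ψ).1 hψ)]
    · rintro lam ⟨w, hw0, hw, hlam⟩
      have hwD := (hΓ.lt_top_iff w).1 hw
      have h1 : w ∈ formEigenspace (formDomain hV hVm) Γ lam := ⟨hwD, fun f hf => by
        rw [hin w hwD f hf, hlam f ((hΓ.lt_top_iff f).2 hf)]⟩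
      have h2 := hlow w hwD
      rw [norm_sq_of_mem_formEigenspace h1] at h2
      exact le_of_mul_le_mul_right h2 (by positivity)
  have hE' : groundEnergy V = E := hE.csInf_eq
  rw [hE']
  exact ⟨⟨v, hv, hv0⟩, hlow, hfin⟩

end Ground

/-! ### Finite rank states and the equidistributed state -/

section FiniteRank

variable {H : Type*} [NormedAddCommGroup H] [InnerProductSpace ℂ H]

/-- A symmetric operator with range in `G` restricts to `G` and vanishes on its orthogonal
complement, so the finite-dimensional spectral theorem describes it entirely. -/
lemma exists_eigenbasis_of_mapsTo {A : H →L[ℂ] H} (hA : A.IsSymmetric) (G : Submodule ℂ H)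
    [FiniteDimensional ℂ G] (hG : ∀ x, A x ∈ G) :
    ∃ (b : Fin (Module.finrank ℂ G) → H) (t : Fin (Module.finrank ℂ G) → ℝ), Orthonormal ℂ b ∧ (∀ i, b i ∈ G) ∧
      (∀ i, A (b i) = (t i : ℂ) • b i) ∧
      (∀ x ∈ G, (∀ i, inner ℂ (b i) x = 0) → x = 0) ∧
      ∀ x, (∀ i, inner ℂ (b i) x = 0) → A x = 0 := by
  have hsym : ((A : H →ₗ[ℂ] H).restrict fun v _ => hG v : G →ₗ[ℂ] G).IsSymmetric :=
    LinearMap.IsSymmetric.restrict_invariant hA fun v _ => hG v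
  let e := hsym.eigenvectorBasis rfl
  have he : ∀ i, A (e i) = (hsym.eigenvalues rfl i : ℂ) • (e i : H) := fun i =>
    congrArg Subtype.val (hsym.apply_eigenvectorBasis rfl i)
  have hzero : ∀ x ∈ G, (∀ i, inner ℂ (e i : H) x = 0) → x = 0 := fun x hx h => by
    have h1 : (⟨x, hx⟩ : G) = 0 := by
      rw [← e.sum_repr' ⟨x, hx⟩]
      refine Finset.sum_eq_zero fun i _ => ?_
      rw [Submodule.coe_inner, h i, zero_smul]
    exact congrArg Subtype.val h1
  refine ⟨fun i => e i, hsym.eigenvalues rfl, e.orthonormal.comp_linearIsometry G.subtypeₗᵢ,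
    fun i => (e i).2, he, hzero, fun x hx => hzero _ (hG x) fun i => ?_⟩
  have := hA (e i) x
  simp only [ContinuousLinearMap.coe_coe] at this
  rw [← this, he, inner_smul_left, hx i, mul_zero]

/-- The equidistributed state of trace `a` on a finite-dimensional space. -/
noncomputable def equidistributed (a : ℝ) (G : Submodule ℂ H) [FiniteDimensional ℂ G] : H →L[ℂ] H :=
  ((a / Module.finrank ℂ G : ℝ) : ℂ) • G.starProjection

section Equidistributed

variable {a : ℝ} {G : Submodule ℂ H} [FiniteDimensional ℂ G]

lemma equidistributed_apply_mem (x : H) : equidistributed a G x ∈ G :=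
  G.smul_mem _ (G.starProjection_apply_mem x)

lemma equidistributed_apply {x : H} (hx : x ∈ G) :
    equidistributed a G x = ((a / Module.finrank ℂ G : ℝ) : ℂ) • x := by
  rw [equidistributed, smul_apply, Submodule.starProjection_eq_self_iff.2 hx]

lemma isPositive_equidistributed (ha : 0 ≤ a) : (equidistributed a G).IsPositive := by
  have h1 : G.starProjection.IsPositive := by
    have := (ContinuousLinearMap.isPositive_one (𝕜 := ℂ) (E := H)).conj_starProjection G
    convert this using 1
    ext1 x
    exact (Submodule.starProjection_eq_self_iff.2 (G.starProjection_apply_mem x)).symm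
  refine h1.smul_of_nonneg ?_
  exact_mod_cast (by positivity : 0 ≤ a / Module.finrank ℂ G)

end Equidistributed

variable [CompleteSpace H]

lemma posTrace_eq_sum {ι : Type*} [Fintype ι] {B : H →L[ℂ] H} (hB : B.IsPositive) {b : ι → H}
    (hb : Orthonormal ℂ b) {s : ι → ℝ} (hs : ∀ i, B (b i) = (s i : ℂ) • b i)
    (hker : ∀ x, (∀ i, inner ℂ (b i) x = 0) → B x = 0) :
    posTrace B = ∑ i, ENNReal.ofReal (s i) := by
  obtain ⟨w, e, hw, he⟩ := hb.toSubtypeRange.exists_hilbertBasis_extension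
  rw [posTrace_eq_tsum hB e]
  let g : ι → w := fun i => ⟨b i, hw ⟨i, rfl⟩⟩
  have hg : Function.Injective g := fun i j hij => by
    have : b i = b j := congrArg Subtype.val hij
    exact hb.linearIndependent.injective this
  rw [← hg.tsum_eq, tsum_fintype]
  · refine Finset.sum_congr rfl fun i _ => ?_
    have : e (g i) = b i := by rw [he]
    rw [this, hs, inner_smul_right, inner_self_eq_norm_sq_to_K, hb.1 i]
    simp
  · intro x hx
    by_contra hxg
    refine hx ?_
    have : B (e x) = 0 := hker _ fun i => by
      have h1 : b i = e (g i) := by rw [he]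
      rw [h1]
      exact e.orthonormal.2 fun h => hxg ⟨i, h⟩
    simp [this]

lemma posTrace_parts_eq_sum {ι : Type*} [Fintype ι] {B : H →L[ℂ] H} (hB : IsSelfAdjoint B)
    {b : ι → H} (hb : Orthonormal ℂ b) {s : ι → ℝ} (hs : ∀ i, B (b i) = (s i : ℂ) • b i)
    (hker : ∀ x, (∀ i, inner ℂ (b i) x = 0) → B x = 0) :
    posTrace B⁺ = ∑ i, ENNReal.ofReal (s i)⁺ ∧ posTrace B⁻ = ∑ i, ENNReal.ofReal (s i)⁻ := by
  have h0 : ∀ x, (∀ i, inner ℂ (b i) x = 0) → B x = ((0 : ℝ) : ℂ) • x := fun x hx => by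
    rw [hker x hx, Complex.ofReal_zero, zero_smul]
  have hp : Continuous fun x : ℝ => x⁺ := continuous_id.sup continuous_const
  have hn : Continuous fun x : ℝ => x⁻ := continuous_neg.sup continuous_const
  constructor
  · refine posTrace_eq_sum ((ContinuousLinearMap.nonneg_iff_isPositive _).1
      (CFC.posPart_nonneg B)) hb (fun i => ?_) fun x hx => ?_
    · rw [posPart_eq_cfc]
      exact cfc_apply_eigenvector hB hp.continuousOn (hs i)
    · have := cfc_apply_eigenvector hB hp.continuousOn (h0 x hx)
      rw [posPart_eq_cfc, this, posPart_zero, Complex.ofReal_zero, zero_smul]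
  · refine posTrace_eq_sum ((ContinuousLinearMap.nonneg_iff_isPositive _).1
      (CFC.negPart_nonneg B)) hb (fun i => ?_) fun x hx => ?_
    · rw [negPart_eq_cfc]
      exact cfc_apply_eigenvector hB hn.continuousOn (hs i)
    · have := cfc_apply_eigenvector hB hn.continuousOn (h0 x hx)
      rw [negPart_eq_cfc, this, negPart_zero, Complex.ofReal_zero, zero_smul]

/-- The entropy of a finite rank state. -/
lemma entropy_eq_sum {ι : Type*} [Fintype ι] {A : H →L[ℂ] H} (hA : IsSelfAdjoint A) {β : ℝ → ℝ}
    (hβ : ContinuousOn β (spectrum ℝ A)) (hβ0 : β 0 = 0) {b : ι → H} (hb : Orthonormal ℂ b)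
    {t : ι → ℝ} (ht : ∀ i, A (b i) = (t i : ℂ) • b i)
    (hker : ∀ x, (∀ i, inner ℂ (b i) x = 0) → A x = 0) :
    entropy β A = ((∑ i, β (t i) : ℝ) : EReal) := by
  obtain ⟨hp, hn⟩ := posTrace_parts_eq_sum (B := cfc β A) (cfc_predicate β A) hb
    (fun i => cfc_apply_eigenvector hA hβ (ht i)) fun x hx => by
      have := cfc_apply_eigenvector hA hβ (t := 0) (v := x) (by simp [hker x hx])
      rwa [hβ0, Complex.ofReal_zero, zero_smul] at this
  rw [entropy, saTrace, hp, hn, ← ENNReal.ofReal_sum_of_nonneg fun i _ => posPart_nonneg _,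
    ← ENNReal.ofReal_sum_of_nonneg fun i _ => negPart_nonneg _, EReal.coe_ennreal_ofReal,
    EReal.coe_ennreal_ofReal, max_eq_left (Finset.sum_nonneg fun i _ => posPart_nonneg _),
    max_eq_left (Finset.sum_nonneg fun i _ => negPart_nonneg _), ← EReal.coe_sub,
    ← Finset.sum_sub_distrib]
  simp_rw [posPart_sub_negPart]

section Equidistributed

variable {a : ℝ} {G : Submodule ℂ H} [FiniteDimensional ℂ G]

lemma posTrace_equidistributed (ha : 0 ≤ a) (hG : 0 < Module.finrank ℂ G) :
    posTrace (equidistributed a G) = ENNReal.ofReal a := by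
  have hpos := isPositive_equidistributed (G := G) ha
  have hN : (0 : ℝ) < Module.finrank ℂ G := Nat.cast_pos.2 hG
  obtain ⟨b, t, hb, hbG, -, -, hker⟩ := exists_eigenbasis_of_mapsTo hpos.isSymmetric G
    equidistributed_apply_mem
  rw [posTrace_eq_sum hpos hb (fun i => equidistributed_apply (hbG i)) hker,
    ← ENNReal.ofReal_sum_of_nonneg fun i _ => by positivity]
  simp [mul_div_cancel₀ _ hN.ne']

/-- The equidistributed state is the unique minimizer of the entropy among the states supported
in a finite-dimensional space. -/
theorem entropy_equidistributed_le (ha : 0 < a) (hG : 0 < Module.finrank ℂ G)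
    {β : ℝ → ℝ} (hβ : ContinuousOn β (Icc 0 a)) (hβc : StrictConvexOn ℝ (Icc 0 a) β)
    (hβ0 : β 0 = 0) {A : H →L[ℂ] H} (hA : A.IsPositive) (htr : posTrace A = ENNReal.ofReal a)
    (hAG : ∀ x, A x ∈ G) : entropy β (equidistributed a G) ≤ entropy β A ∧
      (entropy β A ≤ entropy β (equidistributed a G) → A = equidistributed a G) := by
  have hN : (0 : ℝ) < Module.finrank ℂ G := Nat.cast_pos.2 hG
  have hsp : ∀ {B : H →L[ℂ] H}, B.IsPositive → posTrace B = ENNReal.ofReal a →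
      ContinuousOn β (spectrum ℝ B) := fun hB htr => hβ.mono (spectrum_subset_Icc hB ha.le htr)
  obtain ⟨b, t, hb, hbG, hbt, hzero, hker⟩ := exists_eigenbasis_of_mapsTo hA.isSymmetric G hAG
  have ht0 : ∀ i, 0 ≤ t i := fun i => by
    have h1 := hA.re_inner_nonneg_right (b i)
    rw [hbt, inner_smul_right, inner_self_eq_norm_sq_to_K, hb.1 i] at h1
    simpa using h1
  have hsum : ∑ i, t i = a := by
    rw [posTrace_eq_sum hA hb hbt hker, ← ENNReal.ofReal_sum_of_nonneg fun i _ => ht0 i] at htr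
    exact (ENNReal.ofReal_eq_ofReal_iff (Finset.sum_nonneg fun i _ => ht0 i) ha.le).1 htr
  have hta : ∀ i, t i ∈ Icc 0 a := fun i =>
    ⟨ht0 i, hsum ▸ Finset.single_le_sum (fun j _ => ht0 j) (Finset.mem_univ i)⟩
  have hmean : ∑ i, (Module.finrank ℂ G : ℝ)⁻¹ • t i = a / Module.finrank ℂ G := by
    rw [← Finset.smul_sum, hsum, smul_eq_mul, div_eq_inv_mul]
  have hw : ∑ _i : Fin (Module.finrank ℂ G), (Module.finrank ℂ G : ℝ)⁻¹ = 1 := by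
    simp [hN.ne']
  have hpos := isPositive_equidistributed (G := G) ha.le
  have hkerE : ∀ x, (∀ i, inner ℂ (b i) x = 0) → equidistributed a G x = 0 := fun x hx =>
    hzero _ (equidistributed_apply_mem x) fun i => by
      have := hpos.isSymmetric (b i) x
      simp only [ContinuousLinearMap.coe_coe] at this
      rw [← this, equidistributed_apply (hbG i), inner_smul_left, hx i, mul_zero]
  have hSA := entropy_eq_sum hA.isSelfAdjoint (hsp hA htr) hβ0 hb hbt hker
  have hSE := entropy_eq_sum hpos.isSelfAdjoint (hsp hpos (posTrace_equidistributed ha.le hG)) hβ0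
    hb (fun i => equidistributed_apply (hbG i)) hkerE
  have hval : ∑ _i : Fin (Module.finrank ℂ G), β (a / Module.finrank ℂ G) =
      Module.finrank ℂ G * β (a / Module.finrank ℂ G) := by simp
  have hval' : ∑ i, (Module.finrank ℂ G : ℝ)⁻¹ • β (t i) =
      (Module.finrank ℂ G : ℝ)⁻¹ * ∑ i, β (t i) := by rw [← Finset.smul_sum, smul_eq_mul]
  -- Jensen with equal weights: the eigenvalues have mean `a / dim G`. The equality case for
  -- strictly convex `β` then makes them all equal.
  have hle := hβc.convexOn.map_sum_le (fun _ _ => (inv_pos.2 hN).le) hw fun i _ => hta i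
  rw [hmean, hval'] at hle
  have heq := hβc.map_sum_eq_iff (fun _ _ => inv_pos.2 hN) hw fun i _ => hta i
  rw [hmean, hval'] at heq
  have hle' : Module.finrank ℂ G * β (a / Module.finrank ℂ G) ≤ ∑ i, β (t i) := by
    rwa [← div_eq_inv_mul, le_div_iff₀' hN] at hle
  rw [hSA, hSE, hval, EReal.coe_le_coe_iff, EReal.coe_le_coe_iff]
  refine ⟨hle', fun h => ?_⟩
  have hti : ∀ i, t i = a / Module.finrank ℂ G := fun i => heq.1 (by
    rw [← le_antisymm hle' h, inv_mul_cancel_left₀ hN.ne']) i (Finset.mem_univ i)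
  ext1 x
  refine sub_eq_zero.1 (hzero _ (G.sub_mem (hAG x) (equidistributed_apply_mem x)) fun i => ?_)
  have h1 := hA.isSymmetric (b i) x
  have h2 := hpos.isSymmetric (b i) x
  simp only [ContinuousLinearMap.coe_coe] at h1 h2
  rw [inner_sub_right, ← h1, ← h2, hbt, equidistributed_apply (hbG i), hti, sub_self]

end Equidistributed

end FiniteRank

/-! ### States of lowest energy and reduction of the constrained problem -/

variable {d : ℕ} {V : Space d → ℝ} {β : ℝ → ℝ} {a T Tc : ℝ} {ρ : ℝ → Op d} {ϱ : Op d}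

section GroundStates

variable {K : Type*} [NormedAddCommGroup K] [InnerProductSpace ℂ K] {D : Submodule ℂ (L2 d)}
  {Γ : L2 d →ₗ[ℂ] K} {E : ℝ}

/-- The difference `E(ϱ) - E a` is the sum of the nonnegative terms `r_p (‖Γφ_p‖² - E)`; if it
vanishes, so does each of them. -/
lemma mul_le_energy (hd : 1 ≤ d) (hV : ∀ x, 0 ≤ V x) (hVm : AEStronglyMeasurable V volume)
    (ha : 0 < a) (hΓ : IsFormOf (energyForm V) D Γ) (hlow : ∀ f ∈ D, E * ‖f‖ ^ 2 ≤ ‖Γ f‖ ^ 2)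
    (h : ϱ ∈ statesFinite V a) : E * a ≤ (energy V ϱ).toReal ∧
      ((energy V ϱ).toReal = E * a → ∀ p, 0 < eigval ϱ p → eigvec ϱ p ∈ formEigenspace D Γ E) := by
  have hdens := h.1.1.1
  have hD := diagonalizes_eig hd hdens
  obtain ⟨hmem, hsum⟩ := hasSum_energy hd hV hVm hdens h.2 hD hΓ
  have htr := hasSum_eigval hd hdens
  rw [h.1.2, ENNReal.toReal_ofReal ha.le] at htr
  have hdiff := hsum.sub (htr.mul_left E)
  have hnn : ∀ p, 0 ≤ eigval ϱ p * ‖Γ (eigvec ϱ p)‖ ^ 2 - E * eigval ϱ p := fun p => by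
    rcases (hD.1 p).eq_or_lt with hp | hp
    · simp [← hp]
    · have h1 := hlow _ (hmem p hp)
      rw [hD.2.1.1 p, one_pow, mul_one] at h1
      have h2 := mul_le_mul_of_nonneg_left h1 hp.le
      linarith
  refine ⟨sub_nonneg.1 (hdiff.nonneg hnn), fun heq p hp => ?_⟩
  rw [heq, sub_self, hasSum_zero_iff_of_nonneg hnn] at hdiff
  have h1 := congrFun hdiff p
  refine mem_formEigenspace_of_norm_sq_eq hlow (hmem p hp) ?_
  rw [hD.2.1.1 p, one_pow, mul_one]
  have h2 : eigval ϱ p * (‖Γ (eigvec ϱ p)‖ ^ 2 - E) = 0 := by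
    simp only [Pi.zero_apply] at h1
    linarith
  exact sub_eq_zero.1 ((mul_eq_zero.1 h2).resolve_left hp.ne')

lemma apply_mem_of_energy_eq (hd : 1 ≤ d) (hV : ∀ x, 0 ≤ V x)
    (hVm : AEStronglyMeasurable V volume) (ha : 0 < a) (hΓ : IsFormOf (energyForm V) D Γ)
    (hlow : ∀ f ∈ D, E * ‖f‖ ^ 2 ≤ ‖Γ f‖ ^ 2) [FiniteDimensional ℂ (formEigenspace D Γ E)]
    (h : ϱ ∈ statesFinite V a) (heq : (energy V ϱ).toReal = E * a) (f : L2 d) :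
    ϱ f ∈ formEigenspace D Γ E := by
  have hD := diagonalizes_eig hd h.1.1.1
  have hmem := (mul_le_energy hd hV hVm ha hΓ hlow h).2 heq
  have hcl : IsClosed (formEigenspace D Γ E : Set (L2 d)) :=
    (formEigenspace D Γ E).closed_of_finiteDimensional
  refine hcl.mem_of_tendsto (hD.2.2 f) (Eventually.of_forall fun s => ?_)
  refine Submodule.sum_mem _ fun p _ => ?_
  rcases (hD.1 p).eq_or_lt with hp | hp
  · simp [← hp]
  · exact Submodule.smul_mem _ _ (hmem p hp)

lemma energy_eq_of_apply_mem (hd : 1 ≤ d) (hV : ∀ x, 0 ≤ V x)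
    (hVm : AEStronglyMeasurable V volume) (ha : 0 < a) (hΓ : IsFormOf (energyForm V) D Γ)
    (hpos : ϱ.IsPositive) (htr : posTrace ϱ = ENNReal.ofReal a)
    (hG : ∀ f, ϱ f ∈ formEigenspace D Γ E) :
    ϱ ∈ statesFinite V a ∧ energy V ϱ = ENNReal.ofReal (E * a) := by
  have hdens : IsDensityOperator ϱ := ⟨hpos, htr.trans_lt ENNReal.ofReal_lt_top⟩
  have hD := diagonalizes_eig hd hdens
  have hmem : ∀ p, 0 < eigval ϱ p → eigvec ϱ p ∈ formEigenspace D Γ E := fun p hp => by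
    have h1 : eigvec ϱ p = (eigval ϱ p : ℂ)⁻¹ • ϱ (eigvec ϱ p) := by
      rw [hD.apply_eigvec, smul_smul, inv_mul_cancel₀ (Complex.ofReal_ne_zero.2 hp.ne'), one_smul]
    rw [h1]
    exact Submodule.smul_mem _ _ (hG _)
  have hsum := hasSum_eigval hd hdens
  rw [htr, ENNReal.toReal_ofReal ha.le] at hsum
  have hE : energy V ϱ = ENNReal.ofReal (E * a) := by
    refine energy_eq_ofReal_of_hasSum hd hV hVm hdens hD hΓ (fun p hp => (hmem p hp).1)
      ((hsum.mul_left E).congr_fun fun p => ?_)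
    rcases (hD.1 p).eq_or_lt with hp | hp
    · simp [← hp]
    · rw [norm_sq_of_mem_formEigenspace (hmem p hp), hD.2.1.1 p]
      ring
  have hfin : energy V ϱ < ⊤ := hE ▸ ENNReal.ofReal_lt_top
  exact ⟨⟨⟨⟨hdens, (formTrace_kineticForm_le V ϱ).trans_lt hfin⟩, htr⟩, hfin⟩, hE⟩

end GroundStates

/-- With total current `J`, the boost by `-J/a` would lower the energy by `|J|²/a`. -/
lemma integral_current_eq_zero_of_isMinOn (hd : 1 ≤ d) (hV : ∀ x, 0 ≤ V x)
    (hVm : AEStronglyMeasurable V volume) (ha : 0 < a) (h : ϱ ∈ statesFinite V a)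
    (hmin : IsMinOn (energy V) (statesFinite V a) ϱ) : ∫ x, current ϱ x = 0 := by
  set J := ∫ x, current ϱ x
  obtain ⟨hfin, hval⟩ := energy_gauge_aux hd hV hVm h.1.1 h.2 (-(a⁻¹ • J))
  have h1 : energy V ϱ ≤ energy V (gauge (-(a⁻¹ • J)) ϱ) :=
    hmin (show gauge (-(a⁻¹ • J)) ϱ ∈ statesFinite V a from
      ⟨⟨energySpace_gauge hd h.1.1 _, (posTrace_gauge hd h.1.1.1 _).trans h.1.2⟩, hfin⟩)
  have h2 := ENNReal.toReal_mono hfin.ne h1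
  rw [hval, h.1.2, ENNReal.toReal_ofReal ha.le, inner_neg_left, real_inner_smul_left,
    real_inner_self_eq_norm_sq, norm_neg, norm_smul, mul_pow, norm_inv, Real.norm_of_nonneg ha.le]
    at h2
  have h3 : (a⁻¹) ^ 2 * ‖J‖ ^ 2 * a = a⁻¹ * ‖J‖ ^ 2 := by field_simp
  have h4 : a⁻¹ * ‖J‖ ^ 2 ≤ 0 := by linarith
  have h5 : ‖J‖ ^ 2 ≤ 0 := nonpos_of_mul_nonpos_right h4 (inv_pos.2 ha)
  simpa using le_antisymm h5 (by positivity)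

lemma entropy_gauge (ha : 0 ≤ a) (hβ : ContinuousOn β (Icc 0 a)) (hpos : ϱ.IsPositive)
    (htr : posTrace ϱ = ENNReal.ofReal a) (b : Space d) :
    entropy β (gauge b ϱ) = entropy β ϱ := by
  rw [gauge_eq_conj]
  exact entropy_conj hpos.isSelfAdjoint (hβ.mono (spectrum_subset_Icc hpos ha htr))
    (phaseOp_mem_unitary b)

/-- Removing the current by a gauge transformation: the constrained problem reduces to the
minimization of the entropy at fixed energy. -/
lemma isUniqueMinimizer_gauge (hd : 1 ≤ d) (hV : ∀ x, 0 ≤ V x)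
    (hVm : AEStronglyMeasurable V volume) (ha : 0 < a) (hβ : ContinuousOn β (Icc 0 a)) {c : ℝ}
    {b : Space d} (h : ϱ ∈ statesFinite V a) (hu : ∫ x, current ϱ x = 0)
    (hE : energy V ϱ + ENNReal.ofReal (‖b‖ ^ 2 / a) = ENNReal.ofReal c)
    (hmin : ∀ τ ∈ statesFinite V a, energy V τ = energy V ϱ → entropy β ϱ ≤ entropy β τ ∧
      (entropy β τ ≤ entropy β ϱ → τ = ϱ)) :
    IsUniqueMinimizer (entropy β) (statesGlobal V a b c) (gauge (a⁻¹ • b) ϱ) := by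
  have hmem := gauge_mem_statesGlobal hd hV hVm ha h hu hE
  have hSϱ := entropy_gauge ha.le hβ h.1.1.1.1 h.1.2 (a⁻¹ • b)
  -- Pulled back by the gauge, `σ` has the trace and energy of `ϱ` and the entropy of `σ`, so `hmin`
  -- applies to it.
  have key : ∀ σ ∈ statesGlobal V a b c, entropy β ϱ ≤ entropy β σ ∧
      (entropy β σ ≤ entropy β ϱ → σ = gauge (a⁻¹ • b) ϱ) := by
    intro σ hσ
    obtain ⟨h1, h2⟩ := gauge_mem_statesFinite hd hV hVm ha hσ
    rw [← hE] at h2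
    have h3 := hmin _ h1 ((ENNReal.add_left_inj ENNReal.ofReal_ne_top).1 h2)
    have hσ' := (mem_statesGlobal_iff hd hVm).1 hσ
    rw [entropy_gauge ha.le hβ hσ'.1.1.1 hσ'.2.1] at h3
    refine ⟨h3.1, fun h4 => ?_⟩
    rw [← h3.2 h4, gauge_gauge, add_neg_cancel, gauge_zero]
  refine ⟨⟨hmem, fun σ hσ => ?_⟩, fun σ hσ hσmin => (key σ hσ).2 ?_⟩
  · change entropy β (gauge (a⁻¹ • b) ϱ) ≤ entropy β σ
    rw [hSϱ]
    exact (key σ hσ).1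
  · rw [← hSϱ]
    exact hσmin hmem

lemma IsUniqueMinimizer.existsUnique {α γ : Type*} [Preorder γ] {f : α → γ} {s : Set α} {x : α}
    (h : IsUniqueMinimizer f s x) : ∃! y, y ∈ s ∧ IsMinOn f s y :=
  ⟨x, h.1, fun y hy => h.2 y hy.1 hy.2⟩

/-- The entropies may be infinite here, so only the real energy and the positive real factor `T` are
cancelled. -/
lemma freeEnergy_le_iff_entropy_le {σ : Op d} (hT : 0 < T) (hϱ : energy V ϱ < ⊤)
    (hE : energy V σ = energy V ϱ) :
    freeEnergy V β T ϱ ≤ freeEnergy V β T σ ↔ entropy β ϱ ≤ entropy β σ := by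
  rw [freeEnergy, freeEnergy, hE, coe_ennreal_eq_coe_toReal hϱ]
  have hT' : ∀ t : ℝ, 0 < t → ∀ x y : EReal, x ≤ y → (t : EReal) * x ≤ t * y :=
    fun t ht x y h => mul_le_mul_of_nonneg_left h (EReal.coe_nonneg.2 ht.le)
  refine ⟨fun h => ?_, fun h => add_le_add le_rfl (hT' T hT _ _ h)⟩
  have h1 := hT' T⁻¹ (inv_pos.2 hT) _ _ ((EReal.addLECancellable_coe _).add_le_add_iff_left.1 h)
  rwa [← mul_assoc, ← mul_assoc, ← EReal.coe_mul, inv_mul_cancel₀ hT.ne', EReal.coe_one, one_mul,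
    one_mul] at h1

namespace MonotoneInTemperature

/-- At equal energy, with `T > Tc ≥ 0`, comparing `F_T` is comparing `S`; a competitor with no
larger entropy is again a minimizer of `F_T`, hence `ρ T`. -/
lemma entropy_le_of_energy_eq (hA : MonotoneInTemperature V β a Tc ρ) (hT : Tc < T) :
    ∀ τ ∈ statesFinite V a, energy V τ = energy V (ρ T) → entropy β (ρ T) ≤ entropy β τ ∧
      (entropy β τ ≤ entropy β (ρ T) → τ = ρ T) := by
  intro τ hτ hE
  have hT0 := hA.Tc_nonneg.trans_lt hT
  have hmin := hA.minimizer T hT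
  refine ⟨(freeEnergy_le_iff_entropy_le hT0 hmin.1.1.2 hE).1 (hmin.1.2 hτ), fun h => ?_⟩
  refine hmin.2 τ hτ fun σ hσ => ?_
  have h1 : freeEnergy V β T (ρ T) ≤ freeEnergy V β T σ := hmin.1.2 hσ
  exact le_trans ((freeEnergy_le_iff_entropy_le hT0 hτ.2 hE.symm).2 h) h1

lemma exists_energy_eq (hA : MonotoneInTemperature V β a Tc ρ) {e : ℝ≥0∞}
    (he : ENNReal.ofReal (groundEnergy V * a) < e) (he' : e < ⊤) :
    ∃ T, Tc < T ∧ energy V (ρ T) = e := by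
  obtain ⟨T₁, hT₁, h₁⟩ := ((hA.energy_Tc.eventually_lt_const he).and self_mem_nhdsWithin).exists
  obtain ⟨T₂, hT₂, h₂⟩ :=
    ((hA.energy_atTop.eventually_const_lt he').and (eventually_gt_atTop Tc)).exists
  obtain ⟨T, hT, h⟩ := isPreconnected_Ioi.intermediate_value h₁ h₂ hA.energy_continuous
    ⟨hT₁.le, hT₂.le⟩
  exact ⟨T, hT, h⟩

end MonotoneInTemperature

end QuantumEntropy

/-! ### The two cases: energy at the ground level, and above it -/

open QuantumEntropy in
theorem proposition3 {d : ℕ} (hd : 1 ≤ d)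
    (V : EuclideanSpace ℝ (Fin d) → ℝ) (hV_nonneg : ∀ x, 0 ≤ V x)
    (hV_loc : ∀ K : Set (EuclideanSpace ℝ (Fin d)), IsCompact K → MemLp V 2 (volume.restrict K))
    (hV_lim : Tendsto V (cocompact (EuclideanSpace ℝ (Fin d))) atTop)
    (a : ℝ) (ha : 0 < a)
    (β : ℝ → ℝ) (hβ_cont : ContinuousOn β (Icc 0 a)) (hβ_conv : StrictConvexOn ℝ (Icc 0 a) β)
    (hβ_zero : β 0 = 0)
    (Tc : ℝ) (ρ : ℝ → Op d) (hA : MonotoneInTemperature V β a Tc ρ)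
    (b : EuclideanSpace ℝ (Fin d)) (c : ℝ) (hc : a * groundEnergy V + ‖b‖ ^ 2 / a ≤ c) :
    (∃! σ : Op d, σ ∈ statesGlobal V a b c ∧ IsMinOn (entropy β) (statesGlobal V a b c) σ) ∧
    ∃ T : ℝ, Tc ≤ T ∧
      (∃ ϱ : Op d, IsGibbsState V β a Tc T ϱ ∧
        energy V ϱ + ENNReal.ofReal (‖b‖ ^ 2 / a) = ENNReal.ofReal c ∧
        IsUniqueMinimizer (entropy β) (statesGlobal V a b c) (gauge (a⁻¹ • b) ϱ)) ∧
      ∀ (T' : ℝ) (ϱ' : Op d), IsGibbsState V β a Tc T' ϱ' →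
        energy V ϱ' + ENNReal.ofReal (‖b‖ ^ 2 / a) = ENNReal.ofReal c → T' = T := by
  have hVm := aestronglyMeasurable_of_memLp_compact hV_loc
  obtain ⟨Γ, hΓ, hin⟩ := exists_isFormOf_energyForm hV_nonneg hVm
  obtain ⟨⟨v, hv, hv0⟩, hlow, hfin⟩ := hA.ground_state hd hV_nonneg hVm ha hβ_cont hΓ hin
  have hE0 : 0 ≤ groundEnergy V := by
    have h1 := norm_sq_of_mem_formEigenspace hv
    have h2 : 0 ≤ groundEnergy V * ‖v‖ ^ 2 := h1 ▸ by positivity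
    exact nonneg_of_mul_nonneg_left h2 (by positivity)
  have hk : 0 ≤ ‖b‖ ^ 2 / a := by positivity
  -- `e` is the energy left after removing the kinetic energy `|b|²/a` of the drift.
  obtain ⟨e, rfl⟩ : ∃ e, e + ‖b‖ ^ 2 / a = c := ⟨c - ‖b‖ ^ 2 / a, sub_add_cancel _ _⟩
  have he : groundEnergy V * a ≤ e := by linarith
  have hga : 0 ≤ groundEnergy V * a := by positivity
  have he0 : 0 ≤ e := hga.trans he
  have hiff : ∀ x : ℝ≥0∞, x + ENNReal.ofReal (‖b‖ ^ 2 / a) = ENNReal.ofReal (e + ‖b‖ ^ 2 / a) ↔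
      x = ENNReal.ofReal e := fun x => by
    rw [ENNReal.ofReal_add he0 hk, ENNReal.add_left_inj ENNReal.ofReal_ne_top]
  have hge : ∀ τ ∈ statesFinite V a, ENNReal.ofReal (groundEnergy V * a) ≤ energy V τ :=
    fun τ hτ => (ENNReal.ofReal_le_iff_le_toReal hτ.2.ne).2
      (mul_le_energy hd hV_nonneg hVm ha hΓ hlow hτ).1
  have hGibbs : ∀ T' ϱ', Tc < T' → IsGibbsState V β a Tc T' ϱ' → ϱ' = ρ T' := by
    rintro T' ϱ' hT' ⟨hϱ', ⟨-, hmin⟩ | ⟨rfl, -⟩⟩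
    · exact (hA.minimizer T' hT').2 ϱ' hϱ' hmin
    · exact absurd hT' (lt_irrefl _)
  have hTc : ∀ T' ϱ', IsGibbsState V β a Tc T' ϱ' → Tc ≤ T' := by
    rintro T' ϱ' ⟨-, ⟨hT', -⟩ | ⟨rfl, -⟩⟩
    exacts [hT'.le, le_rfl]
  suffices h : ∃ T : ℝ, Tc ≤ T ∧
      (∃ ϱ : Op d, IsGibbsState V β a Tc T ϱ ∧
        energy V ϱ + ENNReal.ofReal (‖b‖ ^ 2 / a) = ENNReal.ofReal (e + ‖b‖ ^ 2 / a) ∧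
        IsUniqueMinimizer (entropy β) (statesGlobal V a b (e + ‖b‖ ^ 2 / a))
          (gauge (a⁻¹ • b) ϱ)) ∧
      ∀ (T' : ℝ) (ϱ' : Op d), IsGibbsState V β a Tc T' ϱ' →
        energy V ϱ' + ENNReal.ofReal (‖b‖ ^ 2 / a) = ENNReal.ofReal (e + ‖b‖ ^ 2 / a) →
        T' = T by
    refine ⟨?_, h⟩
    obtain ⟨T, -, ⟨ϱ, -, -, h⟩, -⟩ := h
    exact h.existsUnique
  rcases he.eq_or_lt with rfl | he
  · set G := formEigenspace (formDomain hV_nonneg hVm) Γ (groundEnergy V)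
    have hG : 0 < Module.finrank ℂ G :=
      Module.finrank_pos_iff_exists_ne_zero.2 ⟨⟨v, hv⟩, fun h => hv0 (congrArg Subtype.val h)⟩
    obtain ⟨hmem, hE⟩ := energy_eq_of_apply_mem hd hV_nonneg hVm ha hΓ
      (isPositive_equidistributed ha.le) (posTrace_equidistributed ha.le hG)
      (E := groundEnergy V) equidistributed_apply_mem
    have hmin : IsMinOn (energy V) (statesFinite V a) (equidistributed a G) := fun τ hτ => by
      change energy V (equidistributed a G) ≤ energy V τ
      rw [hE]
      exact hge τ hτ
    refine ⟨Tc, le_rfl, ⟨equidistributed a G, ⟨hmem, Or.inr ⟨rfl, hmin⟩⟩, (hiff _).2 hE,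
      isUniqueMinimizer_gauge hd hV_nonneg hVm ha hβ_cont hmem
        (integral_current_eq_zero_of_isMinOn hd hV_nonneg hVm ha hmem hmin) ((hiff _).2 hE)
        fun τ hτ hτE => ?_⟩, fun T' ϱ' h h' => ?_⟩
    · refine entropy_equidistributed_le ha hG hβ_cont hβ_conv hβ_zero hτ.1.1.1.1 hτ.1.2
        (apply_mem_of_energy_eq hd hV_nonneg hVm ha hΓ hlow hτ ?_)
      rw [hτE, hE, ENNReal.toReal_ofReal hga]
    · refine ((hTc T' ϱ' h).eq_or_lt.resolve_right fun hT' => ?_).symm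
      rw [hiff, hGibbs T' ϱ' hT' h] at h'
      obtain ⟨t, ht, htT⟩ := exists_between hT'
      have h1 := hA.energy_strictMono ht hT' htT
      simp only [h'] at h1
      exact absurd (hge _ (hA.minimizer t ht).1.1) (not_le.2 h1)
  · have he' : ENNReal.ofReal (groundEnergy V * a) < ENNReal.ofReal e :=
      (ENNReal.ofReal_lt_ofReal_iff_of_nonneg hga).2 he
    obtain ⟨T, hT, hTE⟩ := hA.exists_energy_eq he' ENNReal.ofReal_lt_top
    have hmin := (hA.minimizer T hT).1
    refine ⟨T, hT.le, ⟨ρ T, ⟨hmin.1, Or.inl ⟨hT, hmin.2⟩⟩, (hiff _).2 hTE,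
      isUniqueMinimizer_gauge hd hV_nonneg hVm ha hβ_cont hmin.1
        (integral_eq_zero_of_ae (hA.current_eq_zero T hT)) ((hiff _).2 hTE)
        (hA.entropy_le_of_energy_eq hT)⟩, fun T' ϱ' h h' => ?_⟩
    rw [hiff] at h'
    rcases (hTc T' ϱ' h).eq_or_lt with rfl | hT'
    · obtain ⟨-, ⟨hlt, -⟩ | ⟨-, hmin'⟩⟩ := h
      · exact absurd hlt (lt_irrefl _)
      -- A Gibbs state at `Tc` has energy at most that of every `ρ t`, hence at most their limit as
      -- `t` decreases to `Tc`.
      · have h1 : energy V ϱ' ≤ ENNReal.ofReal (groundEnergy V * a) :=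
          ge_of_tendsto hA.energy_Tc (eventually_nhdsWithin_of_forall fun t ht =>
            hmin' (hA.minimizer t ht).1.1)
        rw [h'] at h1
        exact absurd h1 (not_le.2 he')
    · rw [hGibbs T' ϱ' hT' h, ← hTE] at h'
      exact hA.energy_strictMono.injOn hT' hT h'
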